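/- Let $K$ be a field. An $n\times n$ matrix $A$ over $K$ is $s$-quasiseparable if for every $1\le k\le n$ the submatrices $A_{1..k,\,k+1..n}$ and $A_{k+1..n,\,1..k}$ have rank at most $s$. Let $J_n$ be the anti-identity matrix, and let $\mathrm{Left}(X)$ be obtained from $X\in K^{n\times n}$ by replacing the entries $X_{i,j}$ with $i+j>n$ by $0$. A matrix is $t$-overlapping in columns (resp. rows) if among any $t+1$ of its non-zero columns (resp. rows) there is one whose leading non-zero entry is strictly below (resp. after) the trailing non-zero entry of another. A *$t$-Bruhat generator* of $A$ consists of a diagonal matrix $D$ and matrices $C_L,R_L,E_L,C_U,R_U,E_U$ such that $C_L,C_U$ (with $n$ rows) are in column echelon form of full column rank and $t$-overlapping in columns, $E_L,E_U$ (with $n$ columns) are in row echelon form of full row rank and $t$-overlapping in rows, $R_L,R_U$ are permutation matrices, and $$A=D+J_n\,\mathrm{Left}(C_LR_LE_L)+\mathrm{Left}(C_UR_UE_U)\,J_n .$$ Its dimensions, its permutations and the positions of the first and last non-zero entry of each column of the $C$'s and each row of the $E$'s are combinatorial data that are available for free; its entries are field elements. Algorithms are (families of) algebraic computation trees over $K$;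 the cost is the number of field operations performed in the worst case: arithmetic operations $+,-,\times,/$ and zero tests. Let $\omega>2$ and $C_\omega,C_{\mathrm{RF}}>0$ be such that * $C+AB$ for $n\times n$ matrices can be computed in $(1+o(1))\,C_\omega n^\omega$ field operations, as $n\to\infty$; * a CRE decomposition $A=CRE$ ($C$ and $E$ in column and row echelon form with $r$ columns and $r$ rows, $R$ an $r\times r$ permutation matrix) of a matrix $A\in K^{m\times n}$ of rank $r$ (not known beforehand) can be computed in $(1+o(1))\,C_{\mathrm{RF}}\,mnr^{\omega-2}$ field operations, as $m,n,r\to\infty$. **Proposition (Bruhat sum).** There is an algorithm that, given an $s_A$-Bruhat generator of an $s_A$-quasiseparable matrix $A\in K^{n\times n}$ and an $s_B$-Bruhat generator of an $s_B$-quasiseparable matrix $B\in K^{n\times n}$, computes a generator of $A+B$ that is an $(s_A+s_B)$-Bruhat generator, and even a $t$-Bruhat generator for every $t$ such that $A+B$ is $t$-quasiseparable. With $s=s_A+s_B\geq 1$, it uses at most $$(1+o(1))\left(\frac{9\cdot 2^{\omega-2}-8}{2^{\omega-2}-1}\,C_\omega+2\,C_{\mathrm{RF}}\right)n\,s^{\omega-1}\log_2\frac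 ns$$ field operations, where $o(1)\to0$ as $n/s\to\infty$: for every $\varepsilon>0$ there is $N$ such that for all $s_A,s_B,n$ with $s\ge1$ and $n\ge Ns$ the cost is at most $(1+\varepsilon)$ times the displayed expression without the factor $1+o(1)$. -/

import Mathlib

universe u v

/-! ### Algebraic computation trees with operation count -/

/-- The four arithmetic operations of a field. -/
inductive ArithOp where
  | add
  | sub
  | mul
  | div

open Classical in
/-- Value of an arithmetic operation; dividing by zero is an error. -/
noncomputable def ArithOp.eval {K : Type u} [Field K] : ArithOp → K → K → Option K
  | .add, x, y => some (x + y)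
  | .sub, x, y => some (x - y)
  | .mul, x, y => some (x * y)
  | .div, x, y => if y = 0 then none else some (x / y)

/-- Algebraic computation trees over `K` with results in `β`. The memory is a list of field
elements to which every computed value or constant is appended; the rest of the tree receives the
*address* of the new cell, never its content. The only way in which the content of the memory can
influence the control flow is the zero test. -/
inductive Prog (K : Type u) (β : Type v) : Type (max u v) where
  /-- stop with result `b` -/
  | ret (b : β)
  /-- load a constant -/
  | const (c : K) (next : ℕ → Prog K β)
  /-- apply an operation to the cells with addresses `a` and `b` -/
  | arith (o : ArithOp) (a b : ℕ) (next : ℕ → Prog K β)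
  /-- branch on whether the cell with address `a` contains zero -/
  | test (a : ℕ) (ifZero ifNonzero : Prog K β)

/-- Result of a terminated run: the returned value, the final memory, and the number of field
operations (arithmetic operations and zero tests) that were executed. -/
structure Outcome (K : Type u) (β : Type v) where
  result : β
  memory : List K
  cost : ℕ

/-- Count one more field operation. -/
def Outcome.charge {K : Type u} {β : Type v} (out : Outcome K β) : Outcome K β :=
  { out with cost := out.cost + 1 }

open Classical in
/-- Run a computation tree on a memory. The run fails (`none`) if it divides by zero or reads an
address that is not in use. Each arithmetic operation and each zero test costs `1`. -/
noncomputable def Prog.run {K : Type u} [Field K] {β : Type v} :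
    Prog K β → List K → Option (Outcome K β)
  | .ret b, mem => some ⟨b, mem, 0⟩
  | .const c next, mem => (next mem.length).run (mem ++ [c])
  | .arith o a b next, mem =>
      (mem[a]?).bind fun x => (mem[b]?).bind fun y => (o.eval x y).bind fun z =>
        ((next mem.length).run (mem ++ [z])).map Outcome.charge
  | .test a p q, mem =>
      (mem[a]?).bind fun x =>
        (if x = 0 then p.run mem else q.run mem).map Outcome.charge

/-! ### Matrix multiplication and CRE decomposition -/

/-- The memory `mem` contains the entries of the matrix `M` at the addresses given by `a`. -/
def MatrixStored {K : Type u} {m n : ℕ} (mem : List K) (a : Matrix (Fin m) (Fin n) ℕ)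
    (M : Matrix (Fin m) (Fin n) K) : Prop :=
  ∀ i j, mem[a i j]? = some (M i j)

/-- `ω` is a feasible exponent for square matrix multiplication over `K` with leading constant
`Cω`: the operation `C + A * B` on `n × n` matrices is computed in
`Cω * n ^ ω + o(Cω * n ^ ω)` field operations. -/
def MatMulTime (K : Type u) [Field K] (ω Cω : ℝ) : Prop :=
  ∃ (alg : ∀ n : ℕ, Matrix (Fin n) (Fin n) ℕ → Matrix (Fin n) (Fin n) ℕ →
      Matrix (Fin n) (Fin n) ℕ → Prog K (Matrix (Fin n) (Fin n) ℕ))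
    (time : ℕ → ℕ),
    (∀ (n : ℕ) (A B C : Matrix (Fin n) (Fin n) K) (mem : List K)
        (aA aB aC : Matrix (Fin n) (Fin n) ℕ),
      MatrixStored mem aA A → MatrixStored mem aB B → MatrixStored mem aC C →
      ∃ out, (alg n aA aB aC).run mem = some out ∧
        MatrixStored out.memory out.result (C + A * B) ∧ out.cost ≤ time n) ∧
    ∀ ε : ℝ, 0 < ε → ∃ N : ℕ, ∀ n : ℕ, N ≤ n →
      (time n : ℝ) ≤ (1 + ε) * (Cω * (n : ℝ) ^ ω)

/-- Column echelon form with full column rank: every column has a leading non-zero entry, and the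
rows of these entries are strictly increasing. -/
def IsColEchelon {K : Type u} [Field K] {m r : ℕ} (C : Matrix (Fin m) (Fin r) K) : Prop :=
  ∃ p : Fin r → Fin m, StrictMono p ∧ ∀ l, C (p l) l ≠ 0 ∧ ∀ i, i < p l → C i l = 0

/-- Row echelon form with full row rank. -/
def IsRowEchelon {K : Type u} [Field K] {r n : ℕ} (E : Matrix (Fin r) (Fin n) K) : Prop :=
  IsColEchelon E.transpose

/-- `A = C * R * E` is a CRE decomposition: `C` and `E` are in column and row echelon form and `R`
is a permutation matrix. -/
def IsCRE {K : Type u} [Field K] {m n r : ℕ} (A : Matrix (Fin m) (Fin n) K)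
    (C : Matrix (Fin m) (Fin r) K) (R : Equiv.Perm (Fin r)) (E : Matrix (Fin r) (Fin n) K) : Prop :=
  IsColEchelon C ∧ IsRowEchelon E ∧ A = C * R.permMatrix K * E

/-- What a program computing a CRE decomposition returns: the rank `r`, the permutation `R`, and
the addresses of the entries of `C` and `E`. -/
structure CREAddr (m n : ℕ) where
  r : ℕ
  C : Matrix (Fin m) (Fin r) ℕ
  R : Equiv.Perm (Fin r)
  E : Matrix (Fin r) (Fin n) ℕ

/-- `CRF` is a leading constant for rank factorization by CRE decomposition over `K`: a CRE
decomposition of an `m × n` matrix of rank `r` is computed in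
`CRF * m * n * r ^ (ω - 2) + o(CRF * m * n * r ^ (ω - 2))` field operations (asymptotically in
`m`, `n`, `r`, where `r` is at most `m` and `n`; the rank is not known beforehand). -/
def CRETime (K : Type u) [Field K] (ω CRF : ℝ) : Prop :=
  ∃ (alg : ∀ m n : ℕ, Matrix (Fin m) (Fin n) ℕ → Prog K (CREAddr m n)) (time : ℕ → ℕ → ℕ → ℕ),
    (∀ (m n : ℕ) (A : Matrix (Fin m) (Fin n) K) (mem : List K) (aA : Matrix (Fin m) (Fin n) ℕ),
      MatrixStored mem aA A →
      ∃ (out : Outcome K (CREAddr m n)) (C : Matrix (Fin m) (Fin out.result.r) K)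
        (E : Matrix (Fin out.result.r) (Fin n) K),
        (alg m n aA).run mem = some out ∧
        MatrixStored out.memory out.result.C C ∧ MatrixStored out.memory out.result.E E ∧
        IsCRE A C out.result.R E ∧ out.cost ≤ time m n A.rank) ∧
    ∀ ε : ℝ, 0 < ε → ∃ N : ℕ, ∀ m n r : ℕ, N ≤ r → r ≤ m → r ≤ n →
      (time m n r : ℝ) ≤ (1 + ε) * (CRF * m * n * (r : ℝ) ^ (ω - 2))

/-! ### Quasiseparable matrices and Bruhat generators -/

/-- `A` is `s`-quasiseparable: for all `k`, the blocks of `A` above and to the right, respectively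
below and to the left, of the `k`-th diagonal position have rank at most `s`. -/
def IsQuasiseparable {K : Type u} [Field K] {n : ℕ} (s : ℕ) (A : Matrix (Fin n) (Fin n) K) : Prop :=
  ∀ k : ℕ, 1 ≤ k → k ≤ n →
    (A.submatrix (fun i : {i : Fin n // (i : ℕ) < k} => i.1)
      (fun j : {j : Fin n // k ≤ (j : ℕ)} => j.1)).rank ≤ s ∧
    (A.submatrix (fun i : {i : Fin n // k ≤ (i : ℕ)} => i.1)
      (fun j : {j : Fin n // (j : ℕ) < k} => j.1)).rank ≤ s

/-- Any `t + 1` non-zero columns contain one whose leading non-zero entry is strictly below the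
trailing non-zero entry of another one. -/
def ColOverlapping {K : Type u} [Field K] {m r : ℕ} (t : ℕ) (C : Matrix (Fin m) (Fin r) K) : Prop :=
  ∀ T : Finset (Fin r), T.card = t + 1 → (∀ l ∈ T, ∃ i, C i l ≠ 0) →
    ∃ a ∈ T, ∃ b ∈ T, ∀ i i', C i a ≠ 0 → C i' b ≠ 0 → i' < i

/-- Any `t + 1` non-zero rows contain one whose leading non-zero entry is strictly after the
trailing non-zero entry of another one. -/
def RowOverlapping {K : Type u} [Field K] {r n : ℕ} (t : ℕ) (E : Matrix (Fin r) (Fin n) K) : Prop :=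
  ColOverlapping t E.transpose

/-- The anti-identity matrix. -/
def antiIdentity (K : Type u) [Field K] (n : ℕ) : Matrix (Fin n) (Fin n) K :=
  Matrix.of fun i j => if j = i.rev then 1 else 0

/-- The Left operator: keep the entries strictly above the antidiagonal
(`i + j ≤ n` for indices starting at `1`). -/
def leftPart {K : Type u} [Field K] {n : ℕ} (A : Matrix (Fin n) (Fin n) K) :
    Matrix (Fin n) (Fin n) K :=
  Matrix.of fun i j => if (i : ℕ) + 1 + ((j : ℕ) + 1) ≤ n then A i j else 0

/-- The data `C`, `R`, `E` of a left Bruhat generator, with entries in `α`, together with the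
positions of the first and of the last non-zero entry of each column of `C` and each row of `E`
(which tell which entries of the sparse matrices `C` and `E` have to be stored).
With `α = K` this is a generator, with `α = ℕ` it gives the addresses of the entries of a generator
in the memory. -/
structure LeftBruhat (α : Type u) (n : ℕ) where
  r : ℕ
  C : Matrix (Fin n) (Fin r) α
  R : Equiv.Perm (Fin r)
  E : Matrix (Fin r) (Fin n) α
  cFirst : Fin r → Fin n
  cLast : Fin r → Fin n
  eFirst : Fin r → Fin n
  eLast : Fin r → Fin n

/-- Apply a function to the entries of a left Bruhat generator. -/
def LeftBruhat.map {α : Type u} {β : Type v} {n : ℕ} (f : α → β) (g : LeftBruhat α n) :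
    LeftBruhat β n where
  r := g.r
  C := g.C.map f
  R := g.R
  E := g.E.map f
  cFirst := g.cFirst
  cLast := g.cLast
  eFirst := g.eFirst
  eLast := g.eLast

/-- The entries of column `l` in rows `a` and `b` are the first and the last non-zero entry of that
column. -/
def IsColRange {K : Type u} [Field K] {m r : ℕ} (C : Matrix (Fin m) (Fin r) K) (l : Fin r)
    (a b : Fin m) : Prop :=
  C a l ≠ 0 ∧ C b l ≠ 0 ∧ ∀ i, C i l ≠ 0 → a ≤ i ∧ i ≤ b

/-- `C` and `E` are in column, respectively row, echelon form and `t`-overlapping, and the recorded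
positions are right. -/
def LeftBruhat.IsValid {K : Type u} [Field K] {n : ℕ} (t : ℕ) (g : LeftBruhat K n) : Prop :=
  IsColEchelon g.C ∧ ColOverlapping t g.C ∧ IsRowEchelon g.E ∧ RowOverlapping t g.E ∧
    (∀ l, IsColRange g.C l (g.cFirst l) (g.cLast l)) ∧
    (∀ l, IsColRange g.E.transpose l (g.eFirst l) (g.eLast l))

/-- The left triangular matrix represented by a left Bruhat generator. -/
noncomputable def LeftBruhat.toMatrix {K : Type u} [Field K] {n : ℕ} (g : LeftBruhat K n) :
    Matrix (Fin n) (Fin n) K :=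
  leftPart (g.C * g.R.permMatrix K * g.E)

/-- The data of a Bruhat generator: the diagonal and the generators of the strictly lower and the
strictly upper triangular part. -/
structure Bruhat (α : Type u) (n : ℕ) where
  D : Fin n → α
  L : LeftBruhat α n
  U : LeftBruhat α n

/-- Apply a function to the entries of a Bruhat generator. -/
def Bruhat.map {α : Type u} {β : Type v} {n : ℕ} (f : α → β) (g : Bruhat α n) : Bruhat β n where
  D := fun i => f (g.D i)
  L := g.L.map f
  U := g.U.map f

/-- `g` represents `A` in `t`-Bruhat format. -/
def Bruhat.Represents {K : Type u} [Field K] {n : ℕ} (g : Bruhat K n) (t : ℕ)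
    (A : Matrix (Fin n) (Fin n) K) : Prop :=
  g.L.IsValid t ∧ g.U.IsValid t ∧
    A = Matrix.diagonal g.D + antiIdentity K n * g.L.toMatrix + g.U.toMatrix * antiIdentity K n

/-- The memory `mem` contains the entries of the generator `g` at the addresses given by `a`, and
`a` has the same combinatorial data as `g`. -/
def Bruhat.Stored {K : Type u} {n : ℕ} (mem : List K) (a : Bruhat ℕ n) (g : Bruhat K n) : Prop :=
  a.map (fun x => mem[x]?) = g.map some

/-!
The sum is computed in `O(n * s ^ (ω - 1))` field operations, without a logarithmic factor. For
`n / s → ∞` the factor `log₂ (n / s)` of the claimed bound therefore absorbs every constant, and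
fast multiplication and CRE decomposition are only needed up to constant factors
(`exists_nat_linear_le_log`).

The diagonals are added. The strictly lower and the strictly upper parts are left triangular
matrices, up to a reversal of the rows or columns, and are treated in the same way
(`exists_prog_leftSum`). Concatenating the generators of two left triangular matrices writes their
sum as the left part of `Ct * G`. Every term (column of `Ct` times row of `G`) has a first row and a
first column, and at most `s` terms start in the block of the first `k` rows and the first `n - k`
columns, since within each summand the terms that start there are independent
(`LeftBruhat.IsValid.card_le_rank`). With blocks of size `b ≤ s`, only `O(b)` terms matter at any
time (`IsStaircase`), and two passes over the `n / b` blocks suffice, each step costing `O(b ^ ω)`: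

* From few to many columns (`exists_prog_coord`), the relevant rows of `G`, which are long, are
  replaced by coordinate vectors of length `O(b)`. They retain the leading position of every linear
  combination of these rows (`SameFlag`), and by elimination `b` further columns can be included.
* From top to bottom (`exists_prog_sweep`), the rows of `Ct`, in these coordinates, are reduced by
  the previous reduced rows and among themselves. This gives `Ct * G = C * F` above the antidiagonal
  with `C` lower triangular and with rows of `F` that are zero or have distinct leading positions
  (`exists_prog_leftFactor`).

Listing the pivots by rows and by columns gives a left Bruhat generator (`exists_prog_generator`).
It is `t`-overlapping without further work: deleting the entries that do not reach the part above
the antidiagonal, the columns of the echelon matrix whose ranges contain a given row belong to the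
pivots in one leading block, and the number of pivots in a leading block is at most its rank
(`card_leads_le_rank`), hence at most `t` if the sum is `t`-quasiseparable.

The elimination of a matrix `M` is obtained from a CRE decomposition of `[M | I]`, whose right block
records the transformation (`IsCRE.elimination`). Algorithms appear as existence statements about
computation trees that depend on addresses and combinatorial data only and that are correct, within
the stated cost, for all contents of the memory (`Prog.Runs`).
-/

/-! ### Composing computation trees -/

section Programs

variable {K : Type u} {β γ : Type*}

/-- Sequential composition: run `p` and continue with the tree chosen by its result. -/
def Prog.bind : Prog K β → (β → Prog K γ) → Prog K γ
  | .ret b, f => f b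
  | .const c next, f => .const c fun a => (next a).bind f
  | .arith o a b next, f => .arith o a b fun x => (next x).bind f
  | .test a p q, f => .test a (p.bind f) (q.bind f)

/-- Iterate `step 0`, …, `step (N - 1)` on a state. -/
def Prog.iter (step : ℕ → β → Prog K β) : ℕ → β → Prog K β
  | 0, x => .ret x
  | t + 1, x => (Prog.iter step t x).bind (step t)

theorem List.IsPrefix.getElem?_some {α : Type*} {l l' : List α} (h : l <+: l') {i : ℕ} {x : α}
    (hx : l[i]? = some x) : l'[i]? = some x := by
  obtain ⟨t, rfl⟩ := h
  rw [List.getElem?_append_left (List.getElem?_eq_some_iff.1 hx).1, hx]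

/-- The memory `mem` contains the entries of `M` at the addresses `a`. -/
def Holds {α δ : Type*} (mem : List K) (a : Matrix α δ ℕ) (M : Matrix α δ K) : Prop :=
  ∀ i j, mem[a i j]? = some (M i j)

theorem Holds.mono {α δ : Type*} {mem mem' : List K} {a : Matrix α δ ℕ} {M : Matrix α δ K}
    (h : Holds mem a M) (hm : mem <+: mem') : Holds mem' a M :=
  fun i j => hm.getElem?_some (h i j)

variable [Field K]

/-- The memory is append-only. -/
theorem Prog.prefix_of_run (p : Prog K β) :
    ∀ {mem : List K} {out : Outcome K β}, p.run mem = some out → mem <+: out.memory := by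
  induction p with
  | ret b =>
    intro mem out h
    simp only [Prog.run, Option.some.injEq] at h
    subst h
    exact List.prefix_rfl
  | const c next ih =>
    intro mem out h
    exact (List.prefix_append _ _).trans (ih _ h)
  | arith o a b next ih =>
    intro mem out h
    simp only [Prog.run, Option.bind_eq_some_iff, Option.map_eq_some_iff] at h
    obtain ⟨x, -, y, -, z, -, o', h, rfl⟩ := h
    exact (List.prefix_append _ _).trans (ih _ (out := o') h)
  | test a p q ihp ihq =>
    intro mem out h
    simp only [Prog.run, Option.bind_eq_some_iff, Option.map_eq_some_iff] at h
    obtain ⟨x, -, o', h, rfl⟩ := h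
    split_ifs at h
    · exact ihp (out := o') h
    · exact ihq (out := o') h

theorem Prog.run_bind (p : Prog K β) (f : β → Prog K γ) :
    ∀ {mem : List K} {out : Outcome K β} {out' : Outcome K γ}, p.run mem = some out →
      (f out.result).run out.memory = some out' →
      (p.bind f).run mem = some { out' with cost := out.cost + out'.cost } := by
  induction p with
  | ret b =>
    intro mem out out' h h'
    simp only [Prog.run, Option.some.injEq] at h
    subst h
    simpa [Prog.bind] using h'
  | const c next ih =>
    intro mem out out' h h'
    exact ih _ h h'
  | arith o a b next ih =>
    intro mem out out' h h'
    simp only [Prog.run, Option.bind_eq_some_iff, Option.map_eq_some_iff] at h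
    obtain ⟨x, hx, y, hy, z, hz, o', h, rfl⟩ := h
    simp only [Prog.run, Prog.bind, hx, hy, hz, Option.bind_some, ih _ h h', Option.map_some,
      Outcome.charge, Option.some.injEq, Outcome.mk.injEq, true_and]
    omega
  | test a p q ihp ihq =>
    intro mem out out' h h'
    simp only [Prog.run, Option.bind_eq_some_iff, Option.map_eq_some_iff] at h
    obtain ⟨x, hx, o', h, rfl⟩ := h
    simp only [Prog.run, Prog.bind, hx, Option.bind_some]
    split_ifs at h ⊢
    · simp only [ihp h h', Option.map_some, Outcome.charge, Option.some.injEq,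
        Outcome.mk.injEq, true_and]
      omega
    · simp only [ihq h h', Option.map_some, Outcome.charge, Option.some.injEq,
        Outcome.mk.injEq, true_and]
      omega

/-- Started on the memory `mem`, the tree `p` terminates without failure after at most `c` field
operations, and its result and final memory satisfy `Q`. -/
def Prog.Runs (p : Prog K β) (mem : List K) (c : ℝ) (Q : β → List K → Prop) : Prop :=
  ∃ out, p.run mem = some out ∧ mem <+: out.memory ∧ Q out.result out.memory ∧ (out.cost : ℝ) ≤ c

theorem Prog.Runs.mono {p : Prog K β} {mem : List K} {c c' : ℝ} {Q Q' : β → List K → Prop}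
    (h : p.Runs mem c Q) (hc : c ≤ c')
    (hQ : ∀ b mem', mem <+: mem' → Q b mem' → Q' b mem') : p.Runs mem c' Q' := by
  obtain ⟨out, h1, h2, h3, h4⟩ := h
  exact ⟨out, h1, h2, hQ _ _ h2 h3, h4.trans hc⟩

theorem Prog.Runs.bind {p : Prog K β} {f : β → Prog K γ} {mem : List K} {c c' : ℝ}
    {Q : β → List K → Prop} {Q' : γ → List K → Prop} (h : p.Runs mem c Q)
    (hf : ∀ b mem', mem <+: mem' → Q b mem' → (f b).Runs mem' c' Q') :
    (p.bind f).Runs mem (c + c') Q' := by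
  obtain ⟨out, h1, h2, h3, h4⟩ := h
  obtain ⟨out', g1, g2, g3, g4⟩ := hf _ _ h2 h3
  refine ⟨_, Prog.run_bind p f h1 g1, h2.trans g2, g3, ?_⟩
  push_cast
  linarith

theorem Prog.runs_ret {b : β} {mem : List K} {Q : β → List K → Prop} (h : Q b mem) :
    (Prog.ret b : Prog K β).Runs mem 0 Q :=
  ⟨_, rfl, List.prefix_rfl, h, by simp⟩

theorem Prog.runs_const {c : K} {next : ℕ → Prog K β} {mem : List K} {t : ℝ}
    {Q : β → List K → Prop}
    (h : ∀ a, (mem ++ [c])[a]? = some c → (next a).Runs (mem ++ [c]) t Q) :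
    (Prog.const c next).Runs mem t Q := by
  obtain ⟨out, h1, h2, h3, h4⟩ := h mem.length (by simp)
  exact ⟨out, h1, (List.prefix_append _ _).trans h2, h3, h4⟩

theorem Prog.runs_iter {step : ℕ → β → Prog K β} {N : ℕ} {x : β} {mem : List K} {c : ℝ}
    (Inv : ℕ → β → List K → Prop) (h0 : Inv 0 x mem)
    (hs : ∀ t < N, ∀ y mem', mem <+: mem' → Inv t y mem' →
      (step t y).Runs mem' c (Inv (t + 1))) :
    (Prog.iter step N x).Runs mem (N * c) (Inv N) := by
  induction N with
  | zero => simpa [Prog.iter] using Prog.runs_ret h0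
  | succ N ih =>
    refine ((ih fun t ht => hs t (by omega)).bind
      fun b mem' hm hb => hs N (by omega) b mem' hm hb).mono ?_ fun _ _ _ h => h
    push_cast
    linarith

/-- Componentwise addition of two vectors, one operation per component. -/
theorem exists_prog_add (n : ℕ) : ∃ P : (Fin n → ℕ) → (Fin n → ℕ) → Prog K (Fin n → ℕ),
    ∀ (a b : Fin n → ℕ) (x y : Fin n → K) (mem : List K), (∀ i, mem[a i]? = some (x i)) →
      (∀ i, mem[b i]? = some (y i)) →
      (P a b).Runs mem n fun c mem' => ∀ i, mem'[c i]? = some (x i + y i) := by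
  let step (a b : Fin n → ℕ) (t : ℕ) (c : Fin n → ℕ) : Prog K (Fin n → ℕ) :=
    if h : t < n then
      .arith .add (a ⟨t, h⟩) (b ⟨t, h⟩) fun z => .ret (Function.update c ⟨t, h⟩ z)
    else .ret c
  refine ⟨fun a b => Prog.iter (step a b) n fun _ => 0, fun a b x y mem hx hy => ?_⟩
  refine (Prog.runs_iter (c := 1)
    (fun t c mem' => ∀ i : Fin n, (i : ℕ) < t → mem'[c i]? = some (x i + y i))
    (fun i hi => by omega) fun t ht c mem' hm hc => ?_).mono (by simp)
    fun c mem' _ h i => h i i.2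
  simp only [step, ht, dite_true]
  refine ⟨⟨Function.update c ⟨t, ht⟩ mem'.length, mem' ++ [x ⟨t, ht⟩ + y ⟨t, ht⟩], 1⟩, ?_,
    List.prefix_append _ _, fun i hi => ?_, by simp⟩
  · simp [Prog.run, hm.getElem?_some (hx ⟨t, ht⟩), hm.getElem?_some (hy ⟨t, ht⟩), ArithOp.eval,
      Outcome.charge]
  · by_cases h : i = ⟨t, ht⟩
    · subst h
      simp
    · have : (i : ℕ) ≠ t := fun h' => h (Fin.ext h')
      simp only [Function.update_of_ne h]
      exact (List.prefix_append _ _).getElem?_some (hc i (by omega))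

/-- Zero tests for a finite family of memory cells, one operation per cell. -/
theorem exists_prog_isNonzero {ι : Type*} [DecidableEq ι] (s : Finset ι) :
    ∃ P : (ι → ℕ) → Prog K (Finset ι), ∀ (a : ι → ℕ) (x : ι → K) (mem : List K),
      (∀ i ∈ s, mem[a i]? = some (x i)) →
      (P a).Runs mem s.card fun r _ => ∀ i, i ∈ r ↔ i ∈ s ∧ x i ≠ 0 := by
  classical
  induction s using Finset.induction_on with
  | empty =>
    refine ⟨fun _ => .ret ∅, fun a x mem _ => ?_⟩
    simpa using Prog.runs_ret (by simp)
  | insert j s hj ih =>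
    obtain ⟨P, hP⟩ := ih
    refine ⟨fun a => (P a).bind fun r => .test (a j) (.ret r) (.ret (insert j r)),
      fun a x mem hx => ?_⟩
    rw [Finset.card_insert_of_notMem hj]
    push_cast
    refine (hP a x mem fun i hi => hx i (Finset.mem_insert_of_mem hi)).bind
      fun r mem' hm hr => ?_
    have hxj := hm.getElem?_some (hx j (Finset.mem_insert_self _ _))
    by_cases h : x j = 0
    · refine ⟨⟨r, mem', 1⟩, by simp [Prog.run, hxj, h, Outcome.charge], List.prefix_rfl,
        fun i => ?_, by simp⟩
      simp only [hr, Finset.mem_insert]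
      constructor
      · tauto
      · rintro ⟨rfl | h1, h2⟩
        · exact absurd h h2
        · exact ⟨h1, h2⟩
    · refine ⟨⟨insert j r, mem', 1⟩, by simp [Prog.run, hxj, h, Outcome.charge],
        List.prefix_rfl, fun i => ?_, by simp⟩
      simp only [hr, Finset.mem_insert]
      constructor
      · rintro (rfl | h1)
        · exact ⟨Or.inl rfl, h⟩
        · tauto
      · tauto

end Programs

/-! ### Embedding supports into initial segments -/

section Supports

variable {K : Type u} {α β γ δ : Type*} [LinearOrder α] [LinearOrder β] [LinearOrder γ]

/-- The increasing enumeration of a finite set, padded by `none`. -/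
def Finset.nth? (I : Finset α) (m : ℕ) (u : Fin m) : Option α :=
  if h : (u : ℕ) < I.card then some (I.orderEmbOfFin rfl ⟨u, h⟩) else none

theorem Finset.mem_of_nth? {I : Finset α} {m : ℕ} {u : Fin m} {i : α}
    (h : I.nth? m u = some i) : i ∈ I := by
  unfold Finset.nth? at h
  split_ifs at h with hu
  simp only [Option.some.injEq] at h
  subst h
  exact I.orderEmbOfFin_mem rfl _

theorem Finset.exists_nth? {I : Finset α} {m : ℕ} (hI : I.card ≤ m) {i : α} (hi : i ∈ I) :
    ∃ u : Fin m, I.nth? m u = some i ∧ (u : ℕ) < I.card := by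
  have : i ∈ Set.range (I.orderEmbOfFin rfl) := by simpa using hi
  obtain ⟨u, rfl⟩ := this
  exact ⟨⟨u, by omega⟩, by simp [Finset.nth?], u.2⟩

theorem Finset.nth?_lt_iff {I : Finset α} {m : ℕ} {u w : Fin m} {i j : α}
    (hu : I.nth? m u = some i) (hw : I.nth? m w = some j) : u < w ↔ i < j := by
  unfold Finset.nth? at hu hw
  split_ifs at hu hw with h1 h2
  simp only [Option.some.injEq] at hu hw
  subst hu hw
  simp

theorem Finset.nth?_inj {I : Finset α} {m : ℕ} {u w : Fin m} {i : α}
    (hu : I.nth? m u = some i) (hw : I.nth? m w = some i) : u = w := by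
  have h1 := Finset.nth?_lt_iff hu hw
  have h2 := Finset.nth?_lt_iff hw hu
  simp only [lt_irrefl, iff_false, not_lt] at h1 h2
  exact le_antisymm h2 h1

theorem Finset.nth?_none {I : Finset α} {m : ℕ} {u : Fin m} (hu : I.nth? m u = none) :
    I.card ≤ u := by
  unfold Finset.nth? at hu
  split_ifs at hu with h1
  omega

theorem Finset.sum_nth? [AddCommMonoid δ] {I : Finset α} {m : ℕ} (hI : I.card ≤ m) (f : α → δ) :
    ∑ u : Fin m, (I.nth? m u).elim 0 f = ∑ i ∈ I, f i := by
  classical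
  have h1 : ∀ i ∈ I, f i = ∑ u : Fin m, if I.nth? m u = some i then f i else 0 := by
    intro i hi
    obtain ⟨u, hu, -⟩ := Finset.exists_nth? hI hi
    rw [Finset.sum_eq_single u]
    · simp [hu]
    · intro w _ hw
      rw [if_neg fun h => hw (Finset.nth?_inj h hu)]
    · simp
  rw [Finset.sum_congr rfl h1, Finset.sum_comm]
  refine Finset.sum_congr rfl fun u _ => ?_
  cases h : I.nth? m u with
  | none => simp
  | some i => simp [Finset.mem_of_nth? h]

/-- Compress the `I × J` part of a matrix to the top left corner of an `m × m'` matrix whose other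
entries are `z`. -/
def Matrix.push (z : δ) (I : Finset α) (J : Finset β) (m m' : ℕ) (M : Matrix α β δ) :
    Matrix (Fin m) (Fin m') δ :=
  Matrix.of fun u w => (I.nth? m u).elim z fun i => (J.nth? m' w).elim z fun j => M i j

open Classical in
/-- Spread the top left corner of a matrix over the index set `I × J`; the other entries become
`z`. -/
noncomputable def Matrix.pull (z : δ) (I : Finset α) (J : Finset β) {m m' : ℕ}
    (M : Matrix (Fin m) (Fin m') δ) : Matrix α β δ :=
  Matrix.of fun i j =>
    if h : (∃ u, I.nth? m u = some i) ∧ ∃ w, J.nth? m' w = some j then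
      M h.1.choose h.2.choose else z

theorem Matrix.pull_apply (z : δ) {I : Finset α} {J : Finset β} {m m' : ℕ}
    (M : Matrix (Fin m) (Fin m') δ) {u : Fin m} {w : Fin m'} {i : α} {j : β}
    (hu : I.nth? m u = some i) (hw : J.nth? m' w = some j) : M.pull z I J i j = M u w := by
  have h : (∃ u, I.nth? m u = some i) ∧ ∃ w, J.nth? m' w = some j := ⟨⟨u, hu⟩, w, hw⟩
  rw [Matrix.pull, Matrix.of_apply, dif_pos h, Finset.nth?_inj h.1.choose_spec hu,
    Finset.nth?_inj h.2.choose_spec hw]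

theorem Matrix.pull_eq (z : δ) {I : Finset α} {J : Finset β} {m m' : ℕ}
    (M : Matrix (Fin m) (Fin m') δ) {i : α} {j : β} (h : ¬ (i ∈ I ∧ j ∈ J)) :
    M.pull z I J i j = z := by
  rw [Matrix.pull, Matrix.of_apply, dif_neg]
  rintro ⟨⟨u, hu⟩, w, hw⟩
  exact h ⟨Finset.mem_of_nth? hu, Finset.mem_of_nth? hw⟩

theorem Holds.push [Zero K] {mem : List K} {z : ℕ} (hz : mem[z]? = some 0) {a : Matrix α β ℕ}
    {M : Matrix α β K} (h : Holds mem a M) (I : Finset α) (J : Finset β) (m m' : ℕ) :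
    Holds mem (a.push z I J m m') (M.push 0 I J m m') := by
  intro u w
  simp only [Matrix.push, Matrix.of_apply]
  cases I.nth? m u with
  | none => exact hz
  | some i =>
    cases J.nth? m' w with
    | none => exact hz
    | some j => exact h i j

theorem Holds.pull [Zero K] {mem : List K} {z : ℕ} (hz : mem[z]? = some 0) {m m' : ℕ}
    {a : Matrix (Fin m) (Fin m') ℕ}
    {M : Matrix (Fin m) (Fin m') K} (h : Holds mem a M) (I : Finset α) (J : Finset β) :
    Holds mem (a.pull z I J) (M.pull 0 I J) := by
  intro i j
  simp only [Matrix.pull, Matrix.of_apply]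
  split_ifs
  · exact h _ _
  · exact hz

/-- The part of a matrix supported on `I × J`. -/
def Matrix.restr [Zero K] (I : Finset α) (J : Finset β) (M : Matrix α β K) : Matrix α β K :=
  Matrix.of fun i j => if i ∈ I ∧ j ∈ J then M i j else 0

theorem Matrix.pull_push_mul [Field K] [Fintype β] {I : Finset α} {J : Finset β} {L : Finset γ}
    {m : ℕ} (hI : I.card ≤ m) (hJ : J.card ≤ m) (hL : L.card ≤ m) (P : Matrix α β K)
    (Q : Matrix β γ K) :
    (P.push 0 I J m m * Q.push 0 J L m m).pull 0 I L = P.restr I J * Q.restr J L := by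
  ext i l
  by_cases h : i ∈ I ∧ l ∈ L
  · obtain ⟨u, hu, -⟩ := Finset.exists_nth? hI h.1
    obtain ⟨w, hw, -⟩ := Finset.exists_nth? hL h.2
    rw [Matrix.pull_apply 0 _ hu hw, Matrix.mul_apply, Matrix.mul_apply]
    have := Finset.sum_nth? hJ fun j => P i j * Q j l
    rw [← Finset.sum_subset (Finset.subset_univ J)
      (fun j _ hj => by simp [Matrix.restr, hj])]
    rw [Finset.sum_congr rfl fun j hj => show P.restr I J i j * Q.restr J L j l = P i j * Q j l
      by simp [Matrix.restr, hj, h.1, h.2], ← this]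
    refine Finset.sum_congr rfl fun x _ => ?_
    cases hx : J.nth? m x <;> simp [Matrix.push, hx, hu, hw]
  · rw [Matrix.pull_eq _ _ h, Matrix.mul_apply, Finset.sum_eq_zero]
    intro j _
    by_cases hi : i ∈ I
    · have hl : l ∉ L := fun hl => h ⟨hi, hl⟩
      simp [Matrix.restr, hl]
    · simp [Matrix.restr, hi]

end Supports

/-! ### Multiplication of matrices with small supports -/

/-- Only the order of magnitude of the time for multiplications is used, but for all `n`. -/
theorem MatMulTime.exists_bound {time : ℕ → ℕ} {ω c : ℝ} (hω : 2 < ω)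
    (h : ∀ ε : ℝ, 0 < ε → ∃ N : ℕ, ∀ n : ℕ, N ≤ n → (time n : ℝ) ≤ (1 + ε) * (c * (n : ℝ) ^ ω)) :
    ∃ κ : ℝ, 0 ≤ κ ∧ ∀ n : ℕ, 1 ≤ n → (time n : ℝ) ≤ κ * (n : ℝ) ^ ω := by
  obtain ⟨N, hN⟩ := h 1 one_pos
  have hS : 0 ≤ ∑ i ∈ Finset.range N, (time i : ℝ) := Finset.sum_nonneg fun _ _ => by positivity
  refine ⟨2 * |c| + ∑ i ∈ Finset.range N, (time i : ℝ), by positivity, fun n hn => ?_⟩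
  have h1 : (1 : ℝ) ≤ (n : ℝ) ^ ω :=
    Real.one_le_rpow (by exact_mod_cast hn) (by linarith)
  rw [add_mul]
  rcases le_or_gt N n with h | h
  · have := hN n h
    have h2 : c * (n : ℝ) ^ ω ≤ |c| * (n : ℝ) ^ ω :=
      mul_le_mul_of_nonneg_right (le_abs_self c) (by positivity)
    nlinarith [mul_nonneg hS (zero_le_one.trans h1)]
  · have h2 : (time n : ℝ) ≤ ∑ i ∈ Finset.range N, (time i : ℝ) :=
      Finset.single_le_sum (f := fun i => (time i : ℝ)) (fun _ _ => by positivity)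
        (Finset.mem_range.2 h)
    have h3 : 0 ≤ |c| * (n : ℝ) ^ ω := by positivity
    nlinarith [mul_nonneg hS (sub_nonneg.2 h1)]

/-- Products of matrices of arbitrary format are computed in `O(m ^ ω)` operations, where `m`
bounds the numbers of rows and columns that matter. -/
theorem exists_prog_mul {K : Type u} [Field K] {ω Cω : ℝ} (hω : 2 < ω) (hMM : MatMulTime K ω Cω) :
    ∃ κ : ℝ, 0 ≤ κ ∧ ∀ (α β γ : Type) [LinearOrder α] [LinearOrder β] [LinearOrder γ] [Fintype β],
      ∃ P : ℕ → Finset α → Finset β → Finset γ → Matrix α β ℕ → Matrix β γ ℕ →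
          Prog K (Matrix α γ ℕ),
        ∀ (m : ℕ) (I : Finset α) (J : Finset β) (L : Finset γ) (a : Matrix α β ℕ)
          (b : Matrix β γ ℕ) (A : Matrix α β K) (B : Matrix β γ K) (mem : List K),
          1 ≤ m → I.card ≤ m → J.card ≤ m → L.card ≤ m → Holds mem a A → Holds mem b B →
          (P m I J L a b).Runs mem (κ * (m : ℝ) ^ ω) fun c mem' =>
            Holds mem' c (A.restr I J * B.restr J L) := by
  obtain ⟨alg, time, halg, htime⟩ := hMM
  obtain ⟨κ, hκ, htime⟩ := MatMulTime.exists_bound hω htime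
  refine ⟨κ, hκ, fun α β γ _ _ _ _ => ⟨fun m I J L a b => .const 0 fun z =>
    (alg m (a.push z I J m m) (b.push z J L m m) (Matrix.of fun _ _ => z)).bind fun r =>
      .ret (r.pull z I L), ?_⟩⟩
  intro m I J L a b A B mem hm hI hJ hL ha hb
  refine Prog.runs_const fun z hz => ?_
  have hpre : mem <+: mem ++ [0] := List.prefix_append _ _
  obtain ⟨out, h1, h2, h3⟩ := halg m _ _ 0 _ _ _ (Matrix.of fun _ _ => z)
    ((ha.mono hpre).push hz I J m m) ((hb.mono hpre).push hz J L m m) (fun i j => hz)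
  have h4 : (alg m (a.push z I J m m) (b.push z J L m m) (Matrix.of fun _ _ => z)).Runs
      (mem ++ [0]) (κ * (m : ℝ) ^ ω) fun r mem' =>
        Holds mem' r (0 + A.push 0 I J m m * B.push 0 J L m m) :=
    ⟨out, h1, Prog.prefix_of_run _ h1, h2, (Nat.cast_le.2 h3).trans (htime m hm)⟩
  refine (h4.bind fun r mem' hm' hr => Prog.runs_ret (Q := fun c mem' =>
    Holds mem' c (A.restr I J * B.restr J L)) ?_).mono (by simp) fun _ _ _ h => h
  rw [← Matrix.pull_push_mul hI hJ hL, ← zero_add (A.push 0 I J m m * B.push 0 J L m m)]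
  exact Holds.pull (hm'.getElem?_some hz) hr I L

/-! ### Elimination with transformation matrix -/

section Elimination

variable {K : Type u} [Field K]

/-- The leading non-zero entry of the vector `v` is at `c`. -/
def IsLead {β : Type*} [LT β] (v : β → K) (c : β) : Prop :=
  v c ≠ 0 ∧ ∀ c' < c, v c' = 0

theorem IsLead.unique {β : Type*} [LinearOrder β] {v : β → K} {c c' : β} (h : IsLead v c)
    (h' : IsLead v c') : c = c' := by
  rcases lt_trichotomy c c' with hc | hc | hc
  · exact absurd (h'.2 c hc) h.1
  · exact hc
  · exact absurd (h.2 c' hc) h'.1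

/-- The matrix `[M | z + (o - z) I]`: with `z` and `o` standing for `0` and `1`, an identity matrix
is appended on the right. -/
def Matrix.augment {δ : Type*} {a b : ℕ} (z o : δ) (M : Matrix (Fin a) (Fin b) δ) :
    Matrix (Fin a) (Fin (b + a)) δ :=
  Matrix.of fun i => Fin.append (M i) fun j => if i = j then o else z

theorem Matrix.augment_eq_mul {a b r : ℕ} {M : Matrix (Fin a) (Fin b) K}
    {C : Matrix (Fin a) (Fin r) K} {F : Matrix (Fin r) (Fin (b + a)) K}
    (h : M.augment 0 1 = C * F) :
    M = C * F.submatrix id (Fin.castAdd a) ∧ 1 = C * F.submatrix id (Fin.natAdd b) := by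
  constructor
  · ext i j
    have := congrFun (congrFun h i) (Fin.castAdd a j)
    simpa [Matrix.augment, Matrix.mul_apply] using this
  · ext i j
    have := congrFun (congrFun h i) (Fin.natAdd b j)
    simpa [Matrix.augment, Matrix.mul_apply, Matrix.one_apply] using this

theorem Matrix.rank_augment {a b : ℕ} (M : Matrix (Fin a) (Fin b) K) :
    (M.augment 0 1).rank = a := by
  refine le_antisymm ((Matrix.rank_le_card_height _).trans_eq (by simp)) ?_
  have h : (1 : Matrix (Fin a) (Fin a) K) = M.augment 0 1 *
      (1 : Matrix (Fin (b + a)) (Fin (b + a)) K).submatrix id (Fin.natAdd b) :=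
    (Matrix.augment_eq_mul (M := M) (by rw [Matrix.mul_one])).2
  have h' := Matrix.rank_mul_le_left (M.augment 0 1)
    ((1 : Matrix (Fin (b + a)) (Fin (b + a)) K).submatrix id (Fin.natAdd b))
  rw [← h, Matrix.rank_one] at h'
  simpa using h'

/-- In a CRE decomposition of `[M | I]`, the matrix `C` is square and lower triangular, and the
right block of `R * E` is its inverse. The left block of `R * E` then is the row reduction of `M`
together with the transformation that achieves it. -/
theorem IsCRE.elimination {a b r : ℕ} {M : Matrix (Fin a) (Fin b) K}
    {C : Matrix (Fin a) (Fin r) K}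
    {R : Equiv.Perm (Fin r)} {E : Matrix (Fin r) (Fin (b + a)) K}
    (h : IsCRE (M.augment 0 1) C R E) :
    ∃ hr : r = a, ∃ C' B' : Matrix (Fin a) (Fin a) K,
      C' = C.submatrix id (Fin.cast hr.symm) ∧
      B' = E.submatrix (fun i => R (Fin.cast hr.symm i)) (Fin.natAdd b) ∧
      (∀ i j, i < j → C' i j = 0) ∧ (∀ i j, i < j → B' i j = 0) ∧ C' * B' = 1 ∧
      E.submatrix (fun i => R (Fin.cast hr.symm i)) (Fin.castAdd a) = B' * M ∧
      ∃ ℓ : Fin a → Fin (b + a), Function.Injective ℓ ∧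
        ∀ i, IsLead (E (R (Fin.cast hr.symm i))) (ℓ i) := by
  obtain ⟨⟨p, hp, hC⟩, ⟨e, he, hE⟩, hM⟩ := h
  rw [Matrix.mul_assoc] at hM
  obtain ⟨h1, h2⟩ := Matrix.augment_eq_mul hM
  have hr : r = a := by
    refine le_antisymm (by simpa using Fintype.card_le_of_injective p hp.injective) ?_
    have := Matrix.rank_mul_le_left C ((R.permMatrix K * E).submatrix id (Fin.natAdd b))
    rw [← h2, Matrix.rank_one] at this
    simpa using this.trans (Matrix.rank_le_card_width C)
  subst hr
  have hRE : R.permMatrix K * E = E.submatrix R id := by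
    rw [PEquiv.toMatrix_toPEquiv_mul]
  rw [hRE] at h1 h2
  simp only [Matrix.submatrix_submatrix] at h1 h2
  have hCl : ∀ i j, i < j → C i j = 0 := fun i j hij =>
    (hC j).2 i (hij.trans_le (hp.le_apply))
  have hCB := h2.symm
  have hBC := mul_eq_one_comm.1 hCB
  have hBl : ∀ i j, i < j → E.submatrix R (Fin.natAdd b) i j = 0 := by
    have hbt : C.BlockTriangular OrderDual.toDual := fun i j hij => hCl i j hij
    let _ : Invertible C := ⟨_, hBC, hCB⟩
    have := Matrix.blockTriangular_inv_of_blockTriangular hbt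
    rw [Matrix.inv_eq_right_inv hCB] at this
    exact fun i j hij => this hij
  refine ⟨rfl, C, E.submatrix R (Fin.natAdd b), rfl, rfl, hCl, hBl, hCB, ?_,
    fun i => e (R i), he.injective.comp R.injective, fun i => hE (R i)⟩
  simp only [Fin.cast_refl, id]
  conv_rhs => rw [h1]
  rw [← Matrix.mul_assoc]
  erw [hBC]
  rw [Matrix.one_mul]
  rfl

/-- The pair of lower triangular matrices `C` and `B` on the index set `I`, inverse to each other,
reduces the rows of `P`: each row `i` of `B * P` is zero (if `q i = none`) or has its leading entry
in a column of its own (if `q i = some c`). -/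
structure IsElimination {α β : Type*} [LinearOrder α] [LinearOrder β] [Fintype α] (I : Finset α)
    (P : Matrix α β K) (C B : Matrix α α K) (q : α → Option β) : Prop where
  supp_C : ∀ i j, C i j ≠ 0 → i ∈ I ∧ j ∈ I ∧ j ≤ i
  supp_B : ∀ i j, B i j ≠ 0 → i ∈ I ∧ j ∈ I ∧ j ≤ i
  mul_C : ∀ i ∈ I, ∀ j, (C * B) i j = if i = j then 1 else 0
  lead : ∀ i c, q i = some c → IsLead ((B * P) i) c
  zero : ∀ i, q i = none → (B * P) i = 0
  inj : ∀ i j c, q i = some c → q j = some c → i = j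

/-- The smallest element of a finite set, if there is one. -/
def Finset.least? {β : Type*} [LinearOrder β] (s : Finset β) : Option β :=
  if h : s.Nonempty then some (s.min' h) else none

theorem Finset.least?_some {β : Type*} [LinearOrder β] {s : Finset β} {v : β → K} {c : β}
    (hs : ∀ j, j ∈ s ↔ v j ≠ 0) (h : s.least? = some c) : IsLead v c := by
  unfold Finset.least? at h
  split_ifs at h with h0
  simp only [Option.some.injEq] at h
  subst h
  refine ⟨(hs _).1 (s.min'_mem h0), fun c' hc' => ?_⟩
  by_contra h
  exact absurd (s.min'_le c' ((hs c').2 h)) (not_le.2 hc')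

theorem Finset.least?_none {β : Type*} [LinearOrder β] {s : Finset β} {v : β → K}
    (hs : ∀ j, j ∈ s ↔ v j ≠ 0) (h : s.least? = none) : v = 0 := by
  unfold Finset.least? at h
  split_ifs at h with h0
  rw [Finset.not_nonempty_iff_eq_empty] at h0
  ext j
  by_contra hj
  have := (hs j).2 hj
  simp [h0] at this

/-- The time bound for CRE decompositions says nothing about small ranks. For matrices `[M | I]`
with at least `N` rows the rank is large enough, and a matrix `M` with few rows can be padded. -/
theorem CRETime.exists_bound {time : ℕ → ℕ → ℕ → ℕ} {ω c : ℝ} (hω : 2 < ω)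
    (h : ∀ ε : ℝ, 0 < ε → ∃ N : ℕ, ∀ m n r : ℕ, N ≤ r → r ≤ m → r ≤ n →
      (time m n r : ℝ) ≤ (1 + ε) * (c * m * n * (r : ℝ) ^ (ω - 2))) :
    ∃ (N : ℕ) (κ : ℝ), 0 ≤ κ ∧ ∀ a b m : ℕ, 1 ≤ m → a ≤ m → b ≤ m →
      (time (a + N) (b + (a + N)) (a + N) : ℝ) ≤ κ * (m : ℝ) ^ ω := by
  obtain ⟨N, hN⟩ := h 1 one_pos
  refine ⟨N, 4 * |c| * (1 + N : ℝ) ^ ω, by positivity, fun a b m hm ha hb => ?_⟩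
  refine (hN _ _ (a + N) (by omega) le_rfl (by omega)).trans ?_
  set X : ℝ := (1 + N : ℝ) * m with hX
  have hmR : (1 : ℝ) ≤ m := by exact_mod_cast hm
  have haR : (a : ℝ) ≤ m := by exact_mod_cast ha
  have hbR : (b : ℝ) ≤ m := by exact_mod_cast hb
  have hX0 : 0 < X := by positivity
  have h0 : (N : ℝ) ≤ N * m := le_mul_of_one_le_right (by positivity) hmR
  have h1 : ((a + N : ℕ) : ℝ) ≤ X := by push_cast; rw [hX]; linarith
  have h2 : ((b + (a + N) : ℕ) : ℝ) ≤ 2 * X := by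
    push_cast; rw [hX]; nlinarith
  have h3 : ((a + N : ℕ) : ℝ) ^ (ω - 2) ≤ X ^ (ω - 2) :=
    Real.rpow_le_rpow (by positivity) h1 (by linarith)
  have h4 : X ^ ω = X * X * X ^ (ω - 2) := by
    rw [← sq, ← Real.rpow_natCast, ← Real.rpow_add hX0]
    congr 1
    push_cast
    ring
  have h5 : (1 + N : ℝ) ^ ω * (m : ℝ) ^ ω = X ^ ω := by
    rw [hX, Real.mul_rpow (by positivity) (by positivity)]
  calc (1 + 1) * (c * ((a + N : ℕ) : ℝ) * ((b + (a + N) : ℕ) : ℝ) * ((a + N : ℕ) : ℝ) ^ (ω - 2))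
      ≤ (1 + 1) * (|c| * ((a + N : ℕ) : ℝ) * ((b + (a + N) : ℕ) : ℝ) *
        ((a + N : ℕ) : ℝ) ^ (ω - 2)) := by gcongr; exact le_abs_self c
    _ ≤ (1 + 1) * (|c| * X * (2 * X) * X ^ (ω - 2)) := by gcongr
    _ = 4 * |c| * X ^ ω := by rw [h4]; ring
    _ = _ := by rw [← h5]; ring

/-- A product with a matrix spread over `I × I` is computed on the compressed matrices, provided
that the padding does not contribute. -/
theorem Matrix.mul_pull {α β : Type} [LinearOrder α] [Fintype α] {I : Finset α}
    {a b : ℕ} (hI : I.card ≤ a) (X : Matrix (Fin a) (Fin a) K)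
    (Y : Matrix α β K) (Y' : Matrix (Fin a) (Fin b) K) {u : Fin a} {w : Fin b} {i : α} {j : β}
    (hu : I.nth? a u = some i)
    (hY : ∀ v k, I.nth? a v = some k → Y k j = Y' v w)
    (h0 : ∀ v, I.nth? a v = none → X u v * Y' v w = 0) :
    (X.pull 0 I I * Y) i j = (X * Y') u w := by
  rw [Matrix.mul_apply, Matrix.mul_apply, ← Finset.sum_subset (Finset.subset_univ I)
    (fun k _ hk => by rw [Matrix.pull_eq _ _ fun h => hk h.2, zero_mul]), ← Finset.sum_nth? hI]
  refine Finset.sum_congr rfl fun v _ => ?_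
  cases hv : I.nth? a v with
  | none => simp [h0 v hv]
  | some k => simp [Matrix.pull_apply 0 X hu hv, hY v k hv]

/-- Elimination of a matrix with support `I × J` in `O(m ^ ω)` operations, where `m` bounds the
cardinalities of `I` and `J`. -/
theorem exists_prog_elimination {ω CRF : ℝ} (hω : 2 < ω) (hRF : CRETime K ω CRF) :
    ∃ κ : ℝ, 0 ≤ κ ∧ ∀ (α β : Type) [LinearOrder α] [LinearOrder β] [Fintype α],
      ∃ P : Finset α → Finset β → Matrix α β ℕ →
          Prog K (Matrix α α ℕ × Matrix α α ℕ × (α → Option β)),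
        ∀ (m : ℕ) (I : Finset α) (J : Finset β) (a : Matrix α β ℕ) (A : Matrix α β K)
          (mem : List K), 1 ≤ m → I.card ≤ m → J.card ≤ m → Holds mem a A →
          (P I J a).Runs mem (κ * (m : ℝ) ^ ω) fun r mem' => ∃ C B,
            Holds mem' r.1 C ∧ Holds mem' r.2.1 B ∧
              IsElimination I (A.restr I J) C B r.2.2 := by
  obtain ⟨alg, time, halg, htime⟩ := hRF
  obtain ⟨N, κ, hκ, htime⟩ := CRETime.exists_bound hω htime
  refine ⟨κ + 1, by positivity, fun α β _ _ _ => ?_⟩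
  have hnz := fun s : Finset (α × β) => exists_prog_isNonzero (K := K) s
  choose Z hZ using hnz
  -- `N` additional zero rows make the rank of `[M | I]` large enough for the time bound
  let aug (I : Finset α) (J : Finset β) (a : Matrix α β ℕ) (z o : ℕ) :=
    (a.push z I J (I.card + N) J.card).augment z o
  let fin (I : Finset α) (J : Finset β) (z : ℕ)
      (r : CREAddr (I.card + N) (J.card + (I.card + N))) :
      Prog K (Matrix α α ℕ × Matrix α α ℕ × (α → Option β)) :=
    if hr : r.r = I.card + N then
      (Z (I ×ˢ J) fun x => (r.E.submatrix (fun i => r.R (Fin.cast hr.symm i))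
          (Fin.castAdd (I.card + N))).pull z I J x.1 x.2).bind fun s =>
        .ret ((r.C.submatrix id (Fin.cast hr.symm)).pull z I I,
          (r.E.submatrix (fun i => r.R (Fin.cast hr.symm i)) (Fin.natAdd J.card)).pull z I I,
          fun i => (J.filter fun j => (i, j) ∈ s).least?)
    else .ret (fun _ _ => 0, fun _ _ => 0, fun _ => none)
  refine ⟨fun I J a => .const 0 fun z => .const 1 fun o =>
    (alg _ _ (aug I J a z o)).bind (fin I J z), fun m I J a A mem hm hI hJ ha => ?_⟩
  refine Prog.runs_const fun z hz => Prog.runs_const fun o ho => ?_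
  have hpre : mem <+: mem ++ [0] ++ [1] := (List.prefix_append _ _).trans (List.prefix_append _ _)
  replace hz := (List.prefix_append (mem ++ [0]) [1]).getElem?_some hz
  replace ha := ha.mono hpre
  generalize mem ++ [0] ++ [1] = mem at *
  have haug : Holds mem (aug I J a z o)
      ((A.push 0 I J (I.card + N) J.card).augment (0 : K) 1) := by
    intro i j
    refine Fin.addCases (fun j => ?_) (fun j => ?_) j
    · simpa [aug, Matrix.augment] using ha.push hz I J (I.card + N) J.card i j
    · simp only [aug, Matrix.augment, Matrix.of_apply, Fin.append_right]
      split_ifs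
      · exact ho
      · exact hz
  obtain ⟨out, C0, E0, h1, h2, h3, h4, h5⟩ := halg _ _ _ _ _ haug
  rw [Matrix.rank_augment] at h5
  have h6 : (alg _ _ (aug I J a z o)).Runs mem (κ * (m : ℝ) ^ ω) fun r mem' =>
      r = out.result ∧ mem' = out.memory :=
    ⟨out, h1, Prog.prefix_of_run _ h1, ⟨rfl, rfl⟩,
      (Nat.cast_le.2 h5).trans (htime _ _ m hm hI hJ)⟩
  have hmm : ((I ×ˢ J).card : ℝ) ≤ (m : ℝ) ^ ω := by
    rw [Finset.card_product]
    have h7 : ((I.card * J.card : ℕ) : ℝ) ≤ (m : ℝ) ^ (2 : ℝ) := by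
      rw [Real.rpow_two, sq]
      exact_mod_cast Nat.mul_le_mul hI hJ
    exact h7.trans (Real.rpow_le_rpow_of_exponent_le (by exact_mod_cast hm) hω.le)
  refine (h6.bind (c' := ((I ×ˢ J).card : ℝ) + 0) ?_).mono (by linarith) fun _ _ _ h => h
  rintro _ _ hpre' ⟨rfl, rfl⟩
  obtain ⟨hr, C', B', hC', hB', hCl, hBl, hCB, hF, ℓ, hℓ, hlead⟩ := h4.elimination
  have hz' := hpre'.getElem?_some hz
  have hF' : Holds out.memory (out.result.E.submatrix (fun i => out.result.R (Fin.cast hr.symm i))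
      (Fin.castAdd (I.card + N)))
      (E0.submatrix (fun i => out.result.R (Fin.cast hr.symm i)) (Fin.castAdd (I.card + N))) :=
    fun i j => h3 _ _
  have hCh : Holds out.memory (out.result.C.submatrix id (Fin.cast hr.symm)) C' := by
    rw [hC']; exact fun i j => h2 _ _
  have hBh : Holds out.memory (out.result.E.submatrix (fun i => out.result.R (Fin.cast hr.symm i))
      (Fin.natAdd J.card)) B' := by
    rw [hB']; exact fun i j => h3 _ _
  rw [hF] at hF'
  have hIc : I.card ≤ I.card + N := by omega
  have hsub : ∀ u w : Fin (I.card + N), I.nth? (I.card + N) w = none →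
      ∀ i, I.nth? (I.card + N) u = some i → u < w := by
    intro u w hw i hu
    have h8 := Finset.nth?_none hw
    obtain ⟨u', hu', h9⟩ := Finset.exists_nth? hIc (Finset.mem_of_nth? hu)
    rw [Finset.nth?_inj hu hu']
    exact Fin.lt_def.2 (h9.trans_le h8)
  -- the entries of `B * P` are those of the compressed matrix
  have hBP : ∀ i j, (B'.pull 0 I I * A.restr I J) i j =
      (B' * A.push 0 I J (I.card + N) J.card).pull 0 I J i j := by
    intro i j
    by_cases h : i ∈ I ∧ j ∈ J
    · obtain ⟨u, hu, -⟩ := Finset.exists_nth? hIc h.1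
      obtain ⟨w, hw, -⟩ := Finset.exists_nth? (le_refl J.card) h.2
      rw [Matrix.pull_apply 0 _ hu hw]
      refine Matrix.mul_pull hIc _ _ _ hu (fun v k hv => ?_) fun v hv => ?_
      · simp [Matrix.restr, Matrix.push, hv, hw, Finset.mem_of_nth? hv, h.2]
      · simp [Matrix.push, hv]
    · rw [Matrix.pull_eq _ _ h, Matrix.mul_apply]
      refine Finset.sum_eq_zero fun k _ => ?_
      by_cases hi : i ∈ I
      · have hj : j ∉ J := fun hj => h ⟨hi, hj⟩
        simp [Matrix.restr, hj]
      · rw [Matrix.pull_eq _ _ fun h => hi h.1, zero_mul]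
  simp only [fin, dif_pos hr]
  refine (hZ (I ×ˢ J) _ (fun x => (B'.pull 0 I I * A.restr I J) x.1 x.2) out.memory
    fun x _ => ?_).bind fun s mem' hm' hs => Prog.runs_ret ?_
  · rw [hBP]
    exact hF'.pull hz' I J x.1 x.2
  have hs' : ∀ i j, j ∈ J.filter (fun j => (i, j) ∈ s) ↔ (B'.pull 0 I I * A.restr I J) i j ≠ 0 := by
    intro i j
    rw [Finset.mem_filter, hs, Finset.mem_product]
    simp only
    refine ⟨fun h => h.2.2, fun h => ?_⟩
    rw [hBP] at h
    have : i ∈ I ∧ j ∈ J := by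
      by_contra h'
      exact h (Matrix.pull_eq _ _ h')
    exact ⟨this.2, this, by rwa [hBP]⟩
  have hpl : ∀ X : Matrix (Fin (I.card + N)) (Fin (I.card + N)) K, (∀ i j, i < j → X i j = 0) →
      ∀ i j, X.pull 0 I I i j ≠ 0 → i ∈ I ∧ j ∈ I ∧ j ≤ i := by
    intro X hX i j hij
    have : i ∈ I ∧ j ∈ I := by
      by_contra h'
      exact hij (Matrix.pull_eq _ _ h')
    refine ⟨this.1, this.2, ?_⟩
    by_contra hlt
    obtain ⟨u, hu, -⟩ := Finset.exists_nth? hIc this.1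
    obtain ⟨w, hw, -⟩ := Finset.exists_nth? hIc this.2
    rw [Matrix.pull_apply 0 _ hu hw] at hij
    exact hij (hX _ _ ((Finset.nth?_lt_iff hu hw).2 (not_le.1 hlt)))
  have hpm : ∀ X Y : Matrix (Fin (I.card + N)) (Fin (I.card + N)) K, (∀ i j, i < j → X i j = 0) →
      X * Y = 1 → ∀ i ∈ I, ∀ j, (X.pull 0 I I * Y.pull 0 I I) i j = if i = j then 1 else 0 := by
    intro X Y hX hXY i hi j
    obtain ⟨u, hu, -⟩ := Finset.exists_nth? hIc hi
    by_cases hj : j ∈ I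
    · obtain ⟨w, hw, -⟩ := Finset.exists_nth? hIc hj
      rw [Matrix.mul_pull hIc X _ Y hu (fun v k hv => Matrix.pull_apply 0 _ hv hw)
        (fun v hv => by rw [hX _ _ (hsub u v hv i hu), zero_mul]), hXY, Matrix.one_apply]
      congr 1
      refine propext ⟨fun h => ?_, fun h => ?_⟩
      · subst h; rw [hu] at hw; simpa using hw
      · subst h; exact Finset.nth?_inj hu hw
    · rw [if_neg (fun h : i = j => hj (h ▸ hi)), Matrix.mul_apply]
      exact Finset.sum_eq_zero fun k _ => by rw [Matrix.pull_eq 0 Y fun h => hj h.2, mul_zero]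
  refine ⟨C'.pull 0 I I, B'.pull 0 I I, (hCh.mono hm').pull (hm'.getElem?_some hz') I I,
    (hBh.mono hm').pull (hm'.getElem?_some hz') I I, hpl C' hCl, hpl B' hBl, hpm C' B' hCl hCB,
    fun i c hc => Finset.least?_some (hs' i) hc,
    fun i hc => Finset.least?_none (hs' i) hc, ?_⟩
  have hinj : ∀ i c, IsLead ((B'.pull 0 I I * A.restr I J) i) c →
      ∃ u, I.nth? (I.card + N) u = some i ∧ ∃ w, J.nth? J.card w = some c ∧
        ℓ u = Fin.castAdd _ w := by
    intro i c h
    have hic : i ∈ I ∧ c ∈ J := by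
      by_contra h'
      exact h.1 (by rw [hBP, Matrix.pull_eq _ _ h'])
    obtain ⟨u, hu, -⟩ := Finset.exists_nth? hIc hic.1
    obtain ⟨w, hw, -⟩ := Finset.exists_nth? (le_refl J.card) hic.2
    refine ⟨u, hu, w, hw, (hlead u).unique ⟨?_, fun x hx => ?_⟩⟩
    · have := h.1
      rw [hBP, Matrix.pull_apply 0 _ hu hw, ← hF] at this
      exact this
    · have hxb : (x : ℕ) < J.card := lt_trans (Fin.lt_def.1 hx) w.2
      have hx' : x = Fin.castAdd (I.card + N) ⟨x, hxb⟩ := Fin.ext rfl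
      have hw' : J.nth? J.card ⟨x, hxb⟩ = some (J.orderEmbOfFin rfl ⟨x, hxb⟩) := by
        simp [Finset.nth?, hxb]
      have := h.2 _ ((Finset.nth?_lt_iff hw' hw).1 (Fin.lt_def.2 (Fin.lt_def.1 hx)))
      rw [hBP, Matrix.pull_apply 0 _ hu hw', ← hF] at this
      rw [hx']
      exact this
  intro i j c hi hj
  obtain ⟨u, hu, w, hw, h8⟩ := hinj i c (Finset.least?_some (hs' i) hi)
  obtain ⟨u', hu', w', hw', h9⟩ := hinj j c (Finset.least?_some (hs' j) hj)
  have := hℓ (h8.trans ((Finset.nth?_inj hw hw') ▸ h9.symm))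
  subst this
  rw [hu] at hu'
  simpa using hu'

end Elimination

/-! ### Families with distinct leading positions -/

section Leads

variable {K : Type u} [Field K] {α ρ : Type*} [Fintype α] [Fintype ρ] {n : ℕ}

/-- In a linear combination of rows with distinct leading positions that vanishes on the first `j`
columns, the rows whose leading position is among these columns do not occur. -/
theorem eq_zero_of_leads {F : Matrix α (Fin n) K} {q : α → Option (Fin n)} {y : α → K} {j : ℕ}
    (hF : ∀ i c, y i ≠ 0 → q i = some c → IsLead (F i) c)
    (h0 : ∀ i (c : Fin n), y i ≠ 0 → q i = none → (c : ℕ) < j → F i c = 0)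
    (hinj : ∀ i i' c, y i ≠ 0 → y i' ≠ 0 → q i = some c → q i' = some c → i = i')
    (hy : ∀ c : Fin n, (c : ℕ) < j → (Matrix.vecMul y F) c = 0) (i : α) (c : Fin n)
    (hi : q i = some c) (hc : (c : ℕ) < j) : y i = 0 := by
  classical
  induction hm : (c : ℕ) using Nat.strong_induction_on generalizing i c with
  | _ m ih =>
    by_contra hyi
    have h := hy c hc
    rw [Matrix.vecMul, dotProduct, Finset.sum_eq_single i] at h
    · exact (mul_ne_zero hyi (hF i c hyi hi).1) h
    · intro i' _ hne
      by_cases hy' : y i' = 0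
      · rw [hy', zero_mul]
      · cases hq : q i' with
        | none => rw [h0 i' c hy' hq hc, mul_zero]
        | some c' =>
          rcases lt_trichotomy c c' with hcc | hcc | hcc
          · rw [(hF i' c' hy' hq).2 c hcc, mul_zero]
          · subst hcc
            exact absurd (hinj i' i c hy' hyi hq hi) hne
          · exact absurd (ih c' (by subst hm; exact hcc) i' c' hq (by
              have := Fin.lt_def.1 hcc; omega) rfl) hy'
    · simp

/-- Rows with distinct leading positions are at most as many as the rows of `G` of which they are
combinations, as far as the first `j` columns are concerned. -/
theorem card_le_of_leads {O : Finset α} {S : Finset ρ} {X : Matrix α ρ K} {G : Matrix ρ (Fin n) K}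
    {q : α → Option (Fin n)} {j : ℕ}
    (hO : ∀ p ∈ O, ∃ c, q p = some c ∧ (c : ℕ) < j ∧ IsLead ((X * G) p) c)
    (hinj : ∀ i i' c, q i = some c → q i' = some c → i = i')
    (hS : ∀ p ∈ O, ∀ g, X p g ≠ 0 → ∀ c : Fin n, (c : ℕ) < j → G g c ≠ 0 → g ∈ S) :
    O.card ≤ S.card := by
  classical
  let f : (O → K) →ₗ[K] (S → K) :=
    (Matrix.vecMulLinear (Matrix.of fun (p : O) (g : S) => X p g))
  have hf : Function.Injective f := by
    rw [← LinearMap.ker_eq_bot, LinearMap.ker_eq_bot']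
    intro y hy
    have hy' : ∀ g : S, ∑ p : O, y p * X p g = 0 := fun g => congrFun hy g
    let y' : α → K := fun p => if h : p ∈ O then y ⟨p, h⟩ else 0
    have hsum : ∀ φ : α → K, ∑ p, y' p * φ p = ∑ p : O, y p * φ p := by
      intro φ
      rw [← Finset.sum_subset (Finset.subset_univ O) (fun p _ hp => by simp [y', hp]),
        ← Finset.sum_coe_sort]
      exact Finset.sum_congr rfl fun p _ => by simp [y']
    have hmem : ∀ p, y' p ≠ 0 → p ∈ O := fun p hp => by
      by_contra h
      exact hp (by simp [y', h])
    have key := eq_zero_of_leads (F := X * G) (q := q) (y := y') (j := j)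
      (fun i c hi hc => by
        obtain ⟨c', h1, -, h2⟩ := hO i (hmem i hi)
        rw [h1] at hc
        cases hc
        exact h2)
      (fun i c hi hc => by
        obtain ⟨c', h1, -, h2⟩ := hO i (hmem i hi)
        rw [h1] at hc
        cases hc)
      (fun i i' c _ _ => hinj i i' c)
      (fun c hc => by
        rw [← Matrix.vecMul_vecMul, Matrix.vecMul, dotProduct]
        refine Finset.sum_eq_zero fun g _ => ?_
        by_cases hg : g ∈ S
        · have : Matrix.vecMul y' X g = 0 := (hsum fun p => X p g).trans (hy' ⟨g, hg⟩)
          rw [this, zero_mul]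
        · by_cases hG : G g c = 0
          · rw [hG, mul_zero]
          · have : Matrix.vecMul y' X g = 0 := by
              refine (hsum fun p => X p g).trans (Finset.sum_eq_zero fun p _ => ?_)
              by_cases hX : X p g = 0
              · rw [hX, mul_zero]
              · exact absurd (hS p p.2 g hX c hc hG) hg
            rw [this, zero_mul])
    ext p
    obtain ⟨c, h1, h2, -⟩ := hO p p.2
    have := key p c h1 h2
    simpa [y'] using this
  have := LinearMap.finrank_le_finrank_of_injective hf
  simpa using this

end Leads

/-! ### Coordinates that preserve leading positions -/

section SameFlag

variable {K : Type u} [Field K] {ρ : Type} [Fintype ρ] {n : ℕ}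

/-- On coefficient vectors `x` supported on `A`, the vectors `x * G` and `x * T` vanish on the same
initial segments of the first `j` columns; in particular they have the same leading positions. -/
def SameFlag (A : Finset ρ) (j : ℕ) (G T : Matrix ρ (Fin n) K) : Prop :=
  ∀ x : ρ → K, (∀ g, x g ≠ 0 → g ∈ A) → ∀ c ≤ j,
    (∀ c' : Fin n, (c' : ℕ) < c → Matrix.vecMul x G c' = 0) ↔
      ∀ c' : Fin n, (c' : ℕ) < c → Matrix.vecMul x T c' = 0

theorem SameFlag.lead_iff {A : Finset ρ} {j : ℕ} {G T : Matrix ρ (Fin n) K} (h : SameFlag A j G T)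
    {x : ρ → K} (hx : ∀ g, x g ≠ 0 → g ∈ A) {c : Fin n} (hc : (c : ℕ) < j) :
    IsLead (Matrix.vecMul x G) c ↔ IsLead (Matrix.vecMul x T) c := by
  have aux : ∀ v : Fin n → K, IsLead v c ↔
      (∀ c' : Fin n, (c' : ℕ) < c → v c' = 0) ∧ ¬ ∀ c' : Fin n, (c' : ℕ) < c + 1 → v c' = 0 := by
    intro v
    constructor
    · rintro ⟨h1, h2⟩
      exact ⟨fun c' hc' => h2 c' hc', fun h3 => h1 (h3 c (by omega))⟩
    · rintro ⟨h1, h2⟩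
      refine ⟨fun h3 => h2 fun c' hc' => ?_, fun c' hc' => h1 c' hc'⟩
      rcases Nat.lt_succ_iff_lt_or_eq.1 hc' with h4 | h4
      · exact h1 c' h4
      · rw [Fin.ext h4, h3]
  rw [aux, aux, h x hx c hc.le, h x hx (c + 1) hc]

/-- Extension of the coordinates by further columns, where rows may be lost, and new rows have to
vanish on the old columns. -/
theorem SameFlag.extend {A₁ A₂ : Finset ρ} {j₁ j₂ : ℕ} {G T P : Matrix ρ (Fin n) K}
    (h : SameFlag A₁ j₁ G T) (hT : ∀ g c, T g c ≠ 0 → g ∈ A₁)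
    (hA : ∀ g ∈ A₂, g ∉ A₁ → ∀ c : Fin n, (c : ℕ) < j₁ → G g c = 0)
    (hP₁ : ∀ g ∈ A₂, ∀ c : Fin n, (c : ℕ) < j₁ → P g c = T g c)
    (hP₂ : ∀ g ∈ A₂, ∀ c : Fin n, j₁ ≤ c → (c : ℕ) < j₂ → P g c = G g c) :
    SameFlag A₂ j₂ G P := by
  classical
  intro x hx
  have key : ∀ M N : Matrix ρ (Fin n) K, ∀ c, (∀ g ∈ A₂, M g c = N g c) →
      Matrix.vecMul x M c = Matrix.vecMul x N c := by
    intro M N c h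
    simp only [Matrix.vecMul_apply_eq_sum]
    refine Finset.sum_congr rfl fun g _ => ?_
    by_cases hg : x g = 0
    · rw [hg, zero_mul, zero_mul]
    · rw [h g (hx g hg)]
  have low : ∀ c ≤ j₁, (∀ c' : Fin n, (c' : ℕ) < c → Matrix.vecMul x G c' = 0) ↔
      ∀ c' : Fin n, (c' : ℕ) < c → Matrix.vecMul x P c' = 0 := by
    intro c hc
    let x' : ρ → K := fun g => if g ∈ A₁ then x g else 0
    have hx' : ∀ g, x' g ≠ 0 → g ∈ A₁ := fun g hg => by
      by_contra h'
      exact hg (by simp [x', h'])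
    have h1 : ∀ c' : Fin n, (c' : ℕ) < c → Matrix.vecMul x G c' = Matrix.vecMul x' G c' := by
      intro c' hc'
      simp only [Matrix.vecMul_apply_eq_sum]
      refine Finset.sum_congr rfl fun g _ => ?_
      by_cases hg : g ∈ A₁
      · simp [x', hg]
      · by_cases hg' : x g = 0
        · simp [x', hg']
        · rw [hA g (hx g hg') hg c' (by omega), mul_zero, mul_zero]
    have h2 : ∀ c' : Fin n, (c' : ℕ) < c → Matrix.vecMul x P c' = Matrix.vecMul x' T c' := by
      intro c' hc'
      rw [key P T c' fun g hg => hP₁ g hg c' (by omega)]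
      simp only [Matrix.vecMul_apply_eq_sum]
      refine Finset.sum_congr rfl fun g _ => ?_
      by_cases hg : g ∈ A₁
      · simp [x', hg]
      · have : T g c' = 0 := by
          by_contra h'
          exact hg (hT g c' h')
        rw [this, mul_zero, mul_zero]
    have h3 := h x' hx' c hc
    constructor
    · intro h4 c' hc'
      rw [h2 c' hc']
      exact h3.1 (fun c' hc' => h1 c' hc' ▸ h4 c' hc') c' hc'
    · intro h4 c' hc'
      rw [h1 c' hc']
      exact h3.2 (fun c' hc' => h2 c' hc' ▸ h4 c' hc') c' hc'
  intro c hc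
  rcases le_or_gt c j₁ with hcj | hcj
  · exact low c hcj
  · have high : ∀ c' : Fin n, j₁ ≤ c' → (c' : ℕ) < c →
        Matrix.vecMul x P c' = Matrix.vecMul x G c' := fun c' h1 h2 =>
      key P G c' fun g hg => hP₂ g hg c' h1 (by omega)
    have h3 := low j₁ le_rfl
    constructor
    · intro h4 c' hc'
      rcases lt_or_ge (c' : ℕ) j₁ with h5 | h5
      · exact h3.1 (fun c' h => h4 c' (by omega)) c' h5
      · rw [high c' h5 hc', h4 c' hc']
    · intro h4 c' hc'
      rcases lt_or_ge (c' : ℕ) j₁ with h5 | h5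
      · exact h3.2 (fun c' h => h4 c' (by omega)) c' h5
      · rw [← high c' h5 hc', h4 c' hc']

theorem SameFlag.trans {A : Finset ρ} {j : ℕ} {G T T' : Matrix ρ (Fin n) K}
    (h : SameFlag A j G T) (h' : SameFlag A j T T') : SameFlag A j G T' :=
  fun x hx c hc => (h x hx c hc).trans (h' x hx c hc)

open Classical in
/-- The columns of `C` placed at the leading positions recorded by `q`. -/
noncomputable def Matrix.atLeads {δ : Type*} (z : δ) (C : Matrix ρ ρ δ) (q : ρ → Option (Fin n)) :
    Matrix ρ (Fin n) δ :=
  Matrix.of fun g c => if h : ∃ i, q i = some c then C g h.choose else z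

theorem IsElimination.eq_mul {α β : Type*} [LinearOrder α] [LinearOrder β] [Fintype α]
    {I : Finset α} {P : Matrix α β K} {C B : Matrix α α K} {q : α → Option β}
    (h : IsElimination I P C B q) {γ : Type*} (M : Matrix α γ K) (hM : ∀ i c, M i c ≠ 0 → i ∈ I) :
    C * (B * M) = M := by
  classical
  rw [← Matrix.mul_assoc]
  ext i c
  rw [Matrix.mul_apply]
  by_cases hi : i ∈ I
  · simp [h.mul_C i hi]
  · have h0 : M i c = 0 := by
      by_contra h'
      exact hi (hM i c h')
    rw [h0]
    refine Finset.sum_eq_zero fun j _ => ?_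
    have : (C * B) i j = 0 := by
      rw [Matrix.mul_apply]
      refine Finset.sum_eq_zero fun l _ => ?_
      have : C i l = 0 := by
        by_contra h'
        exact hi (h.supp_C i l h').1
      rw [this, zero_mul]
    rw [this, zero_mul]

/-- After elimination, a combination of the rows of `P` is known by its coordinates with respect to
the reduced rows, arranged by their leading positions. -/
theorem IsElimination.sameFlag [LinearOrder ρ] {I : Finset ρ} {P : Matrix ρ (Fin n) K}
    {C B : Matrix ρ ρ K} {q : ρ → Option (Fin n)} (h : IsElimination I P C B q)
    (hP : ∀ g c, P g c ≠ 0 → g ∈ I) (j : ℕ) :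
    SameFlag I j P (C.atLeads 0 q) := by
  intro x hx c hc
  have h1 : Matrix.vecMul x P = Matrix.vecMul (Matrix.vecMul x C) (B * P) := by
    rw [Matrix.vecMul_vecMul, h.eq_mul P hP]
  have h2 : ∀ i c', q i = some c' → Matrix.vecMul x (C.atLeads 0 q) c' = Matrix.vecMul x C i := by
    intro i c' hi
    simp only [Matrix.vecMul_apply_eq_sum]
    refine Finset.sum_congr rfl fun g _ => ?_
    have hex : ∃ i, q i = some c' := ⟨i, hi⟩
    rw [Matrix.atLeads, Matrix.of_apply, dif_pos hex, h.inj _ _ _ hex.choose_spec hi]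
  rw [h1]
  constructor
  · intro h3 c' hc'
    by_cases hex : ∃ i, q i = some c'
    · obtain ⟨i, hi⟩ := hex
      rw [h2 i c' hi]
      exact eq_zero_of_leads (fun i c _ => h.lead i c)
        (fun i c _ hi _ => by rw [h.zero i hi]; rfl) (fun i i' c _ _ => h.inj i i' c) h3 i c' hi hc'
    · rw [Matrix.vecMul_apply_eq_sum]
      refine Finset.sum_eq_zero fun g _ => ?_
      rw [Matrix.atLeads, Matrix.of_apply, dif_neg hex, mul_zero]
  · intro h3 c' hc'
    rw [Matrix.vecMul_apply_eq_sum]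
    refine Finset.sum_eq_zero fun i _ => ?_
    cases hi : q i with
    | none => rw [h.zero i hi, Pi.zero_apply, mul_zero]
    | some c'' =>
      rcases lt_or_ge c' c'' with h4 | h4
      · rw [(h.lead i c'' hi).2 c' h4, mul_zero]
      · rw [← h2 i c'' hi, h3 c'' (by have := Fin.le_def.1 h4; omega), zero_mul]

end SameFlag

/-! ### Coordinates for all leading blocks -/

section Staircase

variable {K : Type u} [Field K] {ρ : Type} [Fintype ρ] {n : ℕ}

/-- A factorization `Ct * G`, whose terms start at the rows `pr g` and columns `qr g`, such that at
most `b` terms contribute to each block of the first `k` rows and `n - k` columns, and at most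
`2 * b` terms start in any `b` consecutive rows, or columns. -/
structure IsStaircase (b : ℕ) (pr qr : ρ → ℕ) (Ct : Matrix (Fin n) ρ K) (G : Matrix ρ (Fin n) K) :
    Prop where
  one_le : 1 ≤ b
  supp_Ct : ∀ i g, Ct i g ≠ 0 → pr g ≤ i
  supp_G : ∀ g c, G g c ≠ 0 → qr g ≤ c
  card_le : ∀ k, (Finset.univ.filter fun g => pr g < k ∧ qr g + k < n).card ≤ b
  card_pr : ∀ k, (Finset.univ.filter fun g => k ≤ pr g ∧ pr g < k + b).card ≤ 2 * b
  card_qr : ∀ k, (Finset.univ.filter fun g => k ≤ qr g ∧ qr g < k + b).card ≤ 2 * b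

/-- The terms that contribute to the block of the first `k + b` rows and `n - k` columns. -/
def activeTerms (n b : ℕ) (pr qr : ρ → ℕ) (k : ℕ) : Finset ρ :=
  Finset.univ.filter fun g => pr g < k + b ∧ qr g + k < n

theorem mem_activeTerms {b : ℕ} {pr qr : ρ → ℕ} {k : ℕ} {g : ρ} :
    g ∈ activeTerms n b pr qr k ↔ pr g < k + b ∧ qr g + k < n := by
  simp [activeTerms]

theorem IsStaircase.card_activeTerms {b : ℕ} {pr qr : ρ → ℕ} {Ct : Matrix (Fin n) ρ K}
    {G : Matrix ρ (Fin n) K} (h : IsStaircase b pr qr Ct G) (k : ℕ) :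
    (activeTerms n b pr qr k).card ≤ 3 * b := by
  classical
  have hsub : activeTerms n b pr qr k ⊆
      (Finset.univ.filter fun g => pr g < k + b ∧ qr g + (k + b) < n) ∪
        Finset.univ.filter fun g => n - k - b ≤ qr g ∧ qr g < n - k - b + b := by
    intro g hg
    rw [mem_activeTerms] at hg
    simp only [Finset.mem_union, Finset.mem_filter, Finset.mem_univ, true_and]
    omega
  have h1 := Finset.card_le_card hsub
  have h2 := Finset.card_union_le
    (Finset.univ.filter fun g => pr g < k + b ∧ qr g + (k + b) < n)
    (Finset.univ.filter fun g => n - k - b ≤ qr g ∧ qr g < n - k - b + b)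
  have h3 := h.card_le (k + b)
  have h4 := h.card_qr (n - k - b)
  omega

/-- The columns in `Q` of the matrix `T` give coordinates for the rows of `G` in `A`, as far as the
first `j` columns are concerned. -/
structure IsCoord (A : Finset ρ) (j : ℕ) (G T : Matrix ρ (Fin n) K) (Q : Finset (Fin n)) :
    Prop where
  supp : ∀ g c, T g c ≠ 0 → g ∈ A ∧ c ∈ Q
  lt : ∀ c ∈ Q, (c : ℕ) < j
  card_le : Q.card ≤ A.card
  flag : SameFlag A j G T

theorem Matrix.restr_apply_ne {α β : Type*} [LinearOrder α] [LinearOrder β] {I : Finset α}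
    {J : Finset β} {M : Matrix α β K} {i : α} {j : β} (h : M.restr I J i j ≠ 0) :
    i ∈ I ∧ j ∈ J ∧ M i j ≠ 0 := by
  unfold Matrix.restr at h
  simp only [Matrix.of_apply, ne_eq, ite_eq_right_iff, Classical.not_imp] at h
  exact ⟨h.1.1, h.1.2, h.2⟩

theorem IsElimination.mem_of_lead {α β : Type*} [LinearOrder α] [LinearOrder β] [Fintype α]
    {I : Finset α} {P : Matrix α β K} {C B : Matrix α α K} {q : α → Option β}
    (h : IsElimination I P C B q) {i : α} {c : β} (hi : q i = some c) :
    i ∈ I ∧ ∃ j, P j c ≠ 0 := by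
  have h1 := (h.lead i c hi).1
  rw [Matrix.mul_apply] at h1
  obtain ⟨j, -, hj⟩ := Finset.exists_ne_zero_of_sum_ne_zero h1
  exact ⟨(h.supp_B i j (left_ne_zero_of_mul hj)).1, j, right_ne_zero_of_mul hj⟩

theorem Holds.atLeads {mem : List K} {z : ℕ} (hz : mem[z]? = some 0) {a : Matrix ρ ρ ℕ}
    {M : Matrix ρ ρ K} (h : Holds mem a M) (q : ρ → Option (Fin n)) :
    Holds mem (a.atLeads z q) (M.atLeads 0 q) := by
  intro i j
  simp only [Matrix.atLeads, Matrix.of_apply]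
  split_ifs
  · exact h _ _
  · exact hz

variable [LinearOrder ρ]

/-- Coordinates for `b` more columns. -/
theorem IsCoord.step {b k : ℕ} {pr qr : ρ → ℕ} {Ct : Matrix (Fin n) ρ K}
    {G T P : Matrix ρ (Fin n) K} {Q J : Finset (Fin n)} (hs : IsStaircase b pr qr Ct G)
    (h : IsCoord (activeTerms n b pr qr (k + b)) (n - (k + b)) G T Q)
    (hJ : J = Q ∪ Finset.univ.filter fun c : Fin n => n - (k + b) ≤ c ∧ (c : ℕ) < n - k)
    (hP : P = Matrix.of fun g (c : Fin n) => if (c : ℕ) < n - (k + b) then T g c else G g c)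
    {C B : Matrix ρ ρ K} {q : ρ → Option (Fin n)}
    (he : IsElimination (activeTerms n b pr qr k) (P.restr (activeTerms n b pr qr k) J) C B q) :
    IsCoord (activeTerms n b pr qr k) (n - k) G (C.atLeads 0 q)
      (Finset.univ.filter fun c => ∃ i, q i = some c) where
  supp g c hgc := by
    unfold Matrix.atLeads at hgc
    simp only [Matrix.of_apply, ne_eq, dite_eq_right_iff, not_forall] at hgc
    obtain ⟨h1, h2⟩ := hgc
    exact ⟨(he.supp_C _ _ h2).1, by simpa using h1⟩
  lt c hc := by
    simp only [Finset.mem_filter, Finset.mem_univ, true_and] at hc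
    obtain ⟨i, hi⟩ := hc
    obtain ⟨-, j, hj⟩ := he.mem_of_lead hi
    have := (Matrix.restr_apply_ne hj).2.1
    rw [hJ, Finset.mem_union] at this
    rcases this with h1 | h1
    · have := h.lt c h1
      omega
    · simp only [Finset.mem_filter, Finset.mem_univ, true_and] at h1
      exact h1.2
  card_le := by
    rw [← Finset.card_map ⟨some, Option.some_injective _⟩]
    refine le_trans (Finset.card_le_card ?_) (Finset.card_image_le (f := q))
    intro x hx
    simp only [Finset.mem_map, Finset.mem_filter, Finset.mem_univ, true_and,
      Function.Embedding.coeFn_mk] at hx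
    obtain ⟨c, ⟨i, hi⟩, rfl⟩ := hx
    exact Finset.mem_image.2 ⟨i, (he.mem_of_lead hi).1, hi⟩
  flag := by
    refine SameFlag.trans (SameFlag.extend h.flag (fun g c hgc => (h.supp g c hgc).1) ?_ ?_ ?_)
      (he.sameFlag (fun g c hgc => (Matrix.restr_apply_ne hgc).1) (n - k))
    · intro g hg hg' c hc
      by_contra h0
      have := hs.supp_G g c h0
      rw [mem_activeTerms] at hg hg'
      omega
    · intro g hg c hc
      simp only [Matrix.restr, Matrix.of_apply, hg, true_and, hP, hc, if_true]
      by_cases hT : T g c = 0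
      · simp [hT]
      · rw [if_pos (hJ ▸ Finset.mem_union_left _ (h.supp g c hT).2)]
    · intro g hg c hc hc'
      have hcJ : c ∈ J := by
        rw [hJ]
        exact Finset.mem_union_right _ (by simp; omega)
      simp [Matrix.restr, hg, hP, hcJ, not_lt.2 hc]

/-- Coordinates for the first `n - a * b` columns, for all `a`. They are computed from `a = N`,
where no columns are left, down to `a = 0`: the coordinates for `a + 1`, followed by the next `b`
columns of `G`, form a matrix with `O(b)` rows and columns, whose elimination gives the coordinates
for `a`. -/
theorem exists_prog_coord {ω CRF : ℝ} (hω : 2 < ω) (hRF : CRETime K ω CRF) :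
    ∃ κ : ℝ, 0 ≤ κ ∧ ∀ (ρ : Type) [LinearOrder ρ] [Fintype ρ] (n : ℕ),
      ∃ P : ℕ → ℕ → (ρ → ℕ) → (ρ → ℕ) → Matrix ρ (Fin n) ℕ →
          Prog K (ℕ → Matrix ρ (Fin n) ℕ × Finset (Fin n)),
        ∀ (b N : ℕ) (pr qr : ρ → ℕ) (Ct : Matrix (Fin n) ρ K) (G : Matrix ρ (Fin n) K)
          (aG : Matrix ρ (Fin n) ℕ) (mem : List K),
          IsStaircase b pr qr Ct G → n ≤ N * b → Holds mem aG G →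
          (P b N pr qr aG).Runs mem (N * (κ * ((5 * b : ℕ) : ℝ) ^ ω)) fun x mem' =>
            ∀ a ≤ N, ∃ T, Holds mem' (x a).1 T ∧
              IsCoord (activeTerms n b pr qr (a * b)) (n - a * b) G T (x a).2 := by
  obtain ⟨κ, hκ, hel⟩ := exists_prog_elimination hω hRF
  refine ⟨κ, hκ, fun ρ _ _ n => ?_⟩
  obtain ⟨E, hE⟩ := hel ρ (Fin n)
  let step (b k : ℕ) (pr qr : ρ → ℕ) (aG : Matrix ρ (Fin n) ℕ) (z : ℕ)
      (x : Matrix ρ (Fin n) ℕ × Finset (Fin n)) : Prog K (Matrix ρ (Fin n) ℕ × Finset (Fin n)) :=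
    (E (activeTerms n b pr qr k)
      (x.2 ∪ Finset.univ.filter fun c : Fin n => n - (k + b) ≤ c ∧ (c : ℕ) < n - k)
      (Matrix.of fun g c => if (c : ℕ) < n - (k + b) then x.1 g c else aG g c)).bind fun r =>
        .ret (r.1.atLeads z r.2.2, Finset.univ.filter fun c => ∃ i, r.2.2 i = some c)
  refine ⟨fun b N pr qr aG => .const 0 fun z => Prog.iter (fun t x =>
    (step b ((N - 1 - t) * b) pr qr aG z (x (N - t))).bind fun r =>
      .ret (Function.update x (N - 1 - t) r)) N fun _ => (fun _ _ => z, ∅), ?_⟩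
  intro b N pr qr Ct G aG mem hs hN hG
  refine Prog.runs_const fun z hz => ?_
  replace hG := hG.mono (List.prefix_append mem [0])
  generalize mem ++ [0] = mem at *
  refine (Prog.runs_iter (fun t x mem' => ∀ a, N - t ≤ a → a ≤ N → ∃ T, Holds mem' (x a).1 T ∧
    IsCoord (activeTerms n b pr qr (a * b)) (n - a * b) G T (x a).2) ?_ ?_).mono le_rfl ?_
  · intro a ha ha'
    obtain rfl : a = N := by omega
    refine ⟨0, fun i j => hz, fun g c h => absurd rfl h, fun c hc => absurd hc (by simp), by simp,
      fun x hx c hc => ?_⟩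
    have : n - a * b = 0 := by omega
    constructor <;> intro _ c' hc' <;> omega
  · intro t ht x mem' hm hx
    have hb := hs.one_le
    obtain ⟨T, hT, hc⟩ := hx (N - t) le_rfl (by omega)
    have hk : (N - t) * b = (N - 1 - t) * b + b := by
      have : N - t = (N - 1 - t) + 1 := by omega
      rw [this, Nat.add_mul, Nat.one_mul]
    rw [hk] at hc
    obtain ⟨k, hk'⟩ : ∃ k, (N - 1 - t) * b = k := ⟨_, rfl⟩
    rw [hk'] at hc hk ⊢
    have hA := hs.card_activeTerms k
    have hJ : ((x (N - t)).2 ∪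
        Finset.univ.filter fun c : Fin n => n - (k + b) ≤ c ∧ (c : ℕ) < n - k).card ≤ 5 * b := by
      refine (Finset.card_union_le _ _).trans ?_
      have h1 : (Finset.univ.filter fun c : Fin n => n - (k + b) ≤ c ∧ (c : ℕ) < n - k).card ≤
          b := by
        rw [← Finset.card_map Fin.valEmbedding]
        refine (Finset.card_le_card (t := Finset.Ico (n - (k + b)) (n - k)) ?_).trans ?_
        · intro y hy
          simp only [Finset.mem_map, Finset.mem_filter, Finset.mem_univ, true_and,
            Fin.valEmbedding_apply] at hy
          obtain ⟨c, hc, rfl⟩ := hy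
          exact Finset.mem_Ico.2 hc
        · rw [Nat.card_Ico]; omega
      have h2 := hc.card_le.trans (hs.card_activeTerms (k + b))
      omega
    have hrun := hE (5 * b) (activeTerms n b pr qr k) _
      (Matrix.of fun g c => if (c : ℕ) < n - (k + b) then (x (N - t)).1 g c else aG g c)
      (Matrix.of fun g c => if (c : ℕ) < n - (k + b) then T g c else G g c) mem'
      (by omega) (by omega) hJ (by
        intro g c
        simp only [Matrix.of_apply]
        split_ifs
        · exact hT g c
        · exact hm.getElem?_some (hG g c))
    refine ((hrun.bind (c' := 0) fun r mem₁ hm₁ ⟨C, B, hC, hB, he⟩ => Prog.runs_ret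
      (Q := fun (y : Matrix ρ (Fin n) ℕ × Finset (Fin n)) mem₂ => ∃ T', Holds mem₂ y.1 T' ∧
        IsCoord (activeTerms n b pr qr k) (n - k) G T' y.2) ?_).bind (c' := 0)
      fun y mem₁ hm₁ hy => Prog.runs_ret ?_).mono (by simp) fun _ _ _ h => h
    · exact ⟨_, hC.atLeads (hm₁.getElem?_some (hm.getElem?_some hz)) r.2.2,
        IsCoord.step hs hc rfl rfl he⟩
    · intro a ha ha'
      by_cases hat : a = N - 1 - t
      · subst hat
        obtain ⟨T', h1, h2⟩ := hy
        simp only [Function.update_self]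
        rw [hk']
        exact ⟨T', h1, h2⟩
      · obtain ⟨T', h1, h2⟩ := hx a (by omega) ha'
        rw [Function.update_of_ne hat]
        exact ⟨T', h1.mono hm₁, h2⟩
  · intro x mem' _ h a ha
    exact h a (by omega) ha

end Staircase

/-! ### Row-wise decomposition of the staircase -/

section RowSweep

variable {K : Type u} [Field K] {ρ : Type} [Fintype ρ] {n : ℕ}

/-- Decomposition of the first `k` rows of the blocks of `Ct * G` on and above the antidiagonal, for
blocks of size `b`, as `C * (X * G)`, where `C` is lower triangular and row `p` of `X * G` has its
leading entry at `q p`. -/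
structure IsSweep (b k : ℕ) (pr qr : ρ → ℕ) (Ct : Matrix (Fin n) ρ K) (G : Matrix ρ (Fin n) K)
    (q : Fin n → Option (Fin n)) (X : Matrix (Fin n) ρ K) (C : Matrix (Fin n) (Fin n) K) :
    Prop where
  piv : ∀ p c, q p = some c → (p : ℕ) < k ∧ c + p / b * b < n
  supp_X : ∀ p g, X p g ≠ 0 → pr g < p / b * b + b ∧ qr g + p / b * b < n
  lead : ∀ p c, q p = some c → IsLead ((X * G) p) c
  inj : ∀ i j c, q i = some c → q j = some c → i = j
  supp_C : ∀ i p, C i p ≠ 0 → p ≤ i ∧ q p ≠ none ∧ (i : ℕ) < k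
  diag : ∀ p c, q p = some c → C p p ≠ 0
  factor : ∀ i c : Fin n, (i : ℕ) < k → c + i / b * b < n → (Ct * G) i c = (C * (X * G)) i c

/-- The rows above row `k` whose leading position is among the first `n - k` columns. -/
def oldRows (q : Fin n → Option (Fin n)) (k : ℕ) : Finset (Fin n) :=
  Finset.univ.filter fun p => (p : ℕ) < k ∧ ∃ c, q p = some c ∧ c + k < n

/-- The rows `k`, …, `k + b - 1`. -/
def newRows (n b k : ℕ) : Finset (Fin n) :=
  Finset.univ.filter fun p => k ≤ p ∧ (p : ℕ) < k + b

theorem card_newRows (n b k : ℕ) : (newRows n b k).card ≤ b := by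
  rw [newRows, ← Finset.card_map Fin.valEmbedding]
  refine (Finset.card_le_card (t := Finset.Ico k (k + b)) ?_).trans (by simp)
  intro y hy
  simp only [Finset.mem_map, Finset.mem_filter, Finset.mem_univ, true_and,
    Fin.valEmbedding_apply] at hy
  obtain ⟨c, hc, rfl⟩ := hy
  exact Finset.mem_Ico.2 hc

theorem mem_oldRows {q : Fin n → Option (Fin n)} {k : ℕ} {p : Fin n} :
    p ∈ oldRows q k ↔ (p : ℕ) < k ∧ ∃ c, q p = some c ∧ c + k < n := by
  simp [oldRows]

theorem mem_newRows {b k : ℕ} {p : Fin n} : p ∈ newRows n b k ↔ k ≤ p ∧ (p : ℕ) < k + b := by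
  simp [newRows]

theorem div_mul_add_le {p a b : ℕ} (h : p < a * b) : p / b * b + b ≤ a * b := by
  have hb : 0 < b := Nat.pos_of_ne_zero fun h0 => by simp [h0] at h
  have : p / b + 1 ≤ a := (Nat.div_lt_iff_lt_mul hb).2 h
  calc p / b * b + b = (p / b + 1) * b := by ring
    _ ≤ a * b := Nat.mul_le_mul_right b this

theorem div_mul_eq_of_mem {p a b : ℕ} (h : a * b ≤ p) (h' : p < a * b + b) :
    p / b * b = a * b := by
  congr 1
  exact Nat.div_eq_of_lt_le h (by rw [Nat.add_mul, Nat.one_mul]; exact h')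

/-- The previous rows that still matter are independent combinations of at most `b` terms. -/
theorem IsSweep.card_oldRows {a b : ℕ} {pr qr : ρ → ℕ} {Ct : Matrix (Fin n) ρ K}
    {G : Matrix ρ (Fin n) K} {q : Fin n → Option (Fin n)} {X : Matrix (Fin n) ρ K}
    {C : Matrix (Fin n) (Fin n) K} (hs : IsStaircase b pr qr Ct G)
    (h : IsSweep b (a * b) pr qr Ct G q X C) : (oldRows q (a * b)).card ≤ b := by
  refine (card_le_of_leads (X := X) (G := G) (q := q) (j := n - a * b) ?_ h.inj ?_).trans
    (hs.card_le (a * b))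
  · intro p hp
    obtain ⟨-, c, hc, hcn⟩ := mem_oldRows.1 hp
    exact ⟨c, hc, by omega, h.lead p c hc⟩
  · intro p hp g hX c hc hG
    have h1 := hs.supp_G g c hG
    have h2 := (h.supp_X p g hX).1
    have h3 := div_mul_add_le (mem_oldRows.1 hp).1
    simp only [Finset.mem_filter, Finset.mem_univ, true_and]
    omega

/-- The matrix whose rows are the coefficients of the previous rows and of the new rows. -/
def stackRows {δ : Type*} (k : ℕ) (X Ct : Matrix (Fin n) ρ δ) : Matrix (Fin n) ρ δ :=
  Matrix.of fun i g => if (i : ℕ) < k then X i g else Ct i g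

theorem Matrix.restr_eq_self {α β : Type*} [LinearOrder α] [LinearOrder β] {I : Finset α}
    {J : Finset β} {M : Matrix α β K} (h : ∀ i j, M i j ≠ 0 → i ∈ I ∧ j ∈ J) :
    M.restr I J = M := by
  ext i j
  by_cases hM : M i j = 0
  · simp [Matrix.restr, hM]
  · simp [Matrix.restr, h i j hM]

/-- The next `b` rows are added. Elimination is applied to the previous rows `O` that still matter,
followed by the new rows, both in coordinates. In `X * G` the previous rows stay as they are, while
the elimination reduces them too; the coefficients `C'` with respect to the reduced previous rows
are converted by the block of `B` at `O`. Since the leading positions of the previous rows are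
attained by the reduced previous rows, those of the reduced new rows are different. -/
theorem IsSweep.step [LinearOrder ρ] {a b k : ℕ} (hk : a * b = k) {pr qr : ρ → ℕ}
    {Ct : Matrix (Fin n) ρ K} {G T : Matrix ρ (Fin n) K} {Q : Finset (Fin n)}
    {q : Fin n → Option (Fin n)} {X : Matrix (Fin n) ρ K} {C : Matrix (Fin n) (Fin n) K}
    (hs : IsStaircase b pr qr Ct G) (h : IsSweep b k pr qr Ct G q X C)
    (hT : IsCoord (activeTerms n b pr qr k) (n - k) G T Q) {A : Finset ρ}
    (hA : A = activeTerms n b pr qr k) {O I : Finset (Fin n)} (hO : O = oldRows q k)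
    (hI : I = O ∪ newRows n b k)
    {C' B : Matrix (Fin n) (Fin n) K} {q' : Fin n → Option (Fin n)}
    (he : IsElimination I (((stackRows k X Ct).restr I A * T.restr A Q).restr I Q) C' B q') :
    IsSweep b (k + b) pr qr Ct G (fun i => if (i : ℕ) < k then q i else q' i)
      (Matrix.of fun i g => if (i : ℕ) < k then X i g else
        if q' i = none then 0 else (B.restr I I * (stackRows k X Ct).restr I A) i g)
      (Matrix.of fun i p => if (i : ℕ) < k then C i p else
        if (p : ℕ) < k then (C'.restr I O * B.restr O O) i p else
          if q' p = none then 0 else C' i p) := by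
  subst hA
  set A := activeTerms n b pr qr k with hA
  set H := (stackRows k X Ct).restr I A with hH
  have hsuppH : ∀ i g, H i g ≠ 0 → i ∈ I ∧ g ∈ A := fun i g hg =>
    ⟨(Matrix.restr_apply_ne hg).1, (Matrix.restr_apply_ne hg).2.1⟩
  rw [Matrix.restr_eq_self hT.supp, Matrix.restr_eq_self (fun i c hic => by
    rw [Matrix.mul_apply] at hic
    obtain ⟨g, -, hg⟩ := Finset.exists_ne_zero_of_sum_ne_zero hic
    exact ⟨(hsuppH i g (left_ne_zero_of_mul hg)).1,
      (hT.supp g c (right_ne_zero_of_mul hg)).2⟩)] at he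
  have hBr : B.restr I I = B := Matrix.restr_eq_self fun i j hij =>
    ⟨(he.supp_B i j hij).1, (he.supp_B i j hij).2.1⟩
  rw [hBr]
  have hmemO : ∀ p ∈ I, (p : ℕ) < k → p ∈ O := by
    intro p hp hpk
    rw [hI, Finset.mem_union, mem_newRows] at hp
    rcases hp with hp | hp
    · exact hp
    · omega
  have hIn : ∀ p ∈ I, k ≤ (p : ℕ) → p ∈ newRows n b k := by
    intro p hp hpk
    rw [hI, Finset.mem_union, hO, mem_oldRows] at hp
    rcases hp with hp | hp
    · omega
    · exact hp
  have hOI : ∀ p ∈ O, p ∈ I ∧ (p : ℕ) < k := fun p hp =>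
    ⟨hI ▸ Finset.mem_union_left _ hp, by rw [hO, mem_oldRows] at hp; exact hp.1⟩
  have hnI : ∀ p ∈ newRows n b k, p ∈ I := fun p hp => hI ▸ Finset.mem_union_right _ hp
  -- the rows of `H * G`
  have hHo : ∀ p ∈ O, ∀ c : Fin n, c + k < n → (H * G) p c = (X * G) p c := by
    intro p hp c hc
    simp only [Matrix.mul_apply]
    refine Finset.sum_congr rfl fun g _ => ?_
    by_cases hG : G g c = 0
    · rw [hG, mul_zero, mul_zero]
    · congr 1
      have h1 := (hOI p hp).2
      by_cases hX : X p g = 0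
      · simp [hH, Matrix.restr, stackRows, h1, hX]
      · have h2 := (h.supp_X p g hX).1
        have h3 := hs.supp_G g c hG
        have h4 := div_mul_add_le (hk ▸ h1)
        have h5 : g ∈ A := mem_activeTerms.2 (by omega)
        simp [hH, Matrix.restr, stackRows, h1, h5, (hOI p hp).1]
  have hHn : ∀ i ∈ newRows n b k, ∀ c : Fin n, c + k < n → (H * G) i c = (Ct * G) i c := by
    intro i hi c hc
    simp only [Matrix.mul_apply]
    refine Finset.sum_congr rfl fun g _ => ?_
    by_cases hG : G g c = 0
    · rw [hG, mul_zero, mul_zero]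
    · congr 1
      have h1 := hnI i hi
      rw [mem_newRows] at hi
      by_cases hX : Ct i g = 0
      · simp [hH, Matrix.restr, stackRows, hX, not_lt.2 hi.1]
      · have h2 := hs.supp_Ct i g hX
        have h3 := hs.supp_G g c hG
        have h5 : g ∈ A := mem_activeTerms.2 (by omega)
        simp [hH, Matrix.restr, stackRows, not_lt.2 hi.1, h5, h1]
  have hsuppBH : ∀ i g, (B * H) i g ≠ 0 → i ∈ I ∧ g ∈ A := by
    intro i g hg
    rw [Matrix.mul_apply] at hg
    obtain ⟨j, -, hj⟩ := Finset.exists_ne_zero_of_sum_ne_zero hg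
    exact ⟨(he.supp_B i j (left_ne_zero_of_mul hj)).1, (hsuppH j g (right_ne_zero_of_mul hj)).2⟩
  have hrow : ∀ (Y : Matrix (Fin n) ρ K) (M : Matrix ρ (Fin n) K) i,
      (Y * M) i = Matrix.vecMul (Y i) M := fun _ _ _ => rfl
  have hBHT : B * (H * T) = (B * H) * T := (Matrix.mul_assoc _ _ _).symm
  have hq'lt : ∀ i c, q' i = some c → i ∈ I ∧ c + k < n := by
    intro i c hi
    obtain ⟨h1, j, hj⟩ := he.mem_of_lead hi
    rw [Matrix.mul_apply] at hj
    obtain ⟨g, -, hg⟩ := Finset.exists_ne_zero_of_sum_ne_zero hj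
    have := hT.lt c (hT.supp g c (right_ne_zero_of_mul hg)).2
    exact ⟨h1, by omega⟩
  have hlead' : ∀ i c, q' i = some c → IsLead ((B * H * G) i) c := by
    intro i c hi
    have h1 := he.lead i c hi
    rw [hBHT, hrow] at h1
    rw [hrow]
    exact (hT.flag.lead_iff (fun g hg => (hsuppBH i g hg).2)
      (by have := (hq'lt i c hi).2; omega)).2 h1
  have hzero' : ∀ i, q' i = none → ∀ c : Fin n, c + k < n → (B * H * G) i c = 0 := by
    intro i hi c hc
    have h1 := he.zero i hi
    rw [hBHT, hrow] at h1
    rw [hrow]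
    exact (hT.flag _ (fun g hg => (hsuppBH i g hg).2) (n - k) le_rfl).2
      (fun c' _ => by rw [h1]; rfl) c (by omega)
  -- the previous leading positions are attained by the transformed previous rows
  have hattain : ∀ p ∈ O, ∀ c, q p = some c → ∃ o ∈ O, q' o = some c := by
    intro p hp c hc
    have hck : c + k < n := by
      have h1 := hp
      rw [hO, mem_oldRows] at h1
      obtain ⟨-, c', hc', h2⟩ := h1
      rw [hc] at hc'
      cases hc'
      exact h2
    have h1 : IsLead ((H * T) p) c := by
      rw [hrow]
      refine (hT.flag.lead_iff (fun g hg => (hsuppH p g hg).2) (by omega)).1 ?_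
      rw [← hrow]
      refine ⟨by rw [hHo p hp c hck]; exact (h.lead p c hc).1, fun c' hc' => ?_⟩
      rw [hHo p hp c' (by have := Fin.lt_def.1 hc'; omega)]
      exact (h.lead p c hc).2 c' hc'
    have h2 : C' * (B * (H * T)) = H * T := he.eq_mul _ fun i c hic => by
      rw [Matrix.mul_apply] at hic
      obtain ⟨g, -, hg⟩ := Finset.exists_ne_zero_of_sum_ne_zero hic
      exact (hsuppH i g (left_ne_zero_of_mul hg)).1
    have h3 : Matrix.vecMul (C' p) (B * (H * T)) = (H * T) p := congrFun h2 p
    have h4 : ∀ i c', q' i = some c' → c' < c → C' p i = 0 := fun i c' hi hc' =>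
      eq_zero_of_leads (y := C' p) (j := c) (fun i c _ => he.lead i c)
        (fun i c _ hi _ => by rw [he.zero i hi]; rfl) (fun i i' c _ _ => he.inj i i' c)
        (fun c' hc' => by rw [h3]; exact h1.2 c' hc') i c' hi hc'
    have h5 := h1.1
    rw [← h3, Matrix.vecMul_apply_eq_sum] at h5
    obtain ⟨i, -, hi⟩ := Finset.exists_ne_zero_of_sum_ne_zero h5
    have h6 := left_ne_zero_of_mul hi
    have h7 := right_ne_zero_of_mul hi
    have h8 := he.supp_C p i h6
    refine ⟨i, hmemO i h8.2.1 ((Fin.le_def.1 h8.2.2).trans_lt (hOI p hp).2), ?_⟩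
    cases hq : q' i with
    | none => exact absurd (congrFun (he.zero i hq) c) h7
    | some c' =>
      rcases lt_trichotomy c' c with h9 | h9 | h9
      · exact absurd (h4 i c' hq h9) h6
      · rw [h9]
      · exact absurd ((he.lead i c' hq).2 c h9) h7
  have hXG : ∀ i : Fin n, ¬ (i : ℕ) < k → q' i ≠ none → ∀ c,
      ((Matrix.of fun (i : Fin n) g => if (i : ℕ) < k then X i g else
        if q' i = none then 0 else (B * H) i g) * G) i c = (B * H * G) i c := by
    intro i hi hq c
    simp [Matrix.mul_apply (M := Matrix.of _), Matrix.mul_apply (M := B * H), hi, hq]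
  have hXG' : ∀ i : Fin n, (i : ℕ) < k → ∀ c,
      ((Matrix.of fun (i : Fin n) g => if (i : ℕ) < k then X i g else
        if q' i = none then 0 else (B * H) i g) * G) i c = (X * G) i c := by
    intro i hi c
    simp [Matrix.mul_apply, hi]
  refine ⟨?_, ?_, ?_, ?_, ?_, ?_, ?_⟩
  · intro p c hp
    split_ifs at hp with hpk
    · have := h.piv p c hp
      exact ⟨by omega, this.2⟩
    · obtain ⟨h1, h2⟩ := hq'lt p c hp
      have h3 := mem_newRows.1 (hIn p h1 (by omega))
      refine ⟨h3.2, ?_⟩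
      rw [div_mul_eq_of_mem (hk ▸ h3.1) (hk ▸ h3.2), hk]
      exact h2
  · intro p g hp
    simp only [Matrix.of_apply] at hp
    split_ifs at hp with hpk hq
    · exact h.supp_X p g hp
    · exact absurd rfl hp
    · obtain ⟨h1, h2⟩ := hsuppBH p g hp
      have h3 := mem_newRows.1 (hIn p h1 (by omega))
      rw [div_mul_eq_of_mem (hk ▸ h3.1) (hk ▸ h3.2), hk]
      exact mem_activeTerms.1 h2
  · intro p c hp
    split_ifs at hp with hpk
    · exact (funext (hXG' p hpk) : _ = (X * G) p) ▸ h.lead p c hp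
    · exact (funext (hXG p hpk (by rw [hp]; simp)) : _ = (B * H * G) p) ▸ hlead' p c hp
  · have hmix : ∀ i j : Fin n, ∀ c, (i : ℕ) < k → ¬ (j : ℕ) < k → q i = some c →
        q' j = some c → False := by
      intro i j c hi hj hqi hqj
      obtain ⟨o, ho, hqo⟩ := hattain i
        (by rw [hO, mem_oldRows]; exact ⟨hi, c, hqi, (hq'lt j c hqj).2⟩) c hqi
      have := he.inj o j c hqo hqj
      subst this
      exact hj (hOI o ho).2
    intro i j c hi hj
    split_ifs at hi hj with h1 h2 h2
    · exact h.inj i j c hi hj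
    · exact (hmix i j c h1 h2 hi hj).elim
    · exact (hmix j i c h2 h1 hj hi).elim
    · exact he.inj i j c hi hj
  · intro i p hip
    simp only [Matrix.of_apply] at hip
    split_ifs at hip with h1 h2 h3
    · have := h.supp_C i p hip
      have hp : (p : ℕ) < k := (Fin.le_def.1 this.1).trans_lt h1
      rw [if_pos hp]
      exact ⟨this.1, this.2.1, by omega⟩
    · rw [if_pos h2]
      rw [Matrix.mul_apply] at hip
      obtain ⟨o, -, ho⟩ := Finset.exists_ne_zero_of_sum_ne_zero hip
      have h4 := Matrix.restr_apply_ne (left_ne_zero_of_mul ho)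
      have h5 := (Matrix.restr_apply_ne (right_ne_zero_of_mul ho)).2.1
      have h6 := mem_newRows.1 (hIn i h4.1 (by omega))
      rw [hO, mem_oldRows] at h5
      obtain ⟨-, c, hc, -⟩ := h5
      exact ⟨Fin.le_def.2 (by omega), by rw [hc]; simp, h6.2⟩
    · exact absurd rfl hip
    · rw [if_neg h2]
      have h4 := he.supp_C i p hip
      exact ⟨h4.2.2, h3, (mem_newRows.1 (hIn i h4.1 (by omega))).2⟩
  · intro p c hp
    simp only [Matrix.of_apply]
    split_ifs at hp ⊢ with h1 h2
    · exact h.diag p c hp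
    · rw [hp] at h2
      cases h2
    · have h3 := he.mul_C p (hq'lt p c hp).1 p
      rw [if_pos rfl, Matrix.mul_apply, Finset.sum_eq_single p] at h3
      · exact left_ne_zero_of_mul (h3 ▸ one_ne_zero)
      · intro j _ hj
        by_contra h0
        exact hj (le_antisymm (he.supp_C p j (left_ne_zero_of_mul h0)).2.2
          (he.supp_B j p (right_ne_zero_of_mul h0)).2.2)
      · simp
  · intro i c hi hc
    by_cases hik : (i : ℕ) < k
    · rw [h.factor i c hik hc, Matrix.mul_apply, Matrix.mul_apply]
      refine Finset.sum_congr rfl fun p _ => ?_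
      simp only [Matrix.of_apply, hik, if_true]
      by_cases hC : C i p = 0
      · rw [hC, zero_mul, zero_mul]
      · rw [hXG' p ((Fin.le_def.1 (h.supp_C i p hC).1).trans_lt hik)]
    · have hin : i ∈ newRows n b k := mem_newRows.2 ⟨by omega, hi⟩
      rw [div_mul_eq_of_mem (hk ▸ (mem_newRows.1 hin).1) (hk ▸ hi), hk] at hc
      have h1 : C' * (B * (H * G)) = H * G := he.eq_mul _ fun i c hic => by
        rw [Matrix.mul_apply] at hic
        obtain ⟨g, -, hg⟩ := Finset.exists_ne_zero_of_sum_ne_zero hic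
        exact (hsuppH i g (left_ne_zero_of_mul hg)).1
      rw [← hHn i hin c hc, ← h1, Matrix.mul_apply, Matrix.mul_apply]
      -- split the sums into the contributions of the previous and of the new rows
      have split := fun f : Fin n → K => (Finset.sum_filter_add_sum_filter_not Finset.univ
        (fun p : Fin n => (p : ℕ) < k) f).symm
      refine (split _).trans (Eq.trans ?_ (split _).symm)
      congr 1
      · have h2 : ∀ p ∈ O, (B * (H * G)) p c = (B.restr O O * (X * G)) p c := by
          intro p hp
          rw [Matrix.mul_apply, Matrix.mul_apply]
          refine Finset.sum_congr rfl fun j _ => ?_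
          by_cases hB : B p j = 0
          · simp [Matrix.restr, hB]
          · have h3 := he.supp_B p j hB
            have h4 := hmemO j h3.2.1 ((Fin.le_def.1 h3.2.2).trans_lt (hOI p hp).2)
            rw [hHo j h4 c hc]
            simp [Matrix.restr, hp, h4]
        have h3 : ((C'.restr I O * B.restr O O) * (X * G)) i c =
            ∑ p ∈ Finset.univ.filter (fun p : Fin n => (p : ℕ) < k),
              C' i p * (B * (H * G)) p c := by
          rw [Matrix.mul_assoc, Matrix.mul_apply,
            ← Finset.sum_filter_add_sum_filter_not Finset.univ fun p : Fin n => (p : ℕ) < k]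
          rw [Finset.sum_eq_zero (s := Finset.univ.filter fun p : Fin n => ¬ (p : ℕ) < k), add_zero]
          · refine Finset.sum_congr rfl fun p hp => ?_
            simp only [Finset.mem_filter, Finset.mem_univ, true_and] at hp
            by_cases hC : C' i p = 0
            · simp [Matrix.restr, hC]
            · have hpO := hmemO p (he.supp_C i p hC).2.1 hp
              rw [h2 p hpO]
              simp [Matrix.restr, hnI i hin, hpO]
          · intro p hp
            simp only [Finset.mem_filter, Finset.mem_univ, true_and] at hp
            have : p ∉ O := fun h => hp (hOI p h).2
            simp [Matrix.restr, this]
        rw [← h3, Matrix.mul_apply,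
          ← Finset.sum_filter_add_sum_filter_not Finset.univ fun p : Fin n => (p : ℕ) < k]
        rw [Finset.sum_eq_zero (s := Finset.univ.filter fun p : Fin n => ¬ (p : ℕ) < k), add_zero]
        · refine Finset.sum_congr rfl fun p hp => ?_
          simp only [Finset.mem_filter, Finset.mem_univ, true_and] at hp
          rw [hXG' p hp]
          simp [hik, hp]
        · intro p hp
          simp only [Finset.mem_filter, Finset.mem_univ, true_and] at hp
          rw [Matrix.mul_apply, Finset.sum_eq_zero, zero_mul]
          intro o _
          have : p ∉ O := fun h => hp (hOI p h).2
          simp [Matrix.restr, this]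
      · refine Finset.sum_congr rfl fun p hp => ?_
        simp only [Finset.mem_filter, Finset.mem_univ, true_and] at hp
        by_cases hq : q' p = none
        · have := hzero' p hq c hc
          rw [Matrix.mul_assoc] at this
          simp [hik, hp, hq, this]
        · rw [hXG p hp hq, Matrix.mul_assoc]
          simp [hik, hp, hq]

end RowSweep

section SweepProgram

variable {K : Type u} [Field K]

/-- The decomposition of all rows, computed block by block from top to bottom, once the coordinates
for all blocks are known. -/
theorem exists_prog_sweep {ω Cω CRF : ℝ} (hω : 2 < ω) (hMM : MatMulTime K ω Cω)
    (hRF : CRETime K ω CRF) :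
    ∃ κ : ℝ, 0 ≤ κ ∧ ∀ (ρ : Type) [LinearOrder ρ] [Fintype ρ] (n : ℕ),
      ∃ P : ℕ → ℕ → (ρ → ℕ) → (ρ → ℕ) → Matrix (Fin n) ρ ℕ → Matrix ρ (Fin n) ℕ →
          Prog K ((Fin n → Option (Fin n)) × Matrix (Fin n) ρ ℕ × Matrix (Fin n) (Fin n) ℕ),
        ∀ (b N : ℕ) (pr qr : ρ → ℕ) (Ct : Matrix (Fin n) ρ K) (G : Matrix ρ (Fin n) K)
          (aCt : Matrix (Fin n) ρ ℕ) (aG : Matrix ρ (Fin n) ℕ) (mem : List K),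
          IsStaircase b pr qr Ct G → n ≤ N * b → Holds mem aCt Ct → Holds mem aG G →
          (P b N pr qr aCt aG).Runs mem (N * (κ * ((5 * b : ℕ) : ℝ) ^ ω)) fun r mem' =>
            ∃ X C, Holds mem' r.2.1 X ∧ Holds mem' r.2.2 C ∧
              IsSweep b (N * b) pr qr Ct G r.1 X C := by
  obtain ⟨κ₁, hκ₁, hmul⟩ := exists_prog_mul hω hMM
  obtain ⟨κ₂, hκ₂, hel⟩ := exists_prog_elimination hω hRF
  obtain ⟨κ₃, hκ₃, hco⟩ := exists_prog_coord hω hRF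
  refine ⟨3 * κ₁ + κ₂ + κ₃, by positivity, fun ρ _ _ n => ?_⟩
  obtain ⟨M₁, hM₁⟩ := hmul (Fin n) ρ (Fin n)
  obtain ⟨M₂, hM₂⟩ := hmul (Fin n) (Fin n) ρ
  obtain ⟨M₃, hM₃⟩ := hmul (Fin n) (Fin n) (Fin n)
  obtain ⟨E, hE⟩ := hel (Fin n) (Fin n)
  obtain ⟨S, hS⟩ := hco ρ n
  let fin (k : ℕ) (z : ℕ)
      (s : (Fin n → Option (Fin n)) × Matrix (Fin n) ρ ℕ × Matrix (Fin n) (Fin n) ℕ)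
      (r : Matrix (Fin n) (Fin n) ℕ × Matrix (Fin n) (Fin n) ℕ × (Fin n → Option (Fin n)))
      (Y : Matrix (Fin n) ρ ℕ) (Z : Matrix (Fin n) (Fin n) ℕ) :
      (Fin n → Option (Fin n)) × Matrix (Fin n) ρ ℕ × Matrix (Fin n) (Fin n) ℕ :=
    (fun i => if (i : ℕ) < k then s.1 i else r.2.2 i,
      Matrix.of fun i g => if (i : ℕ) < k then s.2.1 i g else if r.2.2 i = none then z else Y i g,
      Matrix.of fun i p => if (i : ℕ) < k then s.2.2 i p else
        if (p : ℕ) < k then Z i p else if r.2.2 p = none then z else r.1 i p)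
  let step (b k : ℕ) (pr qr : ρ → ℕ) (aCt : Matrix (Fin n) ρ ℕ) (z : ℕ)
      (T : Matrix ρ (Fin n) ℕ × Finset (Fin n))
      (s : (Fin n → Option (Fin n)) × Matrix (Fin n) ρ ℕ × Matrix (Fin n) (Fin n) ℕ) :
      Prog K ((Fin n → Option (Fin n)) × Matrix (Fin n) ρ ℕ × Matrix (Fin n) (Fin n) ℕ) :=
    (M₁ (5 * b) (oldRows s.1 k ∪ newRows n b k) (activeTerms n b pr qr k) T.2
      (stackRows k s.2.1 aCt) T.1).bind fun aP =>
    (E (oldRows s.1 k ∪ newRows n b k) T.2 aP).bind fun r =>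
    (M₂ (5 * b) (oldRows s.1 k ∪ newRows n b k) (oldRows s.1 k ∪ newRows n b k)
      (activeTerms n b pr qr k) r.2.1 (stackRows k s.2.1 aCt)).bind fun Y =>
    (M₃ (5 * b) (oldRows s.1 k ∪ newRows n b k) (oldRows s.1 k) (oldRows s.1 k) r.1 r.2.1).bind
      fun Z => .ret (fin k z s r Y Z)
  refine ⟨fun b N pr qr aCt aG => (S b N pr qr aG).bind fun x => .const 0 fun z =>
    Prog.iter (fun t s => step b (t * b) pr qr aCt z (x t) s) N
      (fun _ => none, fun _ _ => z, fun _ _ => z), ?_⟩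
  intro b N pr qr Ct G aCt aG mem hs hN hCt hG
  have hb := hs.one_le
  refine ((hS b N pr qr Ct G aG mem hs hN hG).bind
    (c' := N * ((3 * κ₁ + κ₂) * ((5 * b : ℕ) : ℝ) ^ ω)) fun x mem₁ hm₁ hx => ?_).mono
    (le_of_eq (by ring)) fun _ _ _ h => h
  refine Prog.runs_const fun z hz => ?_
  replace hm₁ := hm₁.trans (List.prefix_append mem₁ [0])
  replace hx : ∀ a ≤ N, ∃ T, Holds (mem₁ ++ [0]) (x a).1 T ∧
      IsCoord (activeTerms n b pr qr (a * b)) (n - a * b) G T (x a).2 := fun a ha => by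
    obtain ⟨T, h1, h2⟩ := hx a ha
    exact ⟨T, h1.mono (List.prefix_append _ _), h2⟩
  generalize mem₁ ++ [0] = mem₁ at *
  refine (Prog.runs_iter (fun t s mem' => ∃ X C, Holds mem' s.2.1 X ∧ Holds mem' s.2.2 C ∧
    IsSweep b (t * b) pr qr Ct G s.1 X C) ?_ ?_).mono le_rfl fun _ _ _ h => h
  · refine ⟨0, 0, fun _ _ => hz, fun _ _ => hz, ?_, ?_, ?_, ?_, ?_, ?_, ?_⟩
    · intro p c h; cases h
    · intro p g h; exact absurd rfl h
    · intro p c h; cases h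
    · intro i j c h; cases h
    · intro i p h; exact absurd rfl h
    · intro p c h; cases h
    · intro i c h
      omega
  · rintro t ht ⟨q, aX, aC⟩ mem' hm' ⟨X, C, hX, hC, hsw⟩
    obtain ⟨T, hT, hco⟩ := hx t ht.le
    have hO := hsw.card_oldRows hs
    obtain ⟨k, hk⟩ : ∃ k, t * b = k := ⟨_, rfl⟩
    rw [Nat.add_mul, Nat.one_mul]
    rw [hk] at hsw hco hO ⊢
    simp only at hsw hX hC hO
    have hI : (oldRows q k ∪ newRows n b k).card ≤ 5 * b := by
      have h1 := Finset.card_union_le (oldRows q k) (newRows n b k)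
      have h2 := card_newRows n b k
      omega
    have hO5 : (oldRows q k).card ≤ 5 * b := by omega
    have hA := hs.card_activeTerms k
    have hQ := hco.card_le
    have hstack : Holds mem' (stackRows k aX aCt) (stackRows k X Ct) := by
      intro i g
      simp only [stackRows, Matrix.of_apply]
      split_ifs
      · exact hX i g
      · exact (hCt.mono (hm₁.trans hm')) i g
    refine ((hM₁ (5 * b) _ _ _ _ _ _ _ mem' (by omega) hI (by omega) (by omega) hstack
      (hT.mono hm')).bind fun aP mem₂ hm₂ hP => ((hE (5 * b) _ _ aP _ mem₂ (by omega) hI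
      (by omega) hP).bind fun r mem₃ hm₃ ⟨C', B, hC', hB, he⟩ =>
      ((hM₂ (5 * b) _ _ _ _ _ B (stackRows k X Ct) mem₃ (by omega) hI hI (by omega) hB
        (hstack.mono (hm₂.trans hm₃))).bind fun Y mem₄ hm₄ hY =>
      ((hM₃ (5 * b) _ _ _ _ _ C' B mem₄ (by omega) hI hO5 hO5 (hC'.mono hm₄)
        (hB.mono hm₄)).bind fun Z mem₅ hm₅ hZ => Prog.runs_ret ?_)))).mono
        (le_of_eq (by ring)) fun _ _ _ h => h
    have hz' := ((((hm'.trans hm₂).trans hm₃).trans hm₄).trans hm₅).getElem?_some hz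
    refine ⟨_, _, ?_, ?_, hsw.step hk hs hco rfl rfl rfl he⟩
    · intro i g
      simp only [fin, Matrix.of_apply]
      split_ifs
      · exact (hX.mono (((hm₂.trans hm₃).trans hm₄).trans hm₅)) i g
      · exact hz'
      · exact (hY.mono hm₅) i g
    · intro i p
      simp only [fin, Matrix.of_apply]
      split_ifs
      · exact (hC.mono (((hm₂.trans hm₃).trans hm₄).trans hm₅)) i p
      · exact hZ i p
      · exact hz'
      · exact (hC'.mono (hm₄.trans hm₅)) i p

end SweepProgram

/-! ### Decomposition of the part above the antidiagonal -/

section LeftFactor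

variable {K : Type u} [Field K] {n : ℕ}

/-- The part of `M` above the antidiagonal is that of `C * F`, where `C` is lower triangular, row
`p` of `F` has its leading entry at `q p`, and the column `p` of `C` and the row `p` of `F` are
zero where they do not contribute to the part above the antidiagonal. -/
structure IsLeftFactor (q : Fin n → Option (Fin n)) (C F M : Matrix (Fin n) (Fin n) K) : Prop where
  inj : ∀ i j c, q i = some c → q j = some c → i = j
  supp_C : ∀ i p, C i p ≠ 0 → p ≤ i ∧ ∃ c, q p = some c ∧ i + c + 2 ≤ n
  supp_F : ∀ p c, F p c ≠ 0 → p + c + 2 ≤ n ∧ ∃ c', q p = some c' ∧ c' ≤ c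
  diag_C : ∀ p c, q p = some c → C p p ≠ 0
  diag_F : ∀ p c, q p = some c → F p c ≠ 0
  factor : ∀ i c : Fin n, i + c + 2 ≤ n → M i c = (C * F) i c

theorem IsLeftFactor.lead {q : Fin n → Option (Fin n)} {C F M : Matrix (Fin n) (Fin n) K}
    (h : IsLeftFactor q C F M) {p c : Fin n} (hp : q p = some c) : IsLead (F p) c := by
  refine ⟨h.diag_F p c hp, fun c' hc' => ?_⟩
  by_contra h0
  obtain ⟨-, c'', h1, h2⟩ := h.supp_F p c' h0
  rw [hp] at h1
  cases h1
  exact absurd hc' (not_lt.2 h2)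

/-- The entry of a column of `C` in row `i` contributes to the part above the antidiagonal. -/
def LeftCol (q : Option (Fin n)) (i : Fin n) : Prop := ∃ c, q = some c ∧ i + c + 2 ≤ n

open Classical in
/-- The leading positions above the antidiagonal. -/
noncomputable def leftLeads (q : Fin n → Option (Fin n)) (p : Fin n) : Option (Fin n) :=
  if LeftCol (q p) p then q p else none

theorem leftLeads_eq_some {q : Fin n → Option (Fin n)} {p c : Fin n} :
    leftLeads q p = some c ↔ q p = some c ∧ p + c + 2 ≤ n := by
  unfold leftLeads LeftCol
  constructor
  · intro h
    split_ifs at h with h1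
    obtain ⟨c', h2, h3⟩ := h1
    rw [h] at h2
    cases h2
    exact ⟨h, h3⟩
  · rintro ⟨h1, h2⟩
    rw [if_pos ⟨c, h1, h2⟩, h1]

open Classical in
/-- The entries of `C` and `F` that do not contribute to the part above the antidiagonal are
dropped. -/
theorem IsSweep.isLeftFactor {ρ : Type} [Fintype ρ] {b k : ℕ} {pr qr : ρ → ℕ}
    {Ct : Matrix (Fin n) ρ K} {G : Matrix ρ (Fin n) K}
    {q : Fin n → Option (Fin n)} {X : Matrix (Fin n) ρ K} {C F : Matrix (Fin n) (Fin n) K}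
    (h : IsSweep b k pr qr Ct G q X C) (hk : n ≤ k)
    (hF : ∀ i c : Fin n, q i ≠ none → i + c + 2 ≤ n → F i c = (X * G) i c) :
    IsLeftFactor (leftLeads q)
      (Matrix.of fun i p => if LeftCol (leftLeads q p) i then C i p else 0)
      (Matrix.of fun p c : Fin n => if leftLeads q p ≠ none ∧ p + c + 2 ≤ n then F p c else 0)
      (Ct * G) where
  inj i j c hi hj := h.inj i j c (leftLeads_eq_some.1 hi).1 (leftLeads_eq_some.1 hj).1
  supp_C i p hip := by
    simp only [Matrix.of_apply, ne_eq, ite_eq_right_iff, Classical.not_imp] at hip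
    exact ⟨(h.supp_C i p hip.2).1, hip.1⟩
  supp_F p c hpc := by
    simp only [Matrix.of_apply, ne_eq, ite_eq_right_iff, Classical.not_imp] at hpc
    obtain ⟨⟨h1, h2⟩, h3⟩ := hpc
    obtain ⟨c', hc'⟩ := Option.ne_none_iff_exists'.1 h1
    refine ⟨h2, c', hc', ?_⟩
    have h4 := (leftLeads_eq_some.1 hc').1
    rw [hF p c (by rw [h4]; simp) h2] at h3
    by_contra h5
    exact h3 ((h.lead p c' h4).2 c (not_le.1 h5))
  diag_C p c hp := by
    have h1 := leftLeads_eq_some.1 hp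
    have h2 : LeftCol (leftLeads q p) p := ⟨c, hp, h1.2⟩
    simp only [Matrix.of_apply, if_pos h2]
    exact h.diag p c h1.1
  diag_F p c hp := by
    have h1 := leftLeads_eq_some.1 hp
    have h2 : leftLeads q p ≠ none ∧ p + c + 2 ≤ n := ⟨by rw [hp]; simp, h1.2⟩
    simp only [Matrix.of_apply, if_pos h2]
    rw [hF p c (by rw [h1.1]; simp) h1.2]
    exact (h.lead p c h1.1).1
  factor i c hic := by
    have h1 : c + i / b * b < n := by
      have := Nat.div_mul_le_self i b
      omega
    rw [h.factor i c (by omega) h1, Matrix.mul_apply, Matrix.mul_apply]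
    refine Finset.sum_congr rfl fun p _ => ?_
    by_cases hC : C i p = 0
    · simp [hC]
    · obtain ⟨h2, h3, -⟩ := h.supp_C i p hC
      obtain ⟨c', hc'⟩ := Option.ne_none_iff_exists'.1 h3
      have h2' := Fin.le_def.1 h2
      rcases lt_or_ge c c' with h4 | h4
      · have h5 := (h.lead p c' hc').2 c h4
        have h6 := hF p c h3 (by omega)
        rw [h5, mul_zero]
        simp [h6, h5]
      · have h4' := Fin.le_def.1 h4
        have h5 : leftLeads q p = some c' := leftLeads_eq_some.2 ⟨hc', by omega⟩
        have h6 : LeftCol (leftLeads q p) i := ⟨c', h5, by omega⟩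
        have h7 : leftLeads q p ≠ none ∧ p + c + 2 ≤ n := ⟨by rw [h5]; simp, by omega⟩
        simp only [Matrix.of_apply, if_pos h6, if_pos h7]
        rw [hF p c h3 h7.2]

/-- The rows that contribute to the columns from `k` to `k + b - 1` above the antidiagonal. -/
def blockRows (q : Fin n → Option (Fin n)) (b k : ℕ) : Finset (Fin n) :=
  Finset.univ.filter fun p => (∃ c, q p = some c ∧ c < k + b) ∧ p + k + 2 ≤ n

/-- The terms that contribute to the rows `blockRows q b k`. -/
def blockTerms {ρ : Type} [Fintype ρ] (n : ℕ) (pr qr : ρ → ℕ) (b k : ℕ) : Finset ρ :=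
  Finset.univ.filter fun g => pr g + k < n + b ∧ qr g < k + b ∧ k < n

/-- The terms that start above row `n - k` and before column `k`, and those that start in the next
`b` rows or columns. -/
theorem IsStaircase.card_blockTerms {ρ : Type} [Fintype ρ] {b : ℕ} {pr qr : ρ → ℕ}
    {Ct : Matrix (Fin n) ρ K} {G : Matrix ρ (Fin n) K} (h : IsStaircase b pr qr Ct G) (k : ℕ) :
    (blockTerms n pr qr b k).card ≤ 5 * b := by
  classical
  have hsub : blockTerms n pr qr b k ⊆
      (Finset.univ.filter fun g => pr g < n - k ∧ qr g + (n - k) < n) ∪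
        ((Finset.univ.filter fun g => n - k ≤ pr g ∧ pr g < n - k + b) ∪
        Finset.univ.filter fun g => k ≤ qr g ∧ qr g < k + b) := by
    intro g hg
    simp only [blockTerms, Finset.mem_union, Finset.mem_filter, Finset.mem_univ,
      true_and] at hg ⊢
    omega
  have h1 := Finset.card_le_card hsub
  have h2 := Finset.card_union_le
    (Finset.univ.filter fun g => pr g < n - k ∧ qr g + (n - k) < n)
    ((Finset.univ.filter fun g => n - k ≤ pr g ∧ pr g < n - k + b) ∪
        Finset.univ.filter fun g => k ≤ qr g ∧ qr g < k + b)
  have h3 := Finset.card_union_le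
    (Finset.univ.filter fun g => n - k ≤ pr g ∧ pr g < n - k + b)
    (Finset.univ.filter fun g => k ≤ qr g ∧ qr g < k + b)
  have h4 := h.card_le (n - k)
  have h5 := h.card_pr (n - k)
  have h6 := h.card_qr k
  omega

theorem IsSweep.mem_blockTerms {ρ : Type} [Fintype ρ] {b k' : ℕ} {pr qr : ρ → ℕ}
    {Ct : Matrix (Fin n) ρ K} {G : Matrix ρ (Fin n) K}
    {q : Fin n → Option (Fin n)} {X : Matrix (Fin n) ρ K} {C : Matrix (Fin n) (Fin n) K}
    (hs : IsStaircase b pr qr Ct G) (h : IsSweep b k' pr qr Ct G q X C) {k : ℕ} {p c : Fin n}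
    (hp : p + k + 2 ≤ n) (hc : (c : ℕ) < k + b) {g : ρ} (hX : X p g ≠ 0) (hG : G g c ≠ 0) :
    g ∈ blockTerms n pr qr b k := by
  have h1 := h.supp_X p g hX
  have h2 := hs.supp_G g c hG
  have h3 := Nat.div_mul_le_self p b
  simp only [blockTerms, Finset.mem_filter, Finset.mem_univ, true_and]
  omega

theorem IsSweep.card_blockRows {ρ : Type} [Fintype ρ] {b k' : ℕ} {pr qr : ρ → ℕ}
    {Ct : Matrix (Fin n) ρ K} {G : Matrix ρ (Fin n) K}
    {q : Fin n → Option (Fin n)} {X : Matrix (Fin n) ρ K} {C : Matrix (Fin n) (Fin n) K}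
    (hs : IsStaircase b pr qr Ct G) (h : IsSweep b k' pr qr Ct G q X C) (k : ℕ) :
    (blockRows q b k).card ≤ 5 * b := by
  refine (card_le_of_leads (X := X) (G := G) (q := q) (j := k + b) ?_ h.inj ?_).trans
    (hs.card_blockTerms k)
  · intro p hp
    simp only [blockRows, Finset.mem_filter, Finset.mem_univ, true_and] at hp
    obtain ⟨⟨c, hc, hcn⟩, -⟩ := hp
    exact ⟨c, hc, hcn, h.lead p c hc⟩
  · intro p hp g hX c hc hG
    simp only [blockRows, Finset.mem_filter, Finset.mem_univ, true_and] at hp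
    exact h.mem_blockTerms hs hp.2 hc hX hG

open Classical in
/-- A decomposition of the part above the antidiagonal is computed in `O(N * b ^ ω)` operations,
where `b` is the size and `N` the number of the blocks: the product `X * G` is computed for `b`
columns at a time. -/
theorem exists_prog_leftFactor {ω Cω CRF : ℝ} (hω : 2 < ω) (hMM : MatMulTime K ω Cω)
    (hRF : CRETime K ω CRF) :
    ∃ κ : ℝ, 0 ≤ κ ∧ ∀ (ρ : Type) [LinearOrder ρ] [Fintype ρ] (n : ℕ),
      ∃ P : ℕ → ℕ → (ρ → ℕ) → (ρ → ℕ) → Matrix (Fin n) ρ ℕ → Matrix ρ (Fin n) ℕ →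
          Prog K ((Fin n → Option (Fin n)) × Matrix (Fin n) (Fin n) ℕ × Matrix (Fin n) (Fin n) ℕ),
        ∀ (b N : ℕ) (pr qr : ρ → ℕ) (Ct : Matrix (Fin n) ρ K) (G : Matrix ρ (Fin n) K)
          (aCt : Matrix (Fin n) ρ ℕ) (aG : Matrix ρ (Fin n) ℕ) (mem : List K),
          IsStaircase b pr qr Ct G → n ≤ N * b → Holds mem aCt Ct → Holds mem aG G →
          (P b N pr qr aCt aG).Runs mem (N * (κ * ((5 * b : ℕ) : ℝ) ^ ω)) fun r mem' =>
            ∃ C F, Holds mem' r.2.1 C ∧ Holds mem' r.2.2 F ∧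
              IsLeftFactor r.1 C F (Ct * G) := by
  obtain ⟨κ₁, hκ₁, hmul⟩ := exists_prog_mul hω hMM
  obtain ⟨κ₂, hκ₂, hsw⟩ := exists_prog_sweep hω hMM hRF
  refine ⟨κ₂ + κ₁, by positivity, fun ρ _ _ n => ?_⟩
  obtain ⟨M, hM⟩ := hmul (Fin n) ρ (Fin n)
  obtain ⟨S, hS⟩ := hsw ρ n
  let fin (z : ℕ) (q : Fin n → Option (Fin n)) (aC F : Matrix (Fin n) (Fin n) ℕ) :
      (Fin n → Option (Fin n)) × Matrix (Fin n) (Fin n) ℕ × Matrix (Fin n) (Fin n) ℕ :=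
    (leftLeads q, Matrix.of fun i p => if LeftCol (leftLeads q p) i then aC i p else z,
      Matrix.of fun p c : Fin n => if leftLeads q p ≠ none ∧ p + c + 2 ≤ n then F p c else z)
  let step (b k : ℕ) (pr qr : ρ → ℕ) (aG : Matrix ρ (Fin n) ℕ) (q : Fin n → Option (Fin n))
      (aX : Matrix (Fin n) ρ ℕ) (F : Matrix (Fin n) (Fin n) ℕ) :
      Prog K (Matrix (Fin n) (Fin n) ℕ) :=
    (M (5 * b) (blockRows q b k) (blockTerms n pr qr b k) (newRows n b k) aX aG).bind fun r =>
      .ret (Matrix.of fun p c => if c ∈ newRows n b k then r p c else F p c)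
  refine ⟨fun b N pr qr aCt aG => (S b N pr qr aCt aG).bind fun r => .const 0 fun z =>
    (Prog.iter (fun t F => step b (t * b) pr qr aG r.1 r.2.1 F) N fun _ _ => z).bind fun F =>
      .ret (fin z r.1 r.2.2 F), ?_⟩
  intro b N pr qr Ct G aCt aG mem hs hN hCt hG
  have hb := hs.one_le
  refine ((hS b N pr qr Ct G aCt aG mem hs hN hCt hG).bind
    (c' := N * (κ₁ * ((5 * b : ℕ) : ℝ) ^ ω)) fun r mem₁ hm₁ hr => ?_).mono
    (le_of_eq (by ring)) fun _ _ _ h => h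
  obtain ⟨q, aX, aC⟩ := r
  obtain ⟨X, C, hX, hC, hsw⟩ := hr
  simp only at hX hC hsw ⊢
  refine Prog.runs_const fun z hz => ?_
  have hm₂ := List.prefix_append mem₁ [0]
  replace hX := hX.mono hm₂
  replace hC := hC.mono hm₂
  replace hG := hG.mono (hm₁.trans hm₂)
  clear hm₂ hm₁ hCt
  generalize mem₁ ++ [0] = mem₁ at *
  refine ((Prog.runs_iter (c := κ₁ * ((5 * b : ℕ) : ℝ) ^ ω)
    (fun t aF mem' => ∃ F : Matrix (Fin n) (Fin n) K, Holds mem' aF F ∧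
      ∀ i c : Fin n, (c : ℕ) < t * b → q i ≠ none → i + c + 2 ≤ n → F i c = (X * G) i c)
    ⟨0, fun _ _ => hz, fun i c h => by omega⟩ ?_).bind (c' := 0)
      fun aF mem₂ hm₂ ⟨F, hF, hF'⟩ => Prog.runs_ret ?_).mono (add_zero _).le fun _ _ _ h => h
  · rintro t ht aF mem₂ hm₂ ⟨F, hF, hF'⟩
    rw [Nat.add_mul, Nat.one_mul]
    obtain ⟨k, hk⟩ : ∃ k, t * b = k := ⟨_, rfl⟩
    rw [hk] at hF' ⊢
    have hL := card_newRows n b k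
    refine ((hM (5 * b) _ _ _ _ _ X G mem₂ (by omega) (hsw.card_blockRows hs k)
      (hs.card_blockTerms k) (by omega) (hX.mono hm₂) (hG.mono hm₂)).bind
      fun r mem₃ hm₃ hr => Prog.runs_ret (Q := fun aF mem' => ∃ F : Matrix (Fin n) (Fin n) K,
        Holds mem' aF F ∧ ∀ i c : Fin n, (c : ℕ) < k + b → q i ≠ none → i + c + 2 ≤ n →
          F i c = (X * G) i c)
      ⟨Matrix.of fun p c => if c ∈ newRows n b k then
        (X.restr (blockRows q b k) (blockTerms n pr qr b k) *
          G.restr (blockTerms n pr qr b k) (newRows n b k)) p c else F p c, ?_, ?_⟩).mono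
      (by simp) fun _ _ _ h => h
    · intro i c
      simp only [Matrix.of_apply]
      split_ifs
      · exact hr i c
      · exact (hF.mono hm₃) i c
    · intro i c hc hi hic
      obtain ⟨c', hc'⟩ := Option.ne_none_iff_exists'.1 hi
      by_cases hcn : c ∈ newRows n b k
      · have h1 := mem_newRows.1 hcn
        simp only [Matrix.of_apply, if_pos hcn]
        rcases lt_or_ge c c' with h2 | h2
        · rw [(hsw.lead i c' hc').2 c h2]
          rw [Matrix.mul_apply]
          by_cases hir : i ∈ blockRows q b k
          · have h3 := (hsw.lead i c' hc').2 c h2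
            rw [Matrix.mul_apply] at h3
            rw [← h3]
            refine Finset.sum_congr rfl fun g _ => ?_
            by_cases hXG : X i g * G g c = 0
            · rcases mul_eq_zero.1 hXG with h4 | h4 <;> simp [Matrix.restr, h4]
            · have := hsw.mem_blockTerms hs (k := k) (p := i) (by omega) hc
                (left_ne_zero_of_mul hXG) (right_ne_zero_of_mul hXG)
              simp [Matrix.restr, this, hir, hcn]
          · exact Finset.sum_eq_zero fun g _ => by simp [Matrix.restr, hir]
        · have h2' := Fin.le_def.1 h2
          have hir : i ∈ blockRows q b k := by
            simp only [blockRows, Finset.mem_filter, Finset.mem_univ, true_and]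
            exact ⟨⟨c', hc', by omega⟩, by omega⟩
          rw [Matrix.mul_apply, Matrix.mul_apply]
          refine Finset.sum_congr rfl fun g _ => ?_
          by_cases hXG : X i g * G g c = 0
          · rcases mul_eq_zero.1 hXG with h4 | h4 <;> simp [Matrix.restr, h4]
          · have := hsw.mem_blockTerms hs (k := k) (p := i) (by omega) hc
              (left_ne_zero_of_mul hXG) (right_ne_zero_of_mul hXG)
            simp [Matrix.restr, this, hir, hcn]
      · simp only [Matrix.of_apply, if_neg hcn]
        refine hF' i c ?_ hi hic
        by_contra h1
        exact hcn (mem_newRows.2 ⟨by omega, hc⟩)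
  · have hz' := hm₂.getElem?_some hz
    refine ⟨_, _, ?_, ?_, hsw.isLeftFactor hN fun i c => hF' i c (by omega)⟩
    · intro i p
      simp only [fin, Matrix.of_apply]
      split_ifs
      · exact (hC.mono hm₂) i p
      · exact hz'
    · intro p c
      simp only [fin, Matrix.of_apply]
      split_ifs
      · exact hF p c
      · exact hz'

end LeftFactor

/-! ### Ranks of leading blocks and the overlapping property -/

section LeadingBlocks

variable {n : ℕ}

/-- The block of the first `k` rows and the first `n - k` columns. -/
def leftBlock {δ : Type*} (M : Matrix (Fin n) (Fin n) δ) (k : ℕ) :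
    Matrix {i : Fin n // (i : ℕ) < k} {j : Fin n // (j : ℕ) + k < n} δ :=
  M.submatrix (fun i => i.1) fun j => j.1

theorem leftBlock_congr {δ : Type*} {M M' : Matrix (Fin n) (Fin n) δ}
    (h : ∀ i c : Fin n, i + c + 2 ≤ n → M i c = M' i c) (k : ℕ) :
    leftBlock M k = leftBlock M' k := by
  ext ⟨i, hi⟩ ⟨j, hj⟩
  exact h i j (by omega)

variable {K : Type u} [Field K]

/-- Pivots inside a leading block of a product of an echelon matrix with a matrix of distinct
leading positions are at most as many as its rank: the corresponding rows are linearly independent.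
-/
theorem card_leads_le_rank {ι : Type*} [Fintype ι] {C : Matrix (Fin n) ι K}
    {F : Matrix ι (Fin n) K} {M : Matrix (Fin n) (Fin n) K} {p q : ι → Fin n}
    (hp : Function.Injective p) (hC : ∀ l, C (p l) l ≠ 0 ∧ ∀ i < p l, C i l = 0)
    (hq : Function.Injective q) (hF : ∀ l, IsLead (F l) (q l))
    (hM : ∀ i c : Fin n, i + c + 2 ≤ n → M i c = (C * F) i c) (k : ℕ) :
    (Finset.univ.filter fun l => (p l : ℕ) < k ∧ (q l : ℕ) + k < n).card ≤
      (leftBlock M k).rank := by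
  classical
  set O := Finset.univ.filter fun l => (p l : ℕ) < k ∧ (q l : ℕ) + k < n with hO
  have hmem : ∀ l, l ∈ O ↔ (p l : ℕ) < k ∧ (q l : ℕ) + k < n := fun l => by simp [hO]
  let v : O → ({j : Fin n // (j : ℕ) + k < n} → K) := fun l =>
    leftBlock M k ⟨p l, ((hmem l).1 l.2).1⟩
  have hv : LinearIndependent K v := by
    rw [Fintype.linearIndependent_iff]
    intro y hy
    by_contra hne
    push Not at hne
    let y' : ι → K := fun l => if h : l ∈ O then y ⟨l, h⟩ else 0
    have hsum : ∀ φ : ι → K, ∑ l, y' l * φ l = ∑ l : O, y l * φ l := by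
      intro φ
      rw [← Finset.sum_subset (Finset.subset_univ O) (fun l _ hl => by simp [y', hl]),
        ← Finset.sum_coe_sort]
      exact Finset.sum_congr rfl fun l _ => by simp [y']
    let Y : Matrix ι ι K := Matrix.of fun l o => C (p l) o
    have hz : ∀ c : Fin n, (c : ℕ) < n - k → Matrix.vecMul (Matrix.vecMul y' Y) F c = 0 := by
      intro c hc
      rw [Matrix.vecMul_vecMul, Matrix.vecMul_apply_eq_sum]
      have h1 := congrFun hy ⟨c, by omega⟩
      rw [Finset.sum_apply] at h1
      rw [hsum fun l => (Y * F) l c]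
      refine Eq.trans (Finset.sum_congr rfl fun l _ => ?_) h1
      have h2 := (hmem l).1 l.2
      have h3 : v l ⟨c, by omega⟩ = (C * F) (p l) c := hM (p l) c (by omega)
      rw [Pi.smul_apply, smul_eq_mul, h3]
      rfl
    have hz' : ∀ o ∈ O, Matrix.vecMul y' Y o = 0 := fun o ho =>
      eq_zero_of_leads (q := fun l => some (q l)) (j := n - k)
        (fun i c _ h => by cases h; exact hF i) (fun i c _ h => by cases h)
        (fun i i' c _ _ h h' => hq (Option.some.inj (h.trans h'.symm))) hz o (q o) rfl
        (by have := (hmem o).1 ho; omega)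
    -- the last row that occurs cannot cancel
    obtain ⟨l₁, hl₁⟩ := hne
    obtain ⟨l₀, hl₀, hmax⟩ := Finset.exists_max_image (Finset.univ.filter fun l : O => y l ≠ 0)
      (fun l => p l) ⟨l₁, by simpa using hl₁⟩
    simp only [Finset.mem_filter, Finset.mem_univ, true_and] at hl₀ hmax
    have h1 := hz' l₀ l₀.2
    rw [Matrix.vecMul_apply_eq_sum, hsum fun l => Y l l₀, Finset.sum_eq_single l₀] at h1
    · exact mul_ne_zero hl₀ (hC l₀).1 h1
    · intro l _ hne
      by_cases hyl : y l = 0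
      · rw [hyl, zero_mul]
      · have h2 : p l < p l₀ := lt_of_le_of_ne (hmax l hyl) fun h => hne (Subtype.ext (hp h))
        have h3 : Y l l₀ = 0 := (hC l₀).2 _ h2
        rw [h3, mul_zero]
    · simp
  have h1 := finrank_span_eq_card hv
  rw [Fintype.card_coe] at h1
  rw [← h1, Matrix.rank_eq_finrank_span_row]
  refine Submodule.finrank_mono (Submodule.span_mono ?_)
  rintro _ ⟨l, rfl⟩
  exact ⟨_, rfl⟩

/-- Enumerate the pivot rows and the pivot columns increasingly. -/
theorem exists_lead_order (q : Fin n → Option (Fin n))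
    (hq : ∀ i j c, q i = some c → q j = some c → i = j) :
    ∃ (r : ℕ) (row col : Fin r → Fin n) (R : Equiv.Perm (Fin r)), StrictMono row ∧
      StrictMono col ∧ (∀ l, q (row l) = some (col (R l))) ∧
      ∀ p c, q p = some c → ∃ l, row l = p := by
  classical
  let S := Finset.univ.filter fun p => (q p).isSome
  let row := S.orderEmbOfFin rfl
  have hS : ∀ l, (q (row l)).isSome := fun l => by
    exact (Finset.mem_filter.1 (S.orderEmbOfFin_mem rfl l)).2
  choose f hf using fun l => Option.isSome_iff_exists.1 (hS l)
  have hinj : Function.Injective f := fun l l' h => by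
    have := hq _ _ _ (hf l) (h ▸ hf l')
    exact row.injective this
  have hcard : (Finset.univ.image f).card = S.card := by
    rw [Finset.card_image_of_injective _ hinj, Finset.card_univ, Fintype.card_fin]
  let col := (Finset.univ.image f).orderEmbOfFin hcard
  have hcol : ∀ l, ∃ m, col m = f l := fun l => by
    have : f l ∈ Set.range col := by
      rw [Finset.range_orderEmbOfFin]
      simp
    exact this
  choose R hR using hcol
  have hRinj : Function.Injective R := fun l l' h => hinj (by rw [← hR, ← hR, h])
  refine ⟨S.card, row, col, Equiv.ofBijective R (Finite.injective_iff_bijective.1 hRinj),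
    row.strictMono, col.strictMono, fun l => by rw [Equiv.ofBijective_apply, hR, hf], ?_⟩
  intro p c hp
  have : p ∈ Set.range row := by
    rw [Finset.range_orderEmbOfFin]
    simp [S, hp]
  exact this

variable {q : Fin n → Option (Fin n)} {C F M : Matrix (Fin n) (Fin n) K} {r : ℕ}
  {row col : Fin r → Fin n} {R : Equiv.Perm (Fin r)}

theorem IsLeftFactor.mul_eq (h : IsLeftFactor q C F M) (hrow : StrictMono row)
    (hex : ∀ p c, q p = some c → ∃ l, row l = p) :
    C.submatrix id row * F.submatrix row id = C * F := by
  ext i c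
  rw [Matrix.mul_apply, Matrix.mul_apply]
  refine Fintype.sum_of_injective row hrow.injective _ _ (fun p hp => ?_) fun l => rfl
  by_cases hC : C i p = 0
  · rw [hC, zero_mul]
  · obtain ⟨-, c', hc', -⟩ := h.supp_C i p hC
    exact absurd (hex p c' hc') fun ⟨l, hl⟩ => hp ⟨l, hl⟩

theorem IsLeftFactor.card_le_rank (h : IsLeftFactor q C F M) (hrow : StrictMono row)
    (hcol : StrictMono col) (hR : ∀ l, q (row l) = some (col (R l)))
    (hex : ∀ p c, q p = some c → ∃ l, row l = p) (k : ℕ) :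
    (Finset.univ.filter fun l => (row l : ℕ) < k ∧ (col (R l) : ℕ) + k < n).card ≤
      (leftBlock M k).rank := by
  refine card_leads_le_rank (C := C.submatrix id row) (F := F.submatrix row id) hrow.injective
    (fun l => ⟨h.diag_C _ _ (hR l), fun i hi => ?_⟩) (hcol.injective.comp R.injective)
    (fun l => h.lead (hR l)) (fun i c hic => ?_) k
  · by_contra h0
    exact absurd hi (not_lt.2 (h.supp_C _ _ h0).1)
  · rw [h.mul_eq hrow hex]
    exact h.factor i c hic

/-- The left Bruhat generator obtained by enumerating the pivots of a decomposition. It is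
`t`-overlapping as soon as the ranks of the leading blocks are at most `t`: the columns of `C` and
the rows of `E` that meet in a position belong to the pivots of the leading block at this
position. -/
theorem IsLeftFactor.isValid (h : IsLeftFactor q C F M) (hrow : StrictMono row)
    (hcol : StrictMono col) (hR : ∀ l, q (row l) = some (col (R l)))
    (hex : ∀ p c, q p = some c → ∃ l, row l = p) {cLast eLast : Fin r → Fin n}
    (hc : ∀ l, C (cLast l) (row l) ≠ 0 ∧ ∀ i, C i (row l) ≠ 0 → i ≤ cLast l)
    (he : ∀ m, F (row (R.symm m)) (eLast m) ≠ 0 ∧ ∀ j, F (row (R.symm m)) j ≠ 0 → j ≤ eLast m)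
    {t : ℕ} (ht : ∀ k, 1 ≤ k → k < n → (leftBlock M k).rank ≤ t) :
    LeftBruhat.IsValid t (⟨r, C.submatrix id row, R, F.submatrix (fun m => row (R.symm m)) id,
      row, cLast, col, eLast⟩ : LeftBruhat K n) := by
  have hR' : ∀ m, q (row (R.symm m)) = some (col m) := fun m => by rw [hR, R.apply_symm_apply]
  have hCz : ∀ i l, C i (row l) ≠ 0 → row l ≤ i := fun i l hi => (h.supp_C _ _ hi).1
  have hFz : ∀ m c, F (row (R.symm m)) c ≠ 0 → col m ≤ c := fun m c hmc => by
    obtain ⟨-, c', h1, h2⟩ := h.supp_F _ _ hmc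
    rw [hR'] at h1
    cases h1
    exact h2
  refine ⟨⟨row, hrow, fun l => ⟨h.diag_C _ _ (hR l), fun i hi => ?_⟩⟩, ?_,
    ⟨col, hcol, fun m => ⟨h.diag_F _ _ (hR' m), fun c hlt => ?_⟩⟩, ?_,
    fun l => ⟨h.diag_C _ _ (hR l), (hc l).1, fun i hi => ⟨hCz i l hi, (hc l).2 i hi⟩⟩,
    fun m => ⟨h.diag_F _ _ (hR' m), (he m).1, fun c hmc => ⟨hFz m c hmc, (he m).2 c hmc⟩⟩⟩
  · by_contra h0
    exact absurd hi (not_lt.2 (hCz i l h0))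
  · intro T hT _
    change Finset (Fin r) at T
    by_contra hno
    push Not at hno
    obtain ⟨l₀, hl₀, hmax⟩ := Finset.exists_max_image T (fun l => row l)
      (Finset.card_pos.1 (by omega))
    have hsub : T ⊆ Finset.univ.filter
        fun l => (row l : ℕ) < row l₀ + 1 ∧ (col (R l) : ℕ) + (row l₀ + 1) < n := by
      intro l hl
      obtain ⟨i, i', h1, h2, h3⟩ := hno l₀ hl₀ l hl
      have h4 := Fin.le_def.1 (hCz i l₀ h1)
      have h5 := Fin.le_def.1 (hmax l hl)
      obtain ⟨-, c, h6, h7⟩ := h.supp_C i' (row l) h2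
      rw [hR] at h6
      cases h6
      have h8 := Fin.le_def.1 h3
      simp only [Finset.mem_filter, Finset.mem_univ, true_and]
      omega
    have h1 := Finset.card_le_card hsub
    have h2 := (Finset.mem_filter.1 (hsub hl₀)).2
    have h3 := h.card_le_rank hrow hcol hR hex (row l₀ + 1)
    have h4 := ht (row l₀ + 1) (by omega) (by omega)
    omega
  · by_contra h0
    exact absurd hlt (not_lt.2 (hFz m c h0))
  · intro T hT _
    by_contra hno
    push Not at hno
    obtain ⟨m₀, hm₀, hmax⟩ := Finset.exists_max_image T (fun m => col m)
      (Finset.card_pos.1 (by omega))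
    have hsub : T.map R.symm.toEmbedding ⊆ Finset.univ.filter fun l =>
        (row l : ℕ) < n - 1 - col m₀ ∧ (col (R l) : ℕ) + (n - 1 - col m₀) < n := by
      intro l hl
      obtain ⟨m, hm, rfl⟩ := Finset.mem_map.1 hl
      obtain ⟨c, c', h1, h2, h3⟩ := hno m₀ hm₀ m hm
      have h4 := Fin.le_def.1 (hFz m₀ c h1)
      have h5 := Fin.le_def.1 (hmax m hm)
      have h6 : (row (R.symm m) : ℕ) + c' + 2 ≤ n := (h.supp_F _ _ h2).1
      have h8 := Fin.le_def.1 h3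
      simp only [Finset.mem_filter, Finset.mem_univ, true_and, Equiv.coe_toEmbedding,
        Equiv.apply_symm_apply]
      omega
    have h1 := Finset.card_le_card hsub
    rw [Finset.card_map] at h1
    have h2 := (Finset.mem_filter.1
      (hsub (Finset.mem_map_of_mem R.symm.toEmbedding hm₀))).2
    have h3 := h.card_le_rank hrow hcol hR hex (n - 1 - col m₀)
    have h4 := ht (n - 1 - col m₀) (by omega) (by omega)
    omega

theorem IsLeftFactor.toMatrix_eq (h : IsLeftFactor q C F M) (hrow : StrictMono row)
    (hex : ∀ p c, q p = some c → ∃ l, row l = p) (cLast eLast : Fin r → Fin n) :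
    LeftBruhat.toMatrix (⟨r, C.submatrix id row, R, F.submatrix (fun m => row (R.symm m)) id,
      row, cLast, col, eLast⟩ : LeftBruhat K n) = leftPart M := by
  have h1 : C.submatrix id row * R.permMatrix K * F.submatrix (fun m => row (R.symm m)) id =
      C * F := by
    rw [Matrix.mul_assoc, PEquiv.toMatrix_toPEquiv_mul, ← h.mul_eq hrow hex]
    congr 1
    ext l c
    simp
  ext i c
  simp only [LeftBruhat.toMatrix, leftPart, Matrix.of_apply]
  split_ifs with hic
  · rw [h1, ← h.factor i c (by omega)]
  · rfl

end LeadingBlocks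

/-! ### The generator of a sum of left triangular matrices -/

section Generator

variable {K : Type u} {n : ℕ}

/-- The memory contains the entries of the left Bruhat generator `g` at the addresses given by
`a`. -/
def LeftBruhat.Stored (g : LeftBruhat K n) (mem : List K) (a : LeftBruhat ℕ n) : Prop :=
  a.map (fun x => mem[x]?) = g.map some

theorem LeftBruhat.Stored.mono {mem mem' : List K} {a : LeftBruhat ℕ n} {g : LeftBruhat K n}
    (h : g.Stored mem a) (hm : mem <+: mem') : g.Stored mem' a := by
  obtain ⟨r, C, R, E, c₁, c₂, e₁, e₂⟩ := a
  obtain ⟨r', C', R', E', c₁', c₂', e₁', e₂'⟩ := g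
  simp only [LeftBruhat.Stored, LeftBruhat.map, LeftBruhat.mk.injEq] at h ⊢
  obtain ⟨rfl, hC, hR, hE, h1, h2, h3, h4⟩ := h
  refine ⟨rfl, heq_of_eq ?_, hR, heq_of_eq ?_, h1, h2, h3, h4⟩
  · ext1 i j
    exact hm.getElem?_some (congrFun (congrFun (eq_of_heq hC) i) j)
  · ext1 i j
    exact hm.getElem?_some (congrFun (congrFun (eq_of_heq hE) i) j)

theorem LeftBruhat.Stored.exists_eq {mem : List K} {a : LeftBruhat ℕ n} {g : LeftBruhat K n}
    (h : g.Stored mem a) : ∃ C E, a = ⟨g.r, C, g.R, E, g.cFirst, g.cLast, g.eFirst, g.eLast⟩ ∧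
      Holds mem C g.C ∧ Holds mem E g.E := by
  obtain ⟨r, C, R, E, c₁, c₂, e₁, e₂⟩ := a
  obtain ⟨r', C', R', E', c₁', c₂', e₁', e₂'⟩ := g
  simp only [LeftBruhat.Stored, LeftBruhat.map, LeftBruhat.mk.injEq] at h
  obtain ⟨rfl, hC, hR, hE, h1, h2, h3, h4⟩ := h
  cases hR
  cases h1
  cases h2
  cases h3
  cases h4
  exact ⟨C, E, rfl, fun i j => congrFun (congrFun (eq_of_heq hC) i) j,
    fun i j => congrFun (congrFun (eq_of_heq hE) i) j⟩

/-- The largest element of a finite set, or `d` if there is none. -/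
def Finset.greatestD (s : Finset (Fin n)) (d : Fin n) : Fin n :=
  if h : s.Nonempty then s.max' h else d

theorem Finset.greatestD_spec {s : Finset (Fin n)} {d : Fin n} (hd : d ∈ s) :
    s.greatestD d ∈ s ∧ ∀ i ∈ s, i ≤ s.greatestD d := by
  have h : s.Nonempty := ⟨d, hd⟩
  rw [Finset.greatestD, dif_pos h]
  exact ⟨s.max'_mem h, fun i hi => s.le_max' i hi⟩

variable [Field K]

/-- From a decomposition to a left Bruhat generator: zero tests find the last non-zero entries, and
the tested positions are at most `2 * n * s` if the leading blocks have rank at most `s`. -/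
theorem exists_prog_generator (q : Fin n → Option (Fin n)) :
    ∃ P : Matrix (Fin n) (Fin n) ℕ → Matrix (Fin n) (Fin n) ℕ → Prog K (LeftBruhat ℕ n),
      ∀ (C F M : Matrix (Fin n) (Fin n) K) (aC aF : Matrix (Fin n) (Fin n) ℕ) (mem : List K)
        (s : ℕ), IsLeftFactor q C F M → (∀ k, 1 ≤ k → k < n → (leftBlock M k).rank ≤ s) →
        Holds mem aC C → Holds mem aF F →
        (P aC aF).Runs mem (2 * (n * s)) fun a mem' => ∃ g : LeftBruhat K n, g.Stored mem' a ∧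
          (∀ t, (∀ k, 1 ≤ k → k < n → (leftBlock M k).rank ≤ t) → g.IsValid t) ∧
          g.toMatrix = leftPart M := by
  by_cases hq : ∀ i j c, q i = some c → q j = some c → i = j
  swap
  -- without distinct leading positions there is nothing to prove
  · exact ⟨fun _ _ => .ret ⟨0, 0, 1, 0, fun i => i.elim0, fun i => i.elim0, fun i => i.elim0,
      fun i => i.elim0⟩, fun C F M aC aF mem s h => absurd h.inj hq⟩
  obtain ⟨r, row, col, R, hrow, hcol, hR, hex⟩ := exists_lead_order q hq
  -- the positions where a column of `C`, or a row of `E`, can be non-zero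
  let s₁ : Finset (Fin n × Fin r) :=
    Finset.univ.filter fun x => row x.2 ≤ x.1 ∧ x.1 + col (R x.2) + 2 ≤ n
  let s₂ : Finset (Fin n × Fin r) :=
    Finset.univ.filter fun x => col (R x.2) ≤ x.1 ∧ row x.2 + x.1 + 2 ≤ n
  obtain ⟨Z₁, hZ₁⟩ := exists_prog_isNonzero (K := K) s₁
  obtain ⟨Z₂, hZ₂⟩ := exists_prog_isNonzero (K := K) s₂
  refine ⟨fun aC aF => (Z₁ fun x => aC x.1 (row x.2)).bind fun u =>
    (Z₂ fun x => aF (row x.2) x.1).bind fun w =>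
      .ret ⟨r, aC.submatrix id row, R, aF.submatrix (fun m => row (R.symm m)) id, row,
        fun l => (Finset.univ.filter fun i => (i, l) ∈ u).greatestD (row l), col,
        fun m => (Finset.univ.filter fun c => (c, R.symm m) ∈ w).greatestD (col m)⟩, ?_⟩
  intro C F M aC aF mem s h hs hC hF
  have hcount := h.card_le_rank hrow hcol hR hex
  have hR' : ∀ m, q (row (R.symm m)) = some (col m) := fun m => by rw [hR, R.apply_symm_apply]
  have hcard : ∀ t : Finset (Fin n × Fin r), (∀ x ∈ t, ∃ k, 1 ≤ k ∧ k < n ∧ ∀ y ∈ t, y.1 = x.1 →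
      (row y.2 : ℕ) < k ∧ (col (R y.2) : ℕ) + k < n) → t.card ≤ n * s := by
    intro t ht
    refine (Finset.card_le_mul_card_image (f := Prod.fst) t s ?_).trans ?_
    · intro i hi
      obtain ⟨x, hx, rfl⟩ := Finset.mem_image.1 hi
      obtain ⟨k, hk, hkn, hk'⟩ := ht x hx
      refine le_trans ?_ ((hcount k).trans (hs k hk hkn))
      refine Finset.card_le_card_of_injOn Prod.snd ?_ ?_
      · intro y hy
        have hy := Finset.mem_filter.1 hy
        simpa using hk' y hy.1 hy.2
      · intro y hy y' hy' hyy
        have hy := Finset.mem_filter.1 hy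
        have hy' := Finset.mem_filter.1 hy'
        exact Prod.ext (hy.2.trans hy'.2.symm) hyy
    · rw [mul_comm]
      exact Nat.mul_le_mul_right s ((Finset.card_le_univ _).trans (by simp))
  have hc₁ : s₁.card ≤ n * s := hcard s₁ fun x hx => by
    have hx := (Finset.mem_filter.1 hx).2
    refine ⟨x.1 + 1, by omega, by omega, fun y hy hyx => ?_⟩
    have hy := (Finset.mem_filter.1 hy).2
    rw [hyx] at hy
    have := Fin.le_def.1 hy.1
    omega
  have hc₂ : s₂.card ≤ n * s := hcard s₂ fun x hx => by
    have hx := (Finset.mem_filter.1 hx).2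
    refine ⟨n - 1 - x.1, by omega, by omega, fun y hy hyx => ?_⟩
    have hy := (Finset.mem_filter.1 hy).2
    rw [hyx] at hy
    have := Fin.le_def.1 hy.1
    omega
  have hc₁' : (s₁.card : ℝ) ≤ n * s := by exact_mod_cast hc₁
  have hc₂' : (s₂.card : ℝ) ≤ n * s := by exact_mod_cast hc₂
  refine ((hZ₁ _ (fun x => C x.1 (row x.2)) mem fun x _ => hC _ _).bind fun u mem₁ hm₁ hu =>
    (hZ₂ _ (fun x => F (row x.2) x.1) mem₁ fun x _ => (hF.mono hm₁) _ _).bind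
      fun w mem₂ hm₂ hw => Prog.runs_ret ?_).mono (by linarith) fun _ _ _ h => h
  have hu' : ∀ i l, i ∈ (Finset.univ.filter fun i => (i, l) ∈ u) ↔ C i (row l) ≠ 0 := by
    intro i l
    rw [Finset.mem_filter, hu, Finset.mem_filter]
    simp only [Finset.mem_univ, true_and, and_iff_right_iff_imp]
    intro h0
    obtain ⟨h1, c, h2, h3⟩ := h.supp_C _ _ h0
    rw [hR] at h2
    cases h2
    exact ⟨h1, h3⟩
  have hw' : ∀ c m, c ∈ (Finset.univ.filter fun c => (c, R.symm m) ∈ w) ↔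
      F (row (R.symm m)) c ≠ 0 := by
    intro c m
    rw [Finset.mem_filter, hw, Finset.mem_filter]
    simp only [Finset.mem_univ, true_and, and_iff_right_iff_imp, Equiv.apply_symm_apply]
    intro h0
    obtain ⟨h1, c', h2, h3⟩ := h.supp_F _ _ h0
    rw [hR'] at h2
    cases h2
    exact ⟨h3, h1⟩
  refine ⟨⟨r, C.submatrix id row, R, F.submatrix (fun m => row (R.symm m)) id, row,
      fun l => (Finset.univ.filter fun i => (i, l) ∈ u).greatestD (row l), col,
      fun m => (Finset.univ.filter fun c => (c, R.symm m) ∈ w).greatestD (col m)⟩, ?_, ?_,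
      h.toMatrix_eq hrow hex _ _⟩
  · have h1 : (aC.submatrix id row).map (fun x => mem₂[x]?) = (C.submatrix id row).map some := by
      ext1 i l
      exact (hC.mono (hm₁.trans hm₂)) i (row l)
    have h2 : (aF.submatrix (fun m => row (R.symm m)) id).map (fun x => mem₂[x]?) =
        (F.submatrix (fun m => row (R.symm m)) id).map some := by
      ext1 m c
      exact (hF.mono (hm₁.trans hm₂)) _ c
    simp only [LeftBruhat.Stored, LeftBruhat.map, h1, h2]
  · intro t ht
    refine h.isValid hrow hcol hR hex (fun l => ?_) (fun m => ?_) ht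
    · have := Finset.greatestD_spec ((hu' _ _).2 (h.diag_C _ _ (hR l)))
      exact ⟨(hu' _ _).1 this.1, fun i hi => this.2 i ((hu' _ _).2 hi)⟩
    · have := Finset.greatestD_spec ((hw' _ _).2 (h.diag_F _ _ (hR' m)))
      exact ⟨(hw' _ _).1 this.1, fun i hi => this.2 i ((hw' _ _).2 hi)⟩

theorem IsColEchelon.first {m r : ℕ} {C : Matrix (Fin m) (Fin r) K} (h : IsColEchelon C)
    {f g : Fin r → Fin m} (hr : ∀ l, IsColRange C l (f l) (g l)) :
    StrictMono f ∧ ∀ l, C (f l) l ≠ 0 ∧ ∀ i < f l, C i l = 0 := by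
  obtain ⟨p, hp, hC⟩ := h
  have : f = p := funext fun l => le_antisymm ((hr l).2.2 _ (hC l).1).1 (by
    by_contra h0
    exact (hr l).1 ((hC l).2 _ (not_le.1 h0)))
  subst this
  exact ⟨hp, hC⟩

/-- The first positions of the terms of a valid generator belong to distinct leading positions, and
their number in a leading block is at most the rank of this block. -/
theorem LeftBruhat.IsValid.card_le_rank {t : ℕ} {g : LeftBruhat K n} (h : g.IsValid t) (k : ℕ) :
    (Finset.univ.filter fun l => (g.cFirst l : ℕ) < k ∧ (g.eFirst (g.R l) : ℕ) + k < n).card ≤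
      (leftBlock g.toMatrix k).rank := by
  obtain ⟨hC, -, hE, -, hc, he⟩ := h
  obtain ⟨hc1, hc2⟩ := hC.first hc
  obtain ⟨he1, he2⟩ := IsColEchelon.first hE he
  refine card_leads_le_rank (C := g.C) (F := g.E.submatrix g.R id) hc1.injective hc2
    (he1.injective.comp g.R.injective) (fun l => he2 (g.R l)) (fun i c hic => ?_) k
  rw [LeftBruhat.toMatrix, leftPart, Matrix.of_apply, if_pos (by omega), Matrix.mul_assoc,
    PEquiv.toMatrix_toPEquiv_mul]

theorem card_filter_Ico_le {r : ℕ} {f : Fin r → Fin n} (hf : Function.Injective f) (k b : ℕ) :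
    (Finset.univ.filter fun l => k ≤ (f l : ℕ) ∧ (f l : ℕ) < k + b).card ≤ b := by
  refine (Finset.card_le_card_of_injOn (t := Finset.Ico k (k + b)) (fun l => (f l : ℕ)) ?_
    ?_).trans (by simp)
  · intro l hl
    have := (Finset.mem_filter.1 hl).2
    simpa using this
  · intro l _ l' _ h
    exact hf (Fin.ext h)

theorem card_filter_append {a b : ℕ} (p : Fin (a + b) → Prop) [DecidablePred p] :
    (Finset.univ.filter p).card = (Finset.univ.filter fun i => p (Fin.castAdd b i)).card +
      (Finset.univ.filter fun i => p (Fin.natAdd a i)).card := by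
  simp only [Finset.card_filter, Fin.sum_univ_add]

theorem Matrix.rank_add_le_rank_add_rank {α β : Type*} [Fintype α] [Fintype β]
    (A B : Matrix α β K) : (A + B).rank ≤ A.rank + B.rank := by
  rw [Matrix.rank, Matrix.rank, Matrix.rank, Matrix.mulVecLin_add]
  exact (Submodule.finrank_mono (LinearMap.range_add_le _ _)).trans
    (Submodule.finrank_add_le_finrank_add_finrank _ _)

end Generator

section Sum

variable {K : Type u} [Field K] {n : ℕ}

theorem leftBlock_add_rank_le (M M' : Matrix (Fin n) (Fin n) K) (k : ℕ) :
    (leftBlock (M + M') k).rank ≤ (leftBlock M k).rank + (leftBlock M' k).rank :=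
  Matrix.rank_add_le_rank_add_rank (leftBlock M k) (leftBlock M' k)

/-- The largest number of terms that start in a common block of the first `k` rows and the first
`n - k` columns, but at least `1`. It is the size of the blocks in the algorithm; unlike the order
of quasiseparability it can be read off the input. -/
def overlapWidth {r : ℕ} (n : ℕ) (pr qr : Fin r → ℕ) : ℕ :=
  max 1 ((Finset.range n).sup fun k =>
    (Finset.univ.filter fun g => pr g < k ∧ qr g + k < n).card)

theorem card_le_overlapWidth {r : ℕ} (n : ℕ) (pr qr : Fin r → ℕ) (k : ℕ) :
    (Finset.univ.filter fun g => pr g < k ∧ qr g + k < n).card ≤ overlapWidth n pr qr := by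
  by_cases hk : k < n
  · exact (Finset.le_sup (f := fun k => (Finset.univ.filter fun g => pr g < k ∧ qr g + k < n).card)
      (Finset.mem_range.2 hk)).trans (le_max_right _ _)
  · rw [Finset.filter_false_of_mem fun g _ => by omega]
    exact Nat.zero_le _

theorem LeftBruhat.toMatrix_apply (g : LeftBruhat K n) {i c : Fin n} (h : i + c + 2 ≤ n) :
    g.toMatrix i c = ∑ l, g.C i l * g.E (g.R l) c := by
  rw [LeftBruhat.toMatrix, leftPart, Matrix.of_apply, if_pos (by omega), Matrix.mul_assoc,
    PEquiv.toMatrix_toPEquiv_mul, Matrix.mul_apply]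
  rfl

/-- The terms of two generators together form a staircase. -/
theorem isStaircase_append {gA gB : LeftBruhat K n} {tA tB : ℕ} (hA : gA.IsValid tA)
    (hB : gB.IsValid tB) :
    let pr := Fin.append (fun l => (gA.cFirst l : ℕ)) fun l => (gB.cFirst l : ℕ)
    let qr := Fin.append (fun l => (gA.eFirst (gA.R l) : ℕ)) fun l => (gB.eFirst (gB.R l) : ℕ)
    IsStaircase (overlapWidth n pr qr) pr qr (Matrix.of fun i => Fin.append (gA.C i) (gB.C i))
      (Matrix.of (Fin.append (fun l => gA.E (gA.R l)) fun l => gB.E (gB.R l))) := by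
  intro pr qr
  obtain ⟨hA1, -, hA2, -, hA3, hA4⟩ := hA
  obtain ⟨hB1, -, hB2, -, hB3, hB4⟩ := hB
  have hb : 1 ≤ overlapWidth n pr qr := le_max_left _ _
  refine ⟨hb, ?_, ?_, card_le_overlapWidth n pr qr, ?_, ?_⟩
  · intro i g
    refine Fin.addCases (fun l => ?_) (fun l => ?_) g
    · simpa [pr] using fun h => ((hA3 l).2.2 i h).1
    · simpa [pr] using fun h => ((hB3 l).2.2 i h).1
  · intro g c
    refine Fin.addCases (fun l => ?_) (fun l => ?_) g
    · simpa [qr] using fun h => ((hA4 _).2.2 c h).1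
    · simpa [qr] using fun h => ((hB4 _).2.2 c h).1
  · intro k
    rw [card_filter_append, two_mul]
    simp only [pr, Fin.append_left, Fin.append_right]
    exact Nat.add_le_add (card_filter_Ico_le (hA1.first hA3).1.injective k _)
      (card_filter_Ico_le (hB1.first hB3).1.injective k _)
  · intro k
    rw [card_filter_append, two_mul]
    simp only [qr, Fin.append_left, Fin.append_right]
    exact Nat.add_le_add
      (card_filter_Ico_le ((IsColEchelon.first hA2 hA4).1.injective.comp gA.R.injective) k _)
      (card_filter_Ico_le ((IsColEchelon.first hB2 hB4).1.injective.comp gB.R.injective) k _)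

theorem overlapWidth_append_le {gA gB : LeftBruhat K n} {tA tB sA sB : ℕ} (hA : gA.IsValid tA)
    (hB : gB.IsValid tB) (hsA : ∀ k, 1 ≤ k → k < n → (leftBlock gA.toMatrix k).rank ≤ sA)
    (hsB : ∀ k, 1 ≤ k → k < n → (leftBlock gB.toMatrix k).rank ≤ sB) :
    overlapWidth n (Fin.append (fun l => (gA.cFirst l : ℕ)) fun l => (gB.cFirst l : ℕ)) (
      Fin.append (fun l => (gA.eFirst (gA.R l) : ℕ)) fun l => (gB.eFirst (gB.R l) : ℕ)) ≤
      max 1 (sA + sB) := by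
  refine max_le_max le_rfl (Finset.sup_le fun k hk => ?_)
  have hk := Finset.mem_range.1 hk
  rcases Nat.eq_zero_or_pos k with rfl | h0
  · simp
  · rw [card_filter_append]
    simp only [Fin.append_left, Fin.append_right]
    exact Nat.add_le_add ((hA.card_le_rank k).trans (hsA k h0 hk))
      ((hB.card_le_rank k).trans (hsB k h0 hk))

/-- A left Bruhat generator of a sum is computed in `O(n * s ^ (ω - 1) + s ^ ω)` field operations,
where `s` bounds the sum of the ranks of corresponding leading blocks. -/
theorem exists_prog_leftSum {ω Cω CRF : ℝ} (hω : 2 < ω) (hMM : MatMulTime K ω Cω)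
    (hRF : CRETime K ω CRF) : ∃ κ : ℝ, 0 ≤ κ ∧ ∀ n : ℕ,
      ∃ P : LeftBruhat ℕ n → LeftBruhat ℕ n → Prog K (LeftBruhat ℕ n),
      ∀ (aA aB : LeftBruhat ℕ n) (gA gB : LeftBruhat K n) (tA tB sA sB : ℕ) (mem : List K),
        gA.Stored mem aA → gB.Stored mem aB → gA.IsValid tA → gB.IsValid tB →
        (∀ k, 1 ≤ k → k < n → (leftBlock gA.toMatrix k).rank ≤ sA) →
        (∀ k, 1 ≤ k → k < n → (leftBlock gB.toMatrix k).rank ≤ sB) →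
        (P aA aB).Runs mem (κ * (n * ((max 1 (sA + sB) : ℕ) : ℝ) ^ (ω - 1) +
            ((max 1 (sA + sB) : ℕ) : ℝ) ^ ω)) fun a mem' =>
          ∃ g : LeftBruhat K n, g.Stored mem' a ∧ g.toMatrix = gA.toMatrix + gB.toMatrix ∧
          ∀ t, (∀ k, 1 ≤ k → k < n → (leftBlock (gA.toMatrix + gB.toMatrix) k).rank ≤ t) →
            g.IsValid t := by
  obtain ⟨κ, hκ, hLF⟩ := exists_prog_leftFactor hω hMM hRF
  refine ⟨κ * (5 : ℝ) ^ ω + 2, by positivity, fun n => ?_⟩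
  choose LF hLF using fun m : ℕ => hLF (Fin m) n
  choose Gen hGen using fun q => exists_prog_generator (K := K) (n := n) q
  refine ⟨fun aA aB =>
    let pr := Fin.append (fun l => (aA.cFirst l : ℕ)) fun l => (aB.cFirst l : ℕ)
    let qr := Fin.append (fun l => (aA.eFirst (aA.R l) : ℕ)) fun l => (aB.eFirst (aB.R l) : ℕ)
    let b := overlapWidth n pr qr
    (LF (aA.r + aB.r) b (n / b + 1) pr qr (Matrix.of fun i => Fin.append (aA.C i) (aB.C i))
      (Matrix.of (Fin.append (fun l => aA.E (aA.R l)) fun l => aB.E (aB.R l)))).bind fun x =>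
        Gen x.1 x.2.1 x.2.2, ?_⟩
  intro aA aB gA gB tA tB sA sB mem hA hB vA vB hsA hsB
  have hstair := isStaircase_append vA vB
  have hwidth := overlapWidth_append_le vA vB hsA hsB
  obtain ⟨CA, EA, rfl, hCA, hEA⟩ := hA.exists_eq
  obtain ⟨CB, EB, rfl, hCB, hEB⟩ := hB.exists_eq
  dsimp only at hstair ⊢
  set pr := Fin.append (fun l => (gA.cFirst l : ℕ)) fun l => (gB.cFirst l : ℕ) with hpr
  set qr := 
    Fin.append (fun l => (gA.eFirst (gA.R l) : ℕ)) fun l => (gB.eFirst (gB.R l) : ℕ) with hqr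
  set b := overlapWidth n pr qr with hb
  set s := max 1 (sA + sB) with hs
  set Ct : Matrix (Fin n) (Fin (gA.r + gB.r)) K := Matrix.of fun i => Fin.append (gA.C i) (gB.C i)
  set G : Matrix (Fin (gA.r + gB.r)) (Fin n) K :=
    Matrix.of (Fin.append (fun l => gA.E (gA.R l)) fun l => gB.E (gB.R l))
  have hb1 : 1 ≤ b := hstair.one_le
  have hCt : Holds mem (Matrix.of fun i => Fin.append (CA i) (CB i)) Ct := by
    intro i g
    refine Fin.addCases (fun l => ?_) (fun l => ?_) g
    · simpa [Ct] using hCA i l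
    · simpa [Ct] using hCB i l
  have hG : Holds mem (Matrix.of (Fin.append (fun l => EA (gA.R l)) fun l => EB (gB.R l))) G := by
    intro g c
    refine Fin.addCases (fun l => ?_) (fun l => ?_) g
    · simpa [G] using hEA _ c
    · simpa [G] using hEB _ c
  have hprod : ∀ i c : Fin n, i + c + 2 ≤ n →
      (Ct * G) i c = (gA.toMatrix + gB.toMatrix) i c := by
    intro i c h
    rw [Matrix.add_apply, gA.toMatrix_apply h, gB.toMatrix_apply h, Matrix.mul_apply,
      Fin.sum_univ_add]
    simp [Ct, G]
  have hleft : leftPart (Ct * G) = gA.toMatrix + gB.toMatrix := by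
    ext i c
    by_cases h : (i : ℕ) + c + 2 ≤ n
    · rw [← hprod i c h, leftPart, Matrix.of_apply, if_pos (by omega)]
    · have h' : ¬ ((i : ℕ) + 1 + (c + 1) ≤ n) := by omega
      simp [leftPart, LeftBruhat.toMatrix, h']
  have hrank : ∀ k, 1 ≤ k → k < n → (leftBlock (Ct * G) k).rank ≤ sA + sB := by
    intro k h1 h2
    rw [leftBlock_congr hprod]
    exact (leftBlock_add_rank_le _ _ k).trans (Nat.add_le_add (hsA k h1 h2) (hsB k h1 h2))
  have hN : n ≤ (n / b + 1) * b := by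
    rw [add_mul, one_mul]
    exact (Nat.lt_div_mul_add hb1).le
  refine ((hLF _ b (n / b + 1) pr qr Ct G _ _ mem hstair hN hCt hG).bind
    fun x mem₁ hm₁ ⟨C, F, hC, hF, hx⟩ => hGen x.1 C F _ _ _ mem₁ (sA + sB) hx hrank hC hF).mono
      ?_ ?_
  · have hs1 : (1 : ℝ) ≤ s := by exact_mod_cast (le_max_left 1 (sA + sB))
    have hs0 : (0 : ℝ) < s := by linarith
    have hbs : (b : ℝ) ≤ s := by exact_mod_cast hwidth
    have hb0 : (0 : ℝ) < b := by exact_mod_cast hb1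
    have h1 : ((5 * b : ℕ) : ℝ) ^ ω = 5 ^ ω * (b * (b : ℝ) ^ (ω - 1)) := by
      push_cast
      rw [Real.mul_rpow (by norm_num) hb0.le]
      congr 1
      rw [← Real.rpow_one_add' hb0.le (by linarith)]
      congr 1
      ring
    have h2 : ((n / b + 1 : ℕ) : ℝ) * b ≤ n + s := by
      have : (n / b + 1) * b ≤ n + b := by
        rw [add_mul, one_mul]
        exact Nat.add_le_add_right (Nat.div_mul_le_self n b) b
      have : ((n / b + 1 : ℕ) : ℝ) * b ≤ n + b := by exact_mod_cast this
      linarith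
    have h3 : (b : ℝ) ^ (ω - 1) ≤ (s : ℝ) ^ (ω - 1) :=
      Real.rpow_le_rpow hb0.le hbs (by linarith)
    have h4 : (s : ℝ) ≤ (s : ℝ) ^ (ω - 1) := by
      conv_lhs => rw [← Real.rpow_one (s : ℝ)]
      exact Real.rpow_le_rpow_of_exponent_le hs1 (by linarith)
    have h5 : (s : ℝ) ^ ω = s * (s : ℝ) ^ (ω - 1) := by
      rw [← Real.rpow_one_add' hs0.le (by linarith)]
      congr 1
      ring
    have h6 : ((sA + sB : ℕ) : ℝ) ≤ s := by exact_mod_cast (le_max_right 1 (sA + sB))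
    have h7 : ((n / b + 1 : ℕ) : ℝ) * b * (b : ℝ) ^ (ω - 1) ≤ (n + s) * (s : ℝ) ^ (ω - 1) :=
      mul_le_mul h2 h3 (by positivity) (by positivity)
    have h8 : (n : ℝ) * (sA + sB : ℕ) ≤ n * (s : ℝ) ^ (ω - 1) :=
      mul_le_mul_of_nonneg_left (h6.trans h4) (by positivity)
    have h9 : 0 ≤ (s : ℝ) * (s : ℝ) ^ (ω - 1) := by positivity
    have h10 := mul_le_mul_of_nonneg_left h7 (show 0 ≤ κ * (5 : ℝ) ^ ω by positivity)
    rw [h1, h5]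
    push_cast at h8 h10 ⊢
    linarith
  · rintro a mem' - ⟨g, hg1, hg2, hg3⟩
    refine ⟨g, hg1, hg3.trans hleft, fun t ht => hg2 t fun k h1 h2 => ?_⟩
    rw [leftBlock_congr hprod]
    exact ht k h1 h2

end Sum

/-! ### The strictly triangular parts -/

section Triangular

variable {K : Type u} {n : ℕ}

theorem Bruhat.stored_iff {mem : List K} {a : Bruhat ℕ n} {g : Bruhat K n} :
    Bruhat.Stored mem a g ↔
      (∀ i, mem[a.D i]? = some (g.D i)) ∧ g.L.Stored mem a.L ∧ g.U.Stored mem a.U := by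
  simp only [Bruhat.Stored, Bruhat.map, Bruhat.mk.injEq, funext_iff, LeftBruhat.Stored]

variable [Field K]

theorem antiIdentity_mul (M : Matrix (Fin n) (Fin n) K) :
    antiIdentity K n * M = M.submatrix Fin.rev id := by
  ext i j
  simp [antiIdentity, Matrix.mul_apply]

theorem mul_antiIdentity (M : Matrix (Fin n) (Fin n) K) :
    M * antiIdentity K n = M.submatrix id Fin.rev := by
  ext i j
  simp only [antiIdentity, Matrix.mul_apply, Matrix.of_apply, Matrix.submatrix_apply, id]
  rw [Finset.sum_eq_single j.rev]
  · simp
  · intro l _ hl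
    rw [if_neg fun h => hl (by rw [h, Fin.rev_rev]), mul_zero]
  · simp

theorem LeftBruhat.toMatrix_apply_eq_zero (g : LeftBruhat K n) {i c : Fin n}
    (h : n < i + c + 2) : g.toMatrix i c = 0 := by
  rw [LeftBruhat.toMatrix, leftPart, Matrix.of_apply, if_neg (by omega)]

theorem Bruhat.Represents.apply_upper {g : Bruhat K n} {t : ℕ} {A : Matrix (Fin n) (Fin n) K}
    (h : g.Represents t A) {i j : Fin n} (hij : i < j) : A i j = g.U.toMatrix i j.rev := by
  have := Fin.lt_def.1 hij
  rw [h.2.2, antiIdentity_mul, mul_antiIdentity, Matrix.add_apply, Matrix.add_apply,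
    Matrix.diagonal_apply_ne _ hij.ne, Matrix.submatrix_apply, Matrix.submatrix_apply,
    g.L.toMatrix_apply_eq_zero (by rw [Fin.val_rev, id]; omega), zero_add, zero_add, id]

theorem Bruhat.Represents.apply_lower {g : Bruhat K n} {t : ℕ} {A : Matrix (Fin n) (Fin n) K}
    (h : g.Represents t A) {i j : Fin n} (hij : j < i) : A i j = g.L.toMatrix i.rev j := by
  have := Fin.lt_def.1 hij
  rw [h.2.2, antiIdentity_mul, mul_antiIdentity, Matrix.add_apply, Matrix.add_apply,
    Matrix.diagonal_apply_ne _ hij.ne', Matrix.submatrix_apply, Matrix.submatrix_apply,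
    g.U.toMatrix_apply_eq_zero (by rw [Fin.val_rev, id]; omega), zero_add, add_zero, id]

theorem IsQuasiseparable.rank_leftBlock_upper {A U : Matrix (Fin n) (Fin n) K} {t : ℕ}
    (hA : IsQuasiseparable t A) (hU : ∀ i j : Fin n, i < j → A i j = U i j.rev) (k : ℕ)
    (h1 : 1 ≤ k) (h2 : k < n) : (leftBlock U k).rank ≤ t := by
  refine le_trans (le_of_eq ?_) (hA k h1 h2.le).1
  let e : {j : Fin n // (j : ℕ) + k < n} ≃ {j : Fin n // k ≤ (j : ℕ)} :=
    Fin.revPerm.subtypeEquiv fun j => by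
      rw [Fin.revPerm_apply, Fin.val_rev]
      omega
  rw [← Matrix.rank_submatrix _ (Equiv.refl _) e]
  congr 1
  ext ⟨i, hi⟩ ⟨j, hj⟩
  have : i < j.rev := by
    rw [Fin.lt_def, Fin.val_rev]
    omega
  exact ((hU i j.rev this).trans (by rw [Fin.rev_rev]; rfl)).symm

theorem IsQuasiseparable.rank_leftBlock_lower {A L : Matrix (Fin n) (Fin n) K} {t : ℕ}
    (hA : IsQuasiseparable t A) (hL : ∀ i j : Fin n, j < i → A i j = L i.rev j) (k : ℕ)
    (h1 : 1 ≤ k) (h2 : k < n) : (leftBlock L k).rank ≤ t := by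
  refine le_trans (le_of_eq ?_) (hA (n - k) (by omega) (by omega)).2
  let e : {i : Fin n // (i : ℕ) < k} ≃ {i : Fin n // n - k ≤ (i : ℕ)} :=
    Fin.revPerm.subtypeEquiv fun i => by
      rw [Fin.revPerm_apply, Fin.val_rev]
      omega
  let f : {j : Fin n // (j : ℕ) + k < n} ≃ {j : Fin n // (j : ℕ) < n - k} :=
    (Equiv.refl _).subtypeEquiv fun j => by
      rw [Equiv.refl_apply]
      omega
  rw [← Matrix.rank_submatrix _ e f]
  congr 1
  ext ⟨i, hi⟩ ⟨j, hj⟩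
  have : j < i.rev := by
    rw [Fin.lt_def, Fin.val_rev]
    omega
  exact ((hL i.rev j this).trans (by rw [Fin.rev_rev]; rfl)).symm

theorem IsQuasiseparable.add {A B : Matrix (Fin n) (Fin n) K} {s t : ℕ}
    (hA : IsQuasiseparable s A) (hB : IsQuasiseparable t B) : IsQuasiseparable (s + t) (A + B) :=
  fun k h1 h2 =>
    ⟨(Matrix.rank_add_le_rank_add_rank _ _).trans (Nat.add_le_add (hA k h1 h2).1 (hB k h1 h2).1),
      (Matrix.rank_add_le_rank_add_rank _ _).trans (Nat.add_le_add (hA k h1 h2).2 (hB k h1 h2).2)⟩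

end Triangular

/-! ### Bruhat generators of sums -/

/-- A Bruhat generator of a sum is computed in `O(n * s ^ (ω - 1) + s ^ ω)` field operations. -/
theorem exists_prog_bruhatSum {K : Type u} [Field K] {ω Cω CRF : ℝ} (hω : 2 < ω)
    (hMM : MatMulTime K ω Cω) (hRF : CRETime K ω CRF) : ∃ κ : ℝ, 0 ≤ κ ∧ ∀ n : ℕ,
      ∃ P : Bruhat ℕ n → Bruhat ℕ n → Prog K (Bruhat ℕ n),
      ∀ (sA sB : ℕ) (A B : Matrix (Fin n) (Fin n) K) (gA gB : Bruhat K n) (aA aB : Bruhat ℕ n)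
        (mem : List K), IsQuasiseparable sA A → IsQuasiseparable sB B →
        gA.Represents sA A → gB.Represents sB B →
        Bruhat.Stored mem aA gA → Bruhat.Stored mem aB gB →
        (P aA aB).Runs mem (κ * (n * ((max 1 (sA + sB) : ℕ) : ℝ) ^ (ω - 1) +
            ((max 1 (sA + sB) : ℕ) : ℝ) ^ ω)) fun a mem' =>
          ∃ g : Bruhat K n, Bruhat.Stored mem' a g ∧
            ∀ t, IsQuasiseparable t (A + B) → g.Represents t (A + B) := by
  obtain ⟨κ, hκ, hLS⟩ := exists_prog_leftSum hω hMM hRF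
  refine ⟨1 + 2 * κ, by positivity, fun n => ?_⟩
  obtain ⟨Add, hAdd⟩ := exists_prog_add (K := K) n
  obtain ⟨LS, hLS⟩ := hLS n
  refine ⟨fun aA aB => (Add aA.D aB.D).bind fun d => (LS aA.L aB.L).bind fun l =>
    (LS aA.U aB.U).bind fun u => .ret ⟨d, l, u⟩, ?_⟩
  intro sA sB A B gA gB aA aB mem qA qB rA rB hA hB
  obtain ⟨hAD, hAL, hAU⟩ := Bruhat.stored_iff.1 hA
  obtain ⟨hBD, hBL, hBU⟩ := Bruhat.stored_iff.1 hB
  set s := max 1 (sA + sB) with hs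
  refine ((hAdd _ _ _ _ mem hAD hBD).bind fun d mem₁ hm₁ hd =>
    (hLS _ _ _ _ _ _ sA sB mem₁ (hAL.mono hm₁) (hBL.mono hm₁) rA.1 rB.1
      (qA.rank_leftBlock_lower fun i j => rA.apply_lower)
      (qB.rank_leftBlock_lower fun i j => rB.apply_lower)).bind fun l mem₂ hm₂ ⟨gl, hl⟩ =>
    (hLS _ _ _ _ _ _ sA sB mem₂ (hAU.mono (hm₁.trans hm₂)) (hBU.mono (hm₁.trans hm₂)) rA.2.1
      rB.2.1 (qA.rank_leftBlock_upper fun i j => rA.apply_upper)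
      (qB.rank_leftBlock_upper fun i j => rB.apply_upper)).bind fun u mem₃ hm₃ ⟨gu, hu⟩ =>
    Prog.runs_ret ?_).mono ?_ fun _ _ _ h => h
  · refine ⟨⟨fun i => gA.D i + gB.D i, gl, gu⟩, Bruhat.stored_iff.2
      ⟨fun i => (hm₂.trans hm₃).getElem?_some (hd i), hl.1.mono hm₃, hu.1⟩, fun t ht => ?_⟩
    refine ⟨hl.2.2 t (ht.rank_leftBlock_lower fun i j hij => ?_),
      hu.2.2 t (ht.rank_leftBlock_upper fun i j hij => ?_), ?_⟩
    · rw [Matrix.add_apply, Matrix.add_apply, rA.apply_lower hij, rB.apply_lower hij]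
    · rw [Matrix.add_apply, Matrix.add_apply, rA.apply_upper hij, rB.apply_upper hij]
    · rw [hl.2.1, hu.2.1, rA.2.2, rB.2.2, mul_add, add_mul, ← Matrix.diagonal_add]
      abel
  · have h1 : (1 : ℝ) ≤ (s : ℝ) ^ (ω - 1) :=
      Real.one_le_rpow (by exact_mod_cast (le_max_left 1 (sA + sB))) (by linarith)
    have h2 : (n : ℝ) ≤ n * (s : ℝ) ^ (ω - 1) := le_mul_of_one_le_right (by positivity) h1
    have h3 : (0 : ℝ) ≤ (s : ℝ) ^ ω := by positivity
    linarith

/-- The logarithmic factor absorbs the constant of a linear bound. -/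
theorem exists_nat_linear_le_log {κ κ₀ ω : ℝ} (hω : 2 < ω) (hκ : 0 ≤ κ) (hκ₀ : 0 < κ₀) :
    ∃ N : ℕ, ∀ n s : ℕ, 1 ≤ s → N * s ≤ n →
      (⌈κ * (n * (s : ℝ) ^ (ω - 1) + (s : ℝ) ^ ω)⌉₊ : ℝ) ≤
        κ₀ * n * (s : ℝ) ^ (ω - 1) * Real.logb 2 ((n : ℝ) / s) := by
  obtain ⟨N, hN⟩ := exists_nat_ge ((2 : ℝ) ^ ((2 * κ + 1) / κ₀))
  refine ⟨N, fun n s hs hn => ?_⟩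
  have hs1 : (1 : ℝ) ≤ s := by exact_mod_cast hs
  have hs0 : (0 : ℝ) < s := by linarith
  have h2 : (1 : ℝ) ≤ (2 : ℝ) ^ ((2 * κ + 1) / κ₀) :=
    Real.one_le_rpow (by norm_num) (by positivity)
  have hn' : (N : ℝ) * s ≤ n := by exact_mod_cast hn
  have hns : (2 : ℝ) ^ ((2 * κ + 1) / κ₀) ≤ n / s := (le_div_iff₀ hs0).2
    ((mul_le_mul_of_nonneg_right hN hs0.le).trans hn')
  have hlog : (2 * κ + 1) / κ₀ ≤ Real.logb 2 ((n : ℝ) / s) :=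
    (Real.le_logb_iff_rpow_le (by norm_num) (by linarith)).2 hns
  have hlog' : 2 * κ + 1 ≤ κ₀ * Real.logb 2 ((n : ℝ) / s) := by
    rwa [div_le_iff₀' hκ₀] at hlog
  have hsn : (s : ℝ) ≤ n := by
    have := (le_div_iff₀ hs0).1 (h2.trans hns)
    linarith
  have h1 : (1 : ℝ) ≤ (s : ℝ) ^ (ω - 1) := Real.one_le_rpow hs1 (by linarith)
  have h5 : (s : ℝ) ^ ω = s * (s : ℝ) ^ (ω - 1) := by
    rw [← Real.rpow_one_add' hs0.le (by linarith)]
    congr 1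
    ring
  set y := (s : ℝ) ^ (ω - 1)
  have h6 : (s : ℝ) ^ ω ≤ n * y := h5 ▸ mul_le_mul_of_nonneg_right hsn (by linarith)
  have h7 : (1 : ℝ) ≤ n * y := one_le_mul_of_one_le_of_one_le (hs1.trans hsn) h1
  calc (⌈κ * (n * y + (s : ℝ) ^ ω)⌉₊ : ℝ) ≤ κ * (n * y + (s : ℝ) ^ ω) + 1 :=
        (Nat.ceil_lt_add_one (by positivity)).le
    _ ≤ κ * (n * y + n * y) + n * y := by gcongr
    _ = n * y * (2 * κ + 1) := by ring
    _ ≤ n * y * (κ₀ * Real.logb 2 ((n : ℝ) / s)) :=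
        mul_le_mul_of_nonneg_left hlog' (by linarith)
    _ = _ := by ring

theorem mainTheorem2 {K : Type*} [Field K] (ω Cω CRF : ℝ) (hω : 2 < ω) (hCω : 0 < Cω)
    (hCRF : 0 < CRF) (hMM : MatMulTime K ω Cω) (hRF : CRETime K ω CRF) :
    ∃ (alg : ∀ n : ℕ, Bruhat ℕ n → Bruhat ℕ n → Prog K (Bruhat ℕ n)) (time : ℕ → ℕ → ℕ → ℕ),
      (∀ (n sA sB : ℕ) (A B : Matrix (Fin n) (Fin n) K) (gA gB : Bruhat K n),
        IsQuasiseparable sA A → IsQuasiseparable sB B →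
        gA.Represents sA A → gB.Represents sB B →
        ∀ (mem : List K) (aA aB : Bruhat ℕ n),
          Bruhat.Stored mem aA gA → Bruhat.Stored mem aB gB →
          ∃ (out : Outcome K (Bruhat ℕ n)) (g : Bruhat K n),
            (alg n aA aB).run mem = some out ∧
            Bruhat.Stored out.memory out.result g ∧
            g.Represents (sA + sB) (A + B) ∧
            (∀ t : ℕ, IsQuasiseparable t (A + B) → g.Represents t (A + B)) ∧
            out.cost ≤ time n sA sB) ∧
      ∀ ε : ℝ, 0 < ε → ∃ N : ℕ, ∀ n sA sB s : ℕ, s = sA + sB → 1 ≤ s → N * s ≤ n →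
        (time n sA sB : ℝ) ≤ (1 + ε) *
          (((9 * (2 : ℝ) ^ (ω - 2) - 8) / ((2 : ℝ) ^ (ω - 2) - 1) * Cω + 2 * CRF) *
            n * (s : ℝ) ^ (ω - 1) * Real.logb 2 ((n : ℝ) / s)) := by
  obtain ⟨κ, hκ, hP⟩ := exists_prog_bruhatSum hω hMM hRF
  choose P hP using hP
  refine ⟨P, fun n sA sB => ⌈κ * (n * ((max 1 (sA + sB) : ℕ) : ℝ) ^ (ω - 1) +
    ((max 1 (sA + sB) : ℕ) : ℝ) ^ ω)⌉₊, ?_, ?_⟩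
  · intro n sA sB A B gA gB qA qB rA rB mem aA aB hA hB
    obtain ⟨out, hrun, -, ⟨g, hg, ht⟩, hcost⟩ := hP n sA sB A B gA gB aA aB mem qA qB rA rB hA hB
    exact ⟨out, g, hrun, hg, ht _ (qA.add qB), ht, Nat.cast_le.1 (hcost.trans (Nat.le_ceil _))⟩
  · intro ε hε
    have hx : (1 : ℝ) < (2 : ℝ) ^ (ω - 2) := Real.one_lt_rpow (by norm_num) (by linarith)
    have hκ₀ : 0 < (9 * (2 : ℝ) ^ (ω - 2) - 8) / ((2 : ℝ) ^ (ω - 2) - 1) * Cω + 2 * CRF := by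
      have := div_pos (show 0 < 9 * (2 : ℝ) ^ (ω - 2) - 8 by linarith)
        (show 0 < (2 : ℝ) ^ (ω - 2) - 1 by linarith)
      positivity
    obtain ⟨N, hN⟩ := exists_nat_linear_le_log hω hκ hκ₀
    refine ⟨N, ?_⟩
    rintro n sA sB s rfl hs hn
    have h := hN n (sA + sB) hs hn
    dsimp only
    rw [max_eq_right hs]
    exact h.trans (le_mul_of_one_le_left ((Nat.cast_nonneg _).trans h) (by linarith))
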